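/- **Setting.** Let $\mathcal T$ be a compact subset of a Euclidean space with a finite Borel measure $dt$ (for example Lebesgue measure), $L_2=L_2(\mathcal T)$, and let $\mathcal H\subset L_2$ be a reproducing kernel Hilbert space of real functions on $\mathcal T$. Let $J$ be a squared seminorm on $\mathcal H$ whose null space $\mathcal H_0$ is finite-dimensional, with $J(f)=\|f\|_{\mathcal H}^2$ on $\mathcal H_1=\mathcal H_0^{\perp}$. Let $K$, assumed continuous, be the reproducing kernel of $\mathcal H_1$, with eigenvalues $\rho_1\ge\rho_2\ge\cdots$ as an integral operator on $L_2$, and assume $\rho_k\asymp k^{-2r}$ for some $r>1/2$. Here $u_k\asymp v_k$ means that there are $A>0$ and $k_0$ with $u_k\le Av_k$ and $v_k\le Au_k$ for all $k\ge k_0$. **Design classes.** Let $F$ be the law of a random function $X\in L_2$ with $E\|X\|_{L_2}^2<\infty$ and covariance operator $C$ such that $Cf\ne0$ for all $0\neq f\in\mathcal H_0$. Put $\|f\|_R^2=\langle Cf,f\rangle_{L_2}+J(f)$ for $f\in\mathcal H$, with inner product $\langle\cdot,\cdot\rangle_R$, let $R$ be the integral operator on $L_2$ whose kernel is the reproducing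 kernel of $(\mathcal H,\langle\cdot,\cdot\rangle_R)$, let $\nu_1\ge\nu_2\ge\cdots$ be the eigenvalues of $R^{1/2}CR^{1/2}$ with orthonormal eigenfunctions $\zeta_k$, $\omega_k=\nu_k^{-1/2}R^{1/2}\zeta_k$ and $\gamma_k^{-1}=\nu_k^{-1}-1$. For $0\le a\le1$ put $$\|f\|_a^2=\sum_{k\ge1}(1+\gamma_k^{-a})f_k^2,\qquad f_k=\langle Cf,\omega_k\rangle_{L_2},$$ where $f_k=\nu_k\langle f,\omega_k\rangle_R$ for $f\in\mathcal H$. For $s>1/2$ and $M\ge3$ let $\mathcal F(s,M,K)$ be the set of all such $F$ for which - (a) the eigenvalues $\mu_1\ge\mu_2\ge\cdots$ of $C$ satisfy $\mu_k\asymp k^{-2s}$; - (b) $E\langle f,X-EX\rangle_{L_2}^4\le M\,(E\langle f,X-EX\rangle_{L_2}^2)^2<\infty$ for all $f\in L_2$; - (c) $\gamma_k\asymp\rho_k\mu_k$. Let $\mathcal F_{A,k_0}(s,M,K)$ be the subset where (a) and (c) hold with the given constants $A,k_0$. **Model.** The data are $n$ independent copies of $(X,Y)$, $Y=\alpha_0+\int_{\mathcal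 T}X\beta_0+\varepsilon$, where $X\sim F$, $\beta_0\in\mathcal H$, and $\varepsilon$ is independent of $X$ with $E\varepsilon=0$, $\operatorname{Var}\varepsilon\le M_2$, where $M_2>0$. Estimators $\tilde\beta$ are arbitrary measurable $L_2$-valued functions of the data. Put $\kappa=\frac{2(1-a)(r+s)}{2(r+s)+1}$. **Theorem.** (1) There is a constant $d>0$ such that for every noise law as above $$\liminf_{n\to\infty}\ \inf_{\tilde\beta}\ \sup_{F\in\mathcal F(s,M,K),\ \beta_0\in\mathcal H}P\big(\|\tilde\beta-\beta_0\|_a^2>d\,n^{-\kappa}\big)>0 .$$ (2) Consequently the regularized estimator is rate optimal. More precisely, let $\lambda_n>0$, $\lambda_n\asymp n^{-2(r+s)/(2(r+s)+1)}$, and let $\hat\beta_n$ be the slope part of any minimizer over $(\alpha,\beta)\in\mathbb R\times\mathcal H$ of $\frac1n\sum_{i=1}^n\big(y_i-\alpha-\int x_i\beta\big)^2+\lambda_nJ(\beta)$. For all $A$, $k_0$ with $\mathcal F_{A,k_0}(s,M,K)\neq\emptyset$ and all $B>0$, with the suprema below taken over $F\in\mathcal F_{A,k_0}(s,M,K)$,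 all noise laws as above, and all $\beta_0\in\mathcal H$ with $J(\beta_0)\le B$, $$\lim_{c\to\infty}\limsup_{n\to\infty}\ \sup P\big(\|\hat\beta_n-\beta_0\|_a^2>c\,n^{-\kappa}\big)=0,$$ and there is $d>0$ with $$\liminf_{n\to\infty}\ \inf_{\tilde\beta}\ \sup P\big(\|\tilde\beta-\beta_0\|_a^2>d\,n^{-\kappa}\big)>0 .$$ -/

import Mathlib

open MeasureTheory ProbabilityTheory Filter Topology
open scoped RealInnerProductSpace ENNReal

/-- The Borel sigma-algebra on the Hilbert space of square integrable functions. -/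
noncomputable instance instMeasurableSpaceLpTwo {T : Type*} [MeasurableSpace T] (τ : Measure T) :
    MeasurableSpace (Lp ℝ 2 τ) := borel _

instance instBorelSpaceLpTwo {T : Type*} [MeasurableSpace T] (τ : Measure T) :
    BorelSpace (Lp ℝ 2 τ) := ⟨rfl⟩

namespace FLR

/-- Quantitative form of `u ≍ v`: from the index `k₀` on, both ratios are at most `A`. -/
def Comparable (A : ℝ) (k₀ : ℕ) (u v : ℕ → ℝ) : Prop :=
  0 < A ∧ ∀ k, k₀ ≤ k → u k ≤ A * v k ∧ v k ≤ A * u k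

/-- `u ≍ v`: the ratio is bounded away from `0` and `∞` as the index tends to infinity. -/
def AsympEquiv (u v : ℕ → ℝ) : Prop := ∃ (A : ℝ) (k₀ : ℕ), Comparable A k₀ u v

/-- `lam 0 ≥ lam 1 ≥ ...` is the list of the eigenvalues of the (positive, compact) operator `A`,
with multiplicity, and `e` is a corresponding orthonormal system of eigenvectors: all of `A` lives
on the closed span of `e`. -/
structure IsEigenSystem {E : Type*} [NormedAddCommGroup E] [InnerProductSpace ℝ E]
    (A : E →L[ℝ] E) (lam : ℕ → ℝ) (e : ℕ → E) : Prop where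
  orthonormal : Orthonormal ℝ e
  antitone : Antitone lam
  eigen : ∀ k, A (e k) = lam k • e k
  complete : ∀ f, (∀ k, ⟪e k, f⟫ = 0) → A f = 0

/-- `A` is the integral operator `f ↦ ∫ κ(·, t) f(t) dt` on square integrable functions. -/
def IsIntegralOperator {T : Type*} [MeasurableSpace T] {τ : Measure T}
    (κ : T → T → ℝ) (A : Lp ℝ 2 τ →L[ℝ] Lp ℝ 2 τ) : Prop :=
  ∀ f : Lp ℝ 2 τ, A f =ᵐ[τ] fun s => ∫ t, κ s t * f t ∂τ

/-- `κ` is the reproducing kernel of the space of functions `V` for the inner product `B`. -/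
def IsReproducingKernel {T H : Type*} [NormedAddCommGroup H] [InnerProductSpace ℝ H]
    [RKHS ℝ H T ℝ] (V : Set H) (B : H → H → ℝ) (κ : T → T → ℝ) : Prop :=
  ∀ t : T, ∃ g ∈ V, (∀ s, g s = κ s t) ∧ ∀ f ∈ V, B f g = f t

section Design

variable {T H : Type*} [MeasurableSpace T] {τ : Measure T}
  [NormedAddCommGroup H] [InnerProductSpace ℝ H]

/-- `‖f‖_R² = ⟨C f, f⟩ + J(f)` for `f ∈ H`, where `J = p²`; the map `ι` is the inclusion of `H`
in the space of square integrable functions. -/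
noncomputable def rNormSq (ι : H →ₗ[ℝ] Lp ℝ 2 τ) (p : Seminorm ℝ H)
    (C : Lp ℝ 2 τ →L[ℝ] Lp ℝ 2 τ) (f : H) : ℝ :=
  ⟪C (ι f), ι f⟫ + p f ^ 2

/-- The inner product associated with `‖·‖_R`. -/
noncomputable def rInner (ι : H →ₗ[ℝ] Lp ℝ 2 τ) (p : Seminorm ℝ H)
    (C : Lp ℝ 2 τ →L[ℝ] Lp ℝ 2 τ) (f g : H) : ℝ :=
  (rNormSq ι p C (f + g) - rNormSq ι p C (f - g)) / 4

/-- The distribution of a square integrable random function `X` whose covariance operator `C`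
does not vanish on the null space of the penalty `J = p²`, together with the objects it
determines: `C`, its eigensystem `(μ, φ)`, the reproducing kernel `R` of `‖·‖_R`, the positive
square root of its integral operator, and the eigensystem `(ν, ζ)` of `R^{1/2} C R^{1/2}`.
All of them are determined by the distribution, except for the choice of orthonormal
eigenfunctions in multiple eigenspaces. -/
structure Design [RKHS ℝ H T ℝ] (ι : H →ₗ[ℝ] Lp ℝ 2 τ) (p : Seminorm ℝ H) where
  law : Measure (Lp ℝ 2 τ)
  isProb : IsProbabilityMeasure law
  memLp : MemLp id 2 law
  C : Lp ℝ 2 τ →L[ℝ] Lp ℝ 2 τ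
  cov_spec : ∀ f g, ⟪C f, g⟫ = covarianceBilin law f g
  nondegenerate : ∀ f : H, p f = 0 → f ≠ 0 → C (ι f) ≠ 0
  μ : ℕ → ℝ
  φ : ℕ → Lp ℝ 2 τ
  eigenC : IsEigenSystem C μ φ
  kerR : T → T → ℝ
  kerR_spec : IsReproducingKernel (Set.univ : Set H) (rInner ι p C) kerR
  R : Lp ℝ 2 τ →L[ℝ] Lp ℝ 2 τ
  R_spec : IsIntegralOperator kerR R
  Rhalf : Lp ℝ 2 τ →L[ℝ] Lp ℝ 2 τ
  Rhalf_pos : Rhalf.IsPositive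
  Rhalf_sq : Rhalf ∘L Rhalf = R
  ν : ℕ → ℝ
  ζ : ℕ → Lp ℝ 2 τ
  eigenN : IsEigenSystem (Rhalf ∘L C ∘L Rhalf) ν ζ

attribute [instance] Design.isProb

variable [RKHS ℝ H T ℝ] {ι : H →ₗ[ℝ] Lp ℝ 2 τ} {p : Seminorm ℝ H}

namespace Design

/-- `γ_k = (ν_k⁻¹ - 1)⁻¹`. (If `ν_k = 1`, which can happen only for finitely many `k` in the classes
below, then `γ_k` should be read as `∞`; accordingly only `γ_k⁻¹ = ν_k⁻¹ - 1 = 0` is used there.) -/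
noncomputable def γ (D : Design ι p) (k : ℕ) : ℝ := ((D.ν k)⁻¹ - 1)⁻¹

/-- `ω_k = ν_k^{-1/2} R^{1/2} ζ_k`. -/
noncomputable def ω (D : Design ι p) (k : ℕ) : Lp ℝ 2 τ :=
  (D.ν k ^ (-(1 / 2) : ℝ)) • D.Rhalf (D.ζ k)

/-- The coefficient `f_k` of `f`, as `⟨C f, ω_k⟩`. This makes sense for every square integrable
`f`; for `f ∈ H` it is `ν_k ⟨f, ω_k⟩_R`, see `coef_eq` below. -/
noncomputable def coef (D : Design ι p) (f : Lp ℝ 2 τ) (k : ℕ) : ℝ := ⟪D.C f, D.ω k⟫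

/-- `‖f‖_a² = ∑_k (1 + γ_k^{-a}) f_k²`, as an extended nonnegative number. -/
noncomputable def normSq (D : Design ι p) (a : ℝ) (f : Lp ℝ 2 τ) : ℝ≥0∞ :=
  ∑' k, ENNReal.ofReal ((1 + ((D.ν k)⁻¹ - 1) ^ a) * D.coef f k ^ 2)

/-- Membership in the class `F(s, M, K)`, with explicit constants `A`, `k₀` in the two relations
`≍`; `ρ` is the sequence of eigenvalues of `K`. -/
structure InClassWith (ρ : ℕ → ℝ) (s M A : ℝ) (k₀ : ℕ) (D : Design ι p) : Prop where
  eigenvalues : Comparable A k₀ D.μ fun k => ((k : ℝ) + 1) ^ (-(2 * s))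
  fourth_integrable : ∀ f : Lp ℝ 2 τ, Integrable (fun x => ⟪f, x - ∫ y, y ∂D.law⟫ ^ 4) D.law
  fourth_moment : ∀ f : Lp ℝ 2 τ, ∫ x, ⟪f, x - ∫ y, y ∂D.law⟫ ^ 4 ∂D.law
    ≤ M * (∫ x, ⟪f, x - ∫ y, y ∂D.law⟫ ^ 2 ∂D.law) ^ 2
  ratios : Comparable A k₀ D.γ fun k => ρ k * D.μ k

/-- Membership in the class `F(s, M, K)`. -/
def InClass (ρ : ℕ → ℝ) (s M : ℝ) (D : Design ι p) : Prop :=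
  ∃ (A : ℝ) (k₀ : ℕ), D.InClassWith ρ s M A k₀

end Design

/-! Check of the formula for the coefficients: `ω_k` belongs to `H`, and
`⟨C f, ω_k⟩ = ν_k ⟨f, ω_k⟩_R` for `f ∈ H`. -/

theorem inclusion_continuous [CompleteSpace H]
    (hι : ∀ f : H, ι f =ᵐ[τ] f) : Continuous ι := by
  refine LinearMap.continuous_of_seq_closed_graph ι (fun u x y hu hy => ?_)
  have h1 : TendstoInMeasure τ (fun n => ((ι (u n) : Lp ℝ 2 τ) : T → ℝ)) atTop
      (y : T → ℝ) :=
    tendstoInMeasure_of_tendsto_Lp hy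
  obtain ⟨ns, hns, hae⟩ := h1.exists_seq_tendsto_ae
  refine Lp.ext ?_
  have h2 : ∀ᵐ t ∂τ, ∀ n, (ι (u n)) t = u n t := ae_all_iff.2 (fun n => hι (u n))
  filter_upwards [hae, h2, hι x] with t ht ht2 ht3
  have h3 : Tendsto (fun i => u (ns i) t) atTop (𝓝 (x t)) :=
    ((RKHS.continuous_eval (H := H) t).tendsto x).comp (hu.comp hns.tendsto_atTop)
  have h4 : (fun i => (ι (u (ns i))) t) = fun i => u (ns i) t := by
    funext i; exact ht2 (ns i)
  rw [h4] at ht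
  rw [ht3]
  exact tendsto_nhds_unique ht h3

theorem seminorm_eq_norm_projection {H₀ : Submodule ℝ H} [FiniteDimensional ℝ H₀]
    (hH₀ : ∀ f, f ∈ H₀ ↔ p f = 0) (hp : ∀ f ∈ H₀ᗮ, p f = ‖f‖) (f : H) :
    p f = ‖H₀ᗮ.starProjection f‖ := by
  have hdec : H₀.starProjection f + H₀ᗮ.starProjection f = f := by
    simp [Submodule.starProjection_orthogonal]
  have h0 : p (H₀.starProjection f) = 0 := (hH₀ _).1 (Submodule.starProjection_apply_mem _ _)
  rw [← hp _ (Submodule.starProjection_apply_mem _ _)]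
  apply le_antisymm
  · calc p f = p (H₀.starProjection f + H₀ᗮ.starProjection f) := by rw [hdec]
      _ ≤ _ := map_add_le_add p _ _
      _ = _ := by rw [h0, zero_add]
  · calc p (H₀ᗮ.starProjection f) = p (f - H₀.starProjection f) := by
          congr 1; exact eq_sub_of_add_eq' hdec
      _ ≤ p f + p (H₀.starProjection f) := map_sub_le_add p _ _
      _ = p f := by rw [h0, add_zero]

theorem exists_coercive [CompleteSpace H] (hι : ∀ f : H, ι f =ᵐ[τ] f)
    {H₀ : Submodule ℝ H} [FiniteDimensional ℝ H₀]
    (C : Lp ℝ 2 τ →L[ℝ] Lp ℝ 2 τ) (hsymm : ∀ f g, ⟪C f, g⟫ = ⟪C g, f⟫)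
    (hpos : ∀ f, 0 ≤ ⟪C f, f⟫) (hnd : ∀ f ∈ H₀, f ≠ 0 → C (ι f) ≠ 0) :
    ∃ c : ℝ, 0 < c ∧ ∀ f : H, c * ‖f‖ ^ 2 ≤ ⟪C (ι f), ι f⟫ + ‖H₀ᗮ.starProjection f‖ ^ 2 := by
  have hcont := inclusion_continuous hι
  set q : H → ℝ := fun f => ⟪C (ι f), ι f⟫ with hq
  have hqc : Continuous q := by
    have := C.continuous.comp hcont
    exact this.inner hcont
  have hq0 : ∀ f, 0 ≤ q f := fun f => hpos _
  have hqsub : ∀ f g, q (f - g) ≤ 2 * q f + 2 * q g := by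
    intro f g
    have h1 := hpos (ι f + ι g)
    have h2 := hsymm (ι f) (ι g)
    simp only [hq, map_sub, map_add, inner_sub_left, inner_sub_right, inner_add_left,
      inner_add_right] at h1 h2 ⊢
    linarith
  -- an upper bound for `q`
  obtain ⟨b, hb0, hb⟩ : ∃ b : ℝ, 0 ≤ b ∧ ∀ f, q f ≤ b * ‖f‖ ^ 2 := by
    let L : H →L[ℝ] Lp ℝ 2 τ := ⟨ι, hcont⟩
    refine ⟨‖C‖ * ‖L‖ * ‖L‖, by positivity, fun f => ?_⟩
    have h1 : ‖ι f‖ ≤ ‖L‖ * ‖f‖ := L.le_opNorm f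
    calc q f ≤ ‖C (ι f)‖ * ‖ι f‖ := real_inner_le_norm _ _
      _ ≤ (‖C‖ * ‖ι f‖) * ‖ι f‖ := by gcongr; exact C.le_opNorm _
      _ ≤ (‖C‖ * (‖L‖ * ‖f‖)) * (‖L‖ * ‖f‖) := by gcongr
      _ = _ := by ring
  -- `q` is positive definite on `H₀`
  have hqpos : ∀ f ∈ H₀, f ≠ 0 → 0 < q f := by
    intro f hf hf0
    refine lt_of_le_of_ne (hq0 f) (fun h => hnd f hf hf0 ?_)
    have key : ∀ g, ⟪C (ι f), g⟫ = 0 := by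
      intro g
      have h0 : ⟪C (ι f), ι f⟫ = 0 := h.symm
      by_contra hne
      have h3 := hpos (g + (-(⟪C g, g⟫ + 1) / (2 * ⟪C (ι f), g⟫)) • ι f)
      have h2 := hsymm (ι f) g
      simp only [map_add, map_smul, inner_add_left, inner_add_right, inner_smul_left,
        inner_smul_right, h0, ← h2, RCLike.conj_to_real, mul_zero, add_zero] at h3
      have h4 : -(⟪C g, g⟫ + 1) / (2 * ⟪C (ι f), g⟫) * ⟪C (ι f), g⟫ = -(⟪C g, g⟫ + 1) / 2 := by
        field_simp
      rw [h4] at h3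
      linarith
    have := key (C (ι f))
    exact inner_self_eq_zero.1 this
  obtain ⟨e, he, hlow⟩ : ∃ e : ℝ, 0 < e ∧ ∀ f ∈ H₀, e * ‖f‖ ^ 2 ≤ q f := by
    have hcpt : IsCompact (Metric.sphere (0 : H₀) 1) := isCompact_sphere _ _
    have hhom : ∀ (x : ℝ) (f : H), q (x • f) = x ^ 2 * q f := by
      intro x f
      simp only [hq, map_smul, inner_smul_left, inner_smul_right, RCLike.conj_to_real]
      ring
    rcases (Metric.sphere (0 : H₀) 1).eq_empty_or_nonempty with hemp | hne
    · refine ⟨1, one_pos, fun f hf => ?_⟩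
      have hf0 : f = 0 := by
        by_contra hf0
        have : (‖f‖⁻¹ • (⟨f, hf⟩ : H₀)) ∈ Metric.sphere (0 : H₀) 1 := by
          rw [mem_sphere_zero_iff_norm, norm_smul, norm_inv, norm_norm]
          exact inv_mul_cancel₀ (norm_ne_zero_iff.2 hf0)
        rw [hemp] at this
        exact this
      subst hf0
      simpa using hq0 0
    · obtain ⟨g, hg, hmin⟩ := hcpt.exists_isMinOn hne
        (hqc.comp continuous_subtype_val).continuousOn
      have hg1 : ‖g‖ = 1 := mem_sphere_zero_iff_norm.1 hg
      have hgne : (g : H) ≠ 0 := by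
        intro h
        have : ‖(g : H)‖ = 1 := hg1
        rw [h, norm_zero] at this
        exact zero_ne_one this
      refine ⟨q g, hqpos g g.2 hgne, fun f hf => ?_⟩
      by_cases hf0 : f = 0
      · subst hf0
        simpa using hq0 0
      have hmem : (‖f‖⁻¹ • (⟨f, hf⟩ : H₀)) ∈ Metric.sphere (0 : H₀) 1 := by
        rw [mem_sphere_zero_iff_norm, norm_smul, norm_inv, norm_norm]
        exact inv_mul_cancel₀ (norm_ne_zero_iff.2 hf0)
      have h1 : q g ≤ q (‖f‖⁻¹ • f) := hmin hmem
      rw [hhom] at h1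
      have hn : 0 < ‖f‖ := norm_pos_iff.2 hf0
      calc q g * ‖f‖ ^ 2 ≤ (‖f‖⁻¹ ^ 2 * q f) * ‖f‖ ^ 2 := by gcongr
        _ = q f := by field_simp
  refine ⟨(1 + 2 * (1 + b) / e)⁻¹, by positivity, fun f => ?_⟩
  have hdec : H₀.starProjection f + H₀ᗮ.starProjection f = f := by
    simp [Submodule.starProjection_orthogonal]
  set f₀ := H₀.starProjection f
  set f₁ := H₀ᗮ.starProjection f
  have hf₀ : f₀ ∈ H₀ := Submodule.starProjection_apply_mem _ _
  have hf₁ : f₁ ∈ H₀ᗮ := Submodule.starProjection_apply_mem _ _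
  have hpy : ‖f‖ ^ 2 = ‖f₀‖ ^ 2 + ‖f₁‖ ^ 2 := by
    rw [← hdec, sq, sq, sq]
    exact norm_add_sq_eq_norm_sq_add_norm_sq_of_inner_eq_zero f₀ f₁ (hf₁ f₀ hf₀)
  have h1 : q f₀ ≤ 2 * q f + 2 * q f₁ := by
    have : f₀ = f - f₁ := eq_sub_of_add_eq hdec
    conv_lhs => rw [this]
    exact hqsub f f₁
  have h2 := hlow f₀ hf₀
  have h3 := hb f₁
  have h4 := hq0 f
  have h5 : ‖f₀‖ ^ 2 ≤ 2 * (1 + b) / e * (q f + ‖f₁‖ ^ 2) := by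
    rw [div_mul_eq_mul_div, le_div_iff₀ he]
    nlinarith [sq_nonneg ‖f₁‖, mul_nonneg hb0 h4]
  rw [inv_mul_le_iff₀ (by positivity), hpy]
  change _ ≤ _ * (q f + ‖f₁‖ ^ 2)
  nlinarith

theorem Design.coef_eq [CompleteSpace H] (hι : ∀ f : H, ι f =ᵐ[τ] f)
    {H₀ : Submodule ℝ H} [FiniteDimensional ℝ H₀]
    (hH₀ : ∀ f, f ∈ H₀ ↔ p f = 0) (hp : ∀ f ∈ H₀ᗮ, p f = ‖f‖)
    (D : Design ι p) (k : ℕ) :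
    ∃ w : H, ι w = D.ω k ∧ ∀ f : H, D.coef (ι f) k = D.ν k * rInner ι p D.C f w := by
  by_cases hν : D.ν k = 0
  · refine ⟨0, ?_, fun f => ?_⟩ <;> simp [Design.ω, Design.coef, hν]
  have hsymm : ∀ f g, ⟪D.C f, g⟫ = ⟪D.C g, f⟫ := fun f g => by
    rw [D.cov_spec, D.cov_spec, covarianceBilin_comm]
  have hpos : ∀ f, 0 ≤ ⟪D.C f, f⟫ := fun f => by
    rw [D.cov_spec]; exact covarianceBilin_self_nonneg f
  obtain ⟨c, hc, hcoer⟩ := exists_coercive (H₀ := H₀) hι D.C hsymm hpos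
    (fun f hf hf0 => D.nondegenerate f ((hH₀ f).1 hf) hf0)
  let L : H →L[ℝ] Lp ℝ 2 τ := ⟨ι, inclusion_continuous hι⟩
  let P : H →L[ℝ] H := H₀ᗮ.starProjection
  have hB : ∀ f g, rInner ι p D.C f g = ⟪D.C (ι f), ι g⟫ + ⟪P f, P g⟫ := by
    intro f g
    have h1 := hsymm (ι f) (ι g)
    simp only [rInner, rNormSq, seminorm_eq_norm_projection hH₀ hp, ← real_inner_self_eq_norm_sq]
    change (⟪D.C (ι (f + g)), ι (f + g)⟫ + ⟪P (f + g), P (f + g)⟫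
      - (⟪D.C (ι (f - g)), ι (f - g)⟫ + ⟪P (f - g), P (f - g)⟫)) / 4 = _
    have h2 := real_inner_comm (P f) (P g)
    simp only [map_sub, map_add, inner_sub_left, inner_sub_right, inner_add_left,
      inner_add_right]
    linarith
  let A : H →L[ℝ] H := L.adjoint ∘L D.C ∘L L + P.adjoint ∘L P
  let Bf : H →L[ℝ] H →L[ℝ] ℝ := (innerSL ℝ) ∘L A
  have hBf : ∀ f g, Bf f g = rInner ι p D.C f g := by
    intro f g
    rw [hB]
    change ⟪L.adjoint (D.C (ι f)) + P.adjoint (P f), g⟫ = _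
    rw [inner_add_left, ContinuousLinearMap.adjoint_inner_left,
      ContinuousLinearMap.adjoint_inner_left]
    rfl
  have hco : IsCoercive Bf := by
    refine ⟨c, hc, fun u => ?_⟩
    rw [hBf, hB, real_inner_self_eq_norm_sq, mul_assoc, ← sq]
    exact hcoer u
  -- representers of the functionals `f ↦ ∫ f h`
  have hrep : ∀ h : Lp ℝ 2 τ, ∃ G : H, (∀ f, rInner ι p D.C f G = ⟪ι f, h⟫) ∧ ι G = D.R h := by
    intro h
    have hsy : ∀ f g, rInner ι p D.C f g = rInner ι p D.C g f := by
      intro f g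
      rw [hB, hB, hsymm, real_inner_comm (P f) (P g)]
    let G := hco.continuousLinearEquivOfBilin.symm (L.adjoint h)
    have hG : ∀ f, rInner ι p D.C f G = ⟪ι f, h⟫ := by
      intro f
      rw [hsy, ← hBf, ← hco.continuousLinearEquivOfBilin_apply,
        ContinuousLinearEquiv.apply_symm_apply, ContinuousLinearMap.adjoint_inner_left,
        real_inner_comm]
      rfl
    refine ⟨G, hG, Lp.ext ?_⟩
    filter_upwards [hι G, D.R_spec h] with t ht1 ht2
    obtain ⟨g, -, hg1, hg2⟩ := D.kerR_spec t
    rw [ht1, ht2, ← hg2 G (Set.mem_univ _), hsy, hG, L2.inner_def]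
    refine integral_congr_ae ?_
    filter_upwards [hι g] with x hx
    rw [hx, hg1]
    simp only [RCLike.inner_apply, conj_trivial]
    -- symmetry of the kernel
    obtain ⟨g', -, hg1', hg2'⟩ := D.kerR_spec x
    have hk : g x = D.kerR t x := by
      rw [← hg2' g (Set.mem_univ _), hsy, hg2 g' (Set.mem_univ _), hg1']
    rw [← hg1, hk, mul_comm]
  have heig : D.R (D.C (D.ω k)) = D.ν k • D.ω k := by
    have h1 := D.eigenN.eigen k
    have h2 : D.R (D.C (D.Rhalf (D.ζ k))) = D.ν k • D.Rhalf (D.ζ k) := by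
      rw [← map_smul, ← h1, ← D.Rhalf_sq]
      rfl
    rw [Design.ω, map_smul, map_smul, h2, smul_comm]
  obtain ⟨G, hG1, hG2⟩ := hrep (D.C (D.ω k))
  refine ⟨(D.ν k)⁻¹ • G, ?_, fun f => ?_⟩
  · rw [map_smul, hG2, heig, smul_smul, inv_mul_cancel₀ hν, one_smul]
  · have h1 : rInner ι p D.C f ((D.ν k)⁻¹ • G) = (D.ν k)⁻¹ * rInner ι p D.C f G := by
      rw [hB, hB, map_smul, map_smul, inner_smul_right, inner_smul_right]
      ring
    rw [h1, hG1, mul_inv_cancel_left₀ hν, Design.coef, hsymm, real_inner_comm]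

/-- A noise law: centered, with variance at most `M₂`. -/
structure IsNoise (M₂ : ℝ) (noise : Measure ℝ) : Prop where
  isProb : IsProbabilityMeasure noise
  memLp : MemLp id 2 noise
  centered : ∫ x, x ∂noise = 0
  variance_le : Var[id; noise] ≤ M₂

/-- The probability that an estimator `b` of the slope has squared loss larger than `t`, when it is
computed from `n` independent copies `(X_i, Y_i)` of `(X, Y)`, where
`Y = α₀ + ∫ X β₀ + ε` and `X`, `ε` are independent with laws `D.law` and `noise`. -/
noncomputable def errProb (D : Design ι p) (noise : Measure ℝ) (a α₀ : ℝ) (β₀ : H) {n : ℕ}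
    (b : (Fin n → Lp ℝ 2 τ × ℝ) → Lp ℝ 2 τ) (t : ℝ) : ℝ≥0∞ :=
  Measure.pi (fun _ : Fin n => D.law.prod noise)
    {z | ENNReal.ofReal t
      < D.normSq a (b (fun i => ((z i).1, α₀ + ⟪(z i).1, ι β₀⟫ + (z i).2)) - ι β₀)}

/-- The estimators of the slope from `n` observations: all measurable functions of the data. -/
abbrev Estimator (τ : Measure T) (n : ℕ) : Type _ :=
  {b : (Fin n → Lp ℝ 2 τ × ℝ) → Lp ℝ 2 τ // Measurable b}

/-- The rate `n^{-2(1-a)(r+s)/(2(r+s)+1)}`. -/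
noncomputable def rate (r s a : ℝ) (n : ℕ) : ℝ :=
  (n : ℝ) ^ (-(2 * (1 - a) * (r + s) / (2 * (r + s) + 1)))

/-- The largest error probability of `b` over the designs in `𝒟`, the centered noise laws of
variance at most `M₂` and the slopes `β₀ ∈ H` with `J(β₀) ≤ B`. -/
noncomputable def worstProb (𝒟 : Set (Design ι p)) (M₂ B a α₀ : ℝ) {n : ℕ}
    (b : (Fin n → Lp ℝ 2 τ × ℝ) → Lp ℝ 2 τ) (t : ℝ) : ℝ≥0∞ :=
  ⨆ (D : Design ι p) (_ : D ∈ 𝒟) (noise : Measure ℝ) (_ : IsNoise M₂ noise)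
    (β₀ : H) (_ : p β₀ ^ 2 ≤ B), errProb D noise a α₀ β₀ b t

/-- A sequence of estimators is rate optimal with rate `v`: it attains the rate `v`, and `v` is a
minimax lower bound for all measurable estimators. -/
structure IsRateOptimal (𝒟 : Set (Design ι p)) (M₂ B a α₀ : ℝ) (v : ℕ → ℝ)
    (b : ∀ n : ℕ, (Fin n → Lp ℝ 2 τ × ℝ) → Lp ℝ 2 τ) : Prop where
  upper : Tendsto
    (fun c : ℝ => limsup (fun n : ℕ => worstProb 𝒟 M₂ B a α₀ (b n) (c * v n)) atTop)
    atTop (𝓝 0)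
  lower : ∃ d : ℝ, 0 < d ∧
    0 < liminf (fun n : ℕ => ⨅ b' : Estimator τ n, worstProb 𝒟 M₂ B a α₀ b'.1 (d * v n)) atTop

/-- `β` is the slope part of a minimizer over `(α, β) ∈ ℝ × H` of the penalized least squares
criterion `(1/n) ∑ (y_i - (α + ∫ x_i β))² + lam J(β)`. -/
def IsRegularized (ι : H →ₗ[ℝ] Lp ℝ 2 τ) (p : Seminorm ℝ H) (lam : ℝ) {n : ℕ}
    (data : Fin n → Lp ℝ 2 τ × ℝ) (β : H) : Prop :=
  ∃ α : ℝ, ∀ (α' : ℝ) (β' : H),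
    1 / (n : ℝ) * ∑ i, ((data i).2 - (α + ⟪(data i).1, ι β⟫)) ^ 2 + lam * p β ^ 2
      ≤ 1 / (n : ℝ) * ∑ i, ((data i).2 - (α' + ⟪(data i).1, ι β'⟫)) ^ 2 + lam * p β' ^ 2

end Design

end FLR

set_option linter.unusedSectionVars false


namespace FLR

/-! Write q = r + s > 1. For a design with covariance operator C the elements ω_k diagonalize two
quadratic forms at once: they are orthonormal for ⟨C·,·⟩ and orthogonal for the penalty form, with
squared penalties γ_k⁻¹ = ν_k⁻¹ - 1. In a class with fixed constants these grow like k^(2q),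
uniformly over the class (`Design.growth`). All estimates are then made on the coefficients f_k,
which determine a slope up to the kernel of C (`C_eq_zero_of_coef`); the centred data are almost
surely orthogonal to that kernel.

Upper bound. Give the k-th coordinate the weight (1 + λ γ_k⁻¹)⁻¹. The sum N of the weights, the
effective dimension, is O(λ^(-1/(2q))) (`tsum_effective_le`). By the fourth moment condition the
weighted Hilbert-Schmidt distance of the empirical Gram matrix to the identity has mean square
O(N²/n), which tends to 0 for λ ≍ n^(-2q/(2q+1)), and the weighted covariance of features and noise
has mean square O(N/n) = O(λ). When the first quantity is small, the minimizing property of the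
estimator gives ∑ (1 + λ γ_k⁻¹) b_k² = O(λ) for its error b (`regularized_error`). Since 1 + γ^(-a)
≤ (1 + λ^(-a)) (1 + λ γ⁻¹), the loss is O(λ^(1-a)), which is the rate n^(-κ).

Lower bound for J(β₀) ≤ B. Take Gaussian noise and the cube of slopes ∑ θ_k x ω_k, θ_k ∈ {0, 1},
over j ≤ k < 2j, with j of order n^(1/(2q+1)) and x² of order 1/n. Neighbouring vertices cannot be
told apart (`two_point_bound`), the penalty stays bounded, and by Assouad's argument (`assouad`) a
fixed proportion of the coordinates is wrong with positive probability. The loss is then of order j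
· j^(2qa) / n, again n^(-κ).

Lower bound (1). Here the noise law is prescribed, but the slope is unrestricted. The n observed
functions leave some direction in an (n + 1)-dimensional space of slopes undetermined, so averaging
over a huge cube shows that no estimator keeps its error below any given threshold
(`exists_errProb_ge_half`). The supremum is nontrivial only if the class is nonempty. This is proved
by `IsPenalty.exists_inClass`: the random function is a series with random signs, whose kurtosis
constant 3 accounts for M ≥ 3, along vectors adapted to H₀ and to the operator with kernel K. -/

/-- The space `H` of functions is included in `L²` by `ι`, and the seminorm `p` is the norm of the
component orthogonal to `H₀`. -/
structure IsPenalty {T H : Type*} [MeasurableSpace T] {τ : Measure T}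
    [NormedAddCommGroup H] [InnerProductSpace ℝ H] [RKHS ℝ H T ℝ]
    (ι : H →ₗ[ℝ] Lp ℝ 2 τ) (p : Seminorm ℝ H) (H₀ : Submodule ℝ H) : Prop where
  incl : ∀ f : H, ι f =ᵐ[τ] f
  null : ∀ f, f ∈ H₀ ↔ p f = 0
  norm_eq : ∀ f ∈ H₀ᗮ, p f = ‖f‖

/-! ### Simultaneous diagonalization of the covariance form and the penalty. -/

section Geometry

variable {T H : Type*} [MeasurableSpace T] {τ : Measure T}
  [NormedAddCommGroup H] [InnerProductSpace ℝ H] [CompleteSpace H] [RKHS ℝ H T ℝ]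
  {ι : H →ₗ[ℝ] Lp ℝ 2 τ} {p : Seminorm ℝ H} {H₀ : Submodule ℝ H} [FiniteDimensional ℝ H₀]

theorem IsPenalty.eq_norm_projection (h : IsPenalty ι p H₀) (f : H) :
    p f = ‖H₀ᗮ.starProjection f‖ :=
  seminorm_eq_norm_projection h.null h.norm_eq f

theorem IsPenalty.rInner_eq (h : IsPenalty ι p H₀) {C : Lp ℝ 2 τ →L[ℝ] Lp ℝ 2 τ}
    (hsymm : ∀ f g, ⟪C f, g⟫ = ⟪C g, f⟫) (f g : H) :
    rInner ι p C f g
      = ⟪C (ι f), ι g⟫ + ⟪H₀ᗮ.starProjection f, H₀ᗮ.starProjection g⟫ := by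
  have h1 := hsymm (ι f) (ι g)
  simp only [rInner, rNormSq, h.eq_norm_projection, ← real_inner_self_eq_norm_sq]
  have h2 := real_inner_comm (H₀ᗮ.starProjection f) (H₀ᗮ.starProjection g)
  simp only [map_sub, map_add, inner_sub_left, inner_sub_right, inner_add_left,
    inner_add_right]
  linarith

theorem rInner_comm_of (h : IsPenalty ι p H₀) {C : Lp ℝ 2 τ →L[ℝ] Lp ℝ 2 τ}
    (hsymm : ∀ f g, ⟪C f, g⟫ = ⟪C g, f⟫) (f g : H) :
    rInner ι p C f g = rInner ι p C g f := by
  rw [h.rInner_eq hsymm, h.rInner_eq hsymm, hsymm, real_inner_comm (H₀ᗮ.starProjection f)]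

/-- Riesz representation for the inner product `rInner`. -/
theorem IsPenalty.exists_rieszMap (h : IsPenalty ι p H₀)
    {C : Lp ℝ 2 τ →L[ℝ] Lp ℝ 2 τ} (hsymm : ∀ f g, ⟪C f, g⟫ = ⟪C g, f⟫)
    (hpos : ∀ f, 0 ≤ ⟪C f, f⟫) (hnd : ∀ f : H, p f = 0 → f ≠ 0 → C (ι f) ≠ 0) :
    ∃ J : H →L[ℝ] H, ∀ f v, rInner ι p C f (J v) = ⟪f, v⟫ := by
  -- Nondegeneracy on the finite-dimensional null space makes the form coercive, so the Lax-Milgram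
  -- theorem inverts it.
  obtain ⟨c, hc, hcoer⟩ := exists_coercive (H₀ := H₀) h.incl C hsymm hpos
    (fun f hf hf0 => hnd f ((h.null f).1 hf) hf0)
  let L : H →L[ℝ] Lp ℝ 2 τ := ⟨ι, inclusion_continuous h.incl⟩
  let P : H →L[ℝ] H := H₀ᗮ.starProjection
  let A : H →L[ℝ] H := L.adjoint ∘L C ∘L L + P.adjoint ∘L P
  let Bf : H →L[ℝ] H →L[ℝ] ℝ := (innerSL ℝ) ∘L A
  have hBf : ∀ f g, Bf f g = rInner ι p C f g := by
    intro f g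
    rw [h.rInner_eq hsymm]
    change ⟪L.adjoint (C (ι f)) + P.adjoint (P f), g⟫ = _
    rw [inner_add_left, ContinuousLinearMap.adjoint_inner_left,
      ContinuousLinearMap.adjoint_inner_left]
    rfl
  have hco : IsCoercive Bf := by
    refine ⟨c, hc, fun u => ?_⟩
    rw [hBf, h.rInner_eq hsymm, real_inner_self_eq_norm_sq, mul_assoc, ← sq]
    exact hcoer u
  refine ⟨hco.continuousLinearEquivOfBilin.symm, fun f v => ?_⟩
  rw [rInner_comm_of h hsymm, ← hBf, ← hco.continuousLinearEquivOfBilin_apply,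
    ContinuousLinearEquiv.coe_coe, ContinuousLinearEquiv.apply_symm_apply, real_inner_comm]

theorem IsPenalty.exists_representer (h : IsPenalty ι p H₀)
    {C : Lp ℝ 2 τ →L[ℝ] Lp ℝ 2 τ} (hsymm : ∀ f g, ⟪C f, g⟫ = ⟪C g, f⟫)
    (hpos : ∀ f, 0 ≤ ⟪C f, f⟫) (hnd : ∀ f : H, p f = 0 → f ≠ 0 → C (ι f) ≠ 0)
    (ℓ : H →L[ℝ] ℝ) : ∃ G : H, ∀ f, rInner ι p C f G = ℓ f := by
  obtain ⟨J, hJ⟩ := h.exists_rieszMap hsymm hpos hnd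
  refine ⟨J ((InnerProductSpace.toDual ℝ H).symm ℓ), fun f => ?_⟩
  rw [hJ, real_inner_comm, InnerProductSpace.toDual_symm_apply]

/-- The integral operator with the reproducing kernel for `rInner` maps `h` to the representer of
`f ↦ ⟪ι f, h⟫`. -/
theorem IsPenalty.integralOperator_eq (h : IsPenalty ι p H₀)
    {C : Lp ℝ 2 τ →L[ℝ] Lp ℝ 2 τ} (hsymm : ∀ f g, ⟪C f, g⟫ = ⟪C g, f⟫)
    {κ : T → T → ℝ} (hκ : IsReproducingKernel (Set.univ : Set H) (rInner ι p C) κ)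
    {u : Lp ℝ 2 τ} {G : H} (hG : ∀ f, rInner ι p C f G = ⟪ι f, u⟫) :
    ι G =ᵐ[τ] fun s => ∫ t, κ s t * u t ∂τ := by
  have hsy := rInner_comm_of h hsymm
  filter_upwards [h.incl G] with t ht1
  obtain ⟨g, -, hg1, hg2⟩ := hκ t
  rw [ht1, ← hg2 G (Set.mem_univ _), hsy, hG, L2.inner_def]
  refine integral_congr_ae ?_
  filter_upwards [h.incl g] with x hx
  rw [hx, hg1]
  simp only [RCLike.inner_apply, conj_trivial]
  obtain ⟨g', -, hg1', hg2'⟩ := hκ x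
  have hk : g x = κ t x := by
    rw [← hg2' g (Set.mem_univ _), hsy, hg2 g' (Set.mem_univ _), hg1']
  rw [← hg1, hk, mul_comm]

namespace Design

variable (D : Design ι p)

theorem C_symm (f g : Lp ℝ 2 τ) : ⟪D.C f, g⟫ = ⟪D.C g, f⟫ := by
  rw [D.cov_spec, D.cov_spec, covarianceBilin_comm]

theorem C_nonneg (f : Lp ℝ 2 τ) : 0 ≤ ⟪D.C f, f⟫ := by
  rw [D.cov_spec]; exact covarianceBilin_self_nonneg f

/-- A null vector of a positive form lies in its radical. Otherwise a multiple of f can be added to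
g so that the form takes the value ⟨C g, g⟩ - (⟨C g, g⟩ + 1) = -1. -/
theorem C_eq_zero {f : Lp ℝ 2 τ} (hf : ⟪D.C f, f⟫ = 0) : D.C f = 0 := by
  have key : ∀ g, ⟪D.C f, g⟫ = 0 := by
    intro g
    by_contra hne
    have h3 := D.C_nonneg (g + (-(⟪D.C g, g⟫ + 1) / (2 * ⟪D.C f, g⟫)) • f)
    have h2 := D.C_symm f g
    simp only [map_add, map_smul, inner_add_left, inner_add_right, inner_smul_left,
      inner_smul_right, hf, ← h2, RCLike.conj_to_real, mul_zero, add_zero] at h3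
    have h4 : -(⟪D.C g, g⟫ + 1) / (2 * ⟪D.C f, g⟫) * ⟪D.C f, g⟫ = -(⟪D.C g, g⟫ + 1) / 2 := by
      field_simp
    rw [h4] at h3
    linarith
  exact inner_self_eq_zero.1 (key _)

theorem Rhalf_symm (f g : Lp ℝ 2 τ) : ⟪D.Rhalf f, g⟫ = ⟪f, D.Rhalf g⟫ :=
  D.Rhalf_pos.isSymmetric f g

/-- Moving one factor R^(1/2) across the inner product leaves ⟨R^(1/2) C R^(1/2) ζ_j, ζ_k⟩, which is
ν_j or 0; the two factors ν^(-1/2) normalize it. -/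
theorem inner_omega (hν : ∀ k, 0 < D.ν k) (j k : ℕ) :
    ⟪D.C (D.ω j), D.ω k⟫ = if j = k then 1 else 0 := by
  have h1 : ⟪D.C (D.Rhalf (D.ζ j)), D.Rhalf (D.ζ k)⟫ = D.ν j * ⟪D.ζ j, D.ζ k⟫ := by
    rw [← D.Rhalf_symm]
    have h2 := D.eigenN.eigen j
    rw [ContinuousLinearMap.comp_apply, ContinuousLinearMap.comp_apply] at h2
    rw [h2, inner_smul_left]
    simp
  rw [ω, ω, map_smul, inner_smul_left, inner_smul_right, h1,
    orthonormal_iff_ite.1 D.eigenN.orthonormal]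
  split_ifs with hjk
  · subst hjk
    have h3 : D.ν j ^ (-(1 / 2) : ℝ) * D.ν j ^ (-(1 / 2) : ℝ) = (D.ν j)⁻¹ := by
      rw [← Real.rpow_add (hν j), ← Real.rpow_neg_one]; norm_num
    simp only [RCLike.conj_to_real, mul_one]
    rw [← mul_assoc, h3, inv_mul_cancel₀ (hν j).ne']
  · simp

/-- The representation of the coefficients by elements `w k` of `H`. -/
structure IsBasis (D : Design ι p) (w : ℕ → H) : Prop where
  incl : ∀ k, ι (w k) = D.ω k
  coef_eq : ∀ f k, D.coef (ι f) k = D.ν k * rInner ι p D.C f (w k)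

theorem exists_isBasis (h : IsPenalty ι p H₀) : ∃ w, D.IsBasis w := by
  choose w hw1 hw2 using fun k => D.coef_eq h.incl h.null h.norm_eq k
  exact ⟨w, hw1, fun f k => hw2 k f⟩

variable {D} {w : ℕ → H}

theorem IsBasis.coef_basis (hw : D.IsBasis w) (hν : ∀ k, 0 < D.ν k) (j k : ℕ) :
    D.coef (ι (w j)) k = if j = k then 1 else 0 := by
  rw [hw.incl, coef, inner_omega D hν]

theorem coef_sub (f g : Lp ℝ 2 τ) (k : ℕ) : D.coef (f - g) k = D.coef f k - D.coef g k := by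
  simp [coef, inner_sub_left]

theorem coef_smul (c : ℝ) (f : Lp ℝ 2 τ) (k : ℕ) : D.coef (c • f) k = c * D.coef f k := by
  simp [coef, inner_smul_left]

theorem coef_sum {α : Type*} (s : Finset α) (f : α → Lp ℝ 2 τ) (k : ℕ) :
    D.coef (∑ i ∈ s, f i) k = ∑ i ∈ s, D.coef (f i) k := by
  simp [coef, sum_inner]

theorem continuous_coef (k : ℕ) : Continuous fun f => D.coef f k := by
  unfold coef; fun_prop

theorem IsBasis.coef_linear_comb (hw : D.IsBasis w) (hν : ∀ k, 0 < D.ν k) (s : Finset ℕ)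
    (x : ℕ → ℝ) (k : ℕ) :
    D.coef (ι (∑ j ∈ s, x j • w j)) k = if k ∈ s then x k else 0 := by
  rw [map_sum, coef_sum]
  simp only [map_smul, coef_smul, hw.coef_basis hν, mul_ite, mul_one, mul_zero]
  rw [Finset.sum_ite_eq']

/-- The penalty form in terms of the coefficients. -/
theorem IsBasis.inner_proj (hw : D.IsBasis w) (h : IsPenalty ι p H₀) (hν : ∀ k, 0 < D.ν k)
    (f : H) (k : ℕ) :
    ⟪H₀ᗮ.starProjection f, H₀ᗮ.starProjection (w k)⟫
      = ((D.ν k)⁻¹ - 1) * D.coef (ι f) k := by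
  have h1 := h.rInner_eq D.C_symm f (w k)
  have h2 := hw.coef_eq f k
  have h3 : ⟪D.C (ι f), ι (w k)⟫ = D.coef (ι f) k := by rw [hw.incl, coef]
  have h4 : rInner ι p D.C f (w k) = (D.ν k)⁻¹ * D.coef (ι f) k := by
    rw [h2, inv_mul_cancel_left₀ (hν k).ne']
  rw [h4, h3] at h1
  linarith

/-- The number ν_k⁻¹ - 1 is the squared penalty of w_k, hence nonnegative. -/
theorem IsBasis.ν_le_one (hw : D.IsBasis w) (h : IsPenalty ι p H₀) (hν : ∀ k, 0 < D.ν k)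
    (k : ℕ) : D.ν k ≤ 1 := by
  have h1 := hw.inner_proj h hν (w k) k
  rw [hw.coef_basis hν, if_pos rfl, mul_one] at h1
  have h2 : 0 ≤ ⟪H₀ᗮ.starProjection (w k), H₀ᗮ.starProjection (w k)⟫ :=
    real_inner_self_nonneg
  rw [h1] at h2
  have h3 : 1 ≤ (D.ν k)⁻¹ := by linarith
  exact (one_le_inv₀ (hν k)).1 h3

theorem IsBasis.penalty_linear_comb (hw : D.IsBasis w) (h : IsPenalty ι p H₀)
    (hν : ∀ k, 0 < D.ν k) (s : Finset ℕ) (x : ℕ → ℝ) :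
    p (∑ j ∈ s, x j • w j) ^ 2 = ∑ k ∈ s, ((D.ν k)⁻¹ - 1) * x k ^ 2 := by
  rw [h.eq_norm_projection, ← real_inner_self_eq_norm_sq]
  nth_rewrite 2 [map_sum]
  rw [inner_sum]
  refine Finset.sum_congr rfl fun k hk => ?_
  rw [map_smul, inner_smul_right, hw.inner_proj h hν, hw.coef_linear_comb hν, if_pos hk]
  ring

/-- Bessel's inequality for the penalty form: the partial expansion g has squared penalty equal to
its pairing with f, and Cauchy-Schwarz applies. -/
theorem IsBasis.sum_le_penalty (hw : D.IsBasis w) (h : IsPenalty ι p H₀)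
    (hν : ∀ k, 0 < D.ν k) (s : Finset ℕ) (f : H) :
    ∑ k ∈ s, ((D.ν k)⁻¹ - 1) * D.coef (ι f) k ^ 2 ≤ p f ^ 2 := by
  set g := ∑ k ∈ s, D.coef (ι f) k • w k with hg
  set S := ∑ k ∈ s, ((D.ν k)⁻¹ - 1) * D.coef (ι f) k ^ 2 with hS
  have h1 : p g ^ 2 = S := hw.penalty_linear_comb h hν s _
  have h2 : ⟪H₀ᗮ.starProjection f, H₀ᗮ.starProjection g⟫ = S := by
    rw [hg, map_sum, inner_sum]
    refine Finset.sum_congr rfl fun k _ => ?_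
    rw [map_smul, inner_smul_right, hw.inner_proj h hν]
    ring
  have h3 : S ≤ p f * p g := by
    rw [← h2, h.eq_norm_projection, h.eq_norm_projection]
    exact real_inner_le_norm _ _
  have h4 : 0 ≤ S := h1 ▸ sq_nonneg _
  nlinarith [sq_nonneg (p f - p g)]

/-- Bessel's inequality for the covariance form, from its positivity at f - g. -/
theorem IsBasis.sum_le_form (hw : D.IsBasis w) (hν : ∀ k, 0 < D.ν k)
    (s : Finset ℕ) (f : H) :
    ∑ k ∈ s, D.coef (ι f) k ^ 2 ≤ ⟪D.C (ι f), ι f⟫ := by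
  set g := ∑ k ∈ s, D.coef (ι f) k • w k with hg
  have h1 : ∀ u : H, ⟪D.C (ι u), ι g⟫ = ∑ k ∈ s, D.coef (ι f) k * D.coef (ι u) k := by
    intro u
    rw [hg, map_sum, inner_sum]
    refine Finset.sum_congr rfl fun k _ => ?_
    rw [map_smul, inner_smul_right, hw.incl, coef]
    rfl
  have h2 : ⟪D.C (ι g), ι g⟫ = ∑ k ∈ s, D.coef (ι f) k ^ 2 := by
    rw [h1]
    refine Finset.sum_congr rfl fun k hk => ?_
    rw [hg, hw.coef_linear_comb hν, if_pos hk, sq]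
  have h3 : ⟪D.C (ι f), ι g⟫ = ∑ k ∈ s, D.coef (ι f) k ^ 2 := by
    rw [h1]; simp only [sq]
  have h4 := D.C_nonneg (ι f - ι g)
  have h5 := D.C_symm (ι g) (ι f)
  simp only [map_sub, inner_sub_left, inner_sub_right] at h4
  linarith

/-- An element of `H` all of whose coefficients vanish is in the kernel of `C`. -/
theorem C_eq_zero_of_coef (h : IsPenalty ι p H₀) (hν : ∀ k, 0 < D.ν k) {f : H}
    (hf : ∀ k, D.coef (ι f) k = 0) : D.C (ι f) = 0 := by
  -- The representer G of g ↦ ⟨C f, g⟩ satisfies ι G = R C f. It suffices to show G = 0, because ⟨C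
  -- f, f⟩ = ⟨f, G⟩_R.
  obtain ⟨G, hG⟩ := h.exists_representer D.C_symm D.C_nonneg D.nondegenerate
    (innerSL ℝ (D.C (ι f)) ∘L ⟨ι, inclusion_continuous h.incl⟩)
  have hG' : ∀ g, rInner ι p D.C g G = ⟪ι g, D.C (ι f)⟫ := fun g => by
    rw [hG, real_inner_comm]; rfl
  have hιG : ι G = D.R (D.C (ι f)) := by
    refine Lp.ext ?_
    filter_upwards [h.integralOperator_eq D.C_symm D.kerR_spec hG', D.R_spec (D.C (ι f))]
      with t ht1 ht2
    rw [ht1, ht2]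
  have h1 : ∀ k, ⟪D.ζ k, D.Rhalf (D.C (ι f))⟫ = 0 := by
    intro k
    have h2 := hf k
    rw [coef, ω, inner_smul_right, ← D.Rhalf_symm, mul_eq_zero] at h2
    rw [real_inner_comm]
    exact h2.resolve_left (Real.rpow_pos_of_pos (hν k) _).ne'
  -- The vector R^(1/2) C f is orthogonal to every ζ_k, so R^(1/2) C R^(1/2) annihilates it, that
  -- is, R^(1/2) C ι G = 0. Pairing this with R^(1/2) C f gives ⟨C ι G, ι G⟩ = 0.
  have h2 := D.eigenN.complete _ h1
  simp only [ContinuousLinearMap.comp_apply] at h2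
  have hRR : ∀ x, D.Rhalf (D.Rhalf x) = D.R x := fun x => by rw [← D.Rhalf_sq]; rfl
  rw [hRR, ← hιG] at h2
  have h3 : D.C (ι G) = 0 := by
    apply D.C_eq_zero
    rw [hιG, ← hRR, ← D.Rhalf_symm, hRR, ← hιG, h2, inner_zero_left]
  have h4 : rInner ι p D.C G G = 0 := by
    rw [hG', real_inner_comm, D.C_symm, h3, inner_zero_left]
  have h5 : G = 0 := by
    by_contra hne
    rw [h.rInner_eq D.C_symm, h3, inner_zero_left, zero_add, real_inner_self_eq_norm_sq,
      ← h.eq_norm_projection] at h4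
    exact D.nondegenerate G (pow_eq_zero_iff two_ne_zero |>.1 h4) hne h3
  apply D.C_eq_zero
  have h6 := hG' f
  rw [h5, h.rInner_eq D.C_symm] at h6
  simp only [map_zero, inner_zero_right, add_zero] at h6
  rw [real_inner_comm]
  exact h6.symm

/-- The expansion of an element of `H` in the basis converges in `H`, up to the kernel of `C`. -/
theorem IsBasis.exists_tendsto (hw : D.IsBasis w) (h : IsPenalty ι p H₀)
    (hν : ∀ k, 0 < D.ν k) (f : H) :
    ∃ u : H, Tendsto (fun n => ∑ k ∈ Finset.range n, D.coef (ι f) k • w k) atTop (𝓝 u) ∧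
      D.C (ι f - ι u) = 0 := by
  set x := D.coef (ι f) with hx
  set s : ℕ → H := fun n => ∑ k ∈ Finset.range n, x k • w k with hs
  obtain ⟨c, hc, hcoer⟩ := exists_coercive (H₀ := H₀) h.incl D.C D.C_symm D.C_nonneg
    (fun f hf hf0 => D.nondegenerate f ((h.null f).1 hf) hf0)
  -- The right side is the squared R-norm of the partial sum. By the two Bessel inequalities these
  -- sums converge, and coercivity turns this into convergence in H. The limit has the coefficients
  -- of f, so the difference is in the kernel of C.
  have hcoer' : ∀ S : Finset ℕ, c * ‖∑ k ∈ S, x k • w k‖ ^ 2 ≤ ∑ k ∈ S, (D.ν k)⁻¹ * x k ^ 2 := by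
    intro S
    refine (hcoer _).trans (le_of_eq ?_)
    rw [← h.eq_norm_projection, hw.penalty_linear_comb h hν]
    have h1 : ⟪D.C (ι (∑ k ∈ S, x k • w k)), ι (∑ k ∈ S, x k • w k)⟫ = ∑ k ∈ S, x k ^ 2 := by
      nth_rewrite 2 [map_sum]
      rw [inner_sum]
      refine Finset.sum_congr rfl fun k hk => ?_
      have := hw.coef_linear_comb hν S x k
      rw [if_pos hk, coef, ← hw.incl] at this
      rw [map_smul, inner_smul_right, this, sq]
    rw [h1, ← Finset.sum_add_distrib]
    exact Finset.sum_congr rfl fun k _ => by ring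
  have hsum : Summable fun k => (D.ν k)⁻¹ * x k ^ 2 := by
    refine summable_of_sum_le (c := ⟪D.C (ι f), ι f⟫ + p f ^ 2)
      (fun k => mul_nonneg (inv_nonneg.2 (hν k).le) (sq_nonneg _)) fun S => ?_
    have h1 := hw.sum_le_form hν S f
    have h2 := hw.sum_le_penalty h hν S f
    calc _ = ∑ k ∈ S, D.coef (ι f) k ^ 2 + ∑ k ∈ S, ((D.ν k)⁻¹ - 1) * D.coef (ι f) k ^ 2 := by
          rw [← Finset.sum_add_distrib]
          exact Finset.sum_congr rfl fun k _ => by rw [hx]; ring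
      _ ≤ _ := add_le_add h1 h2
  have hsumm : Summable fun k => x k • w k := by
    rw [summable_iff_vanishing_norm]
    intro ε hε
    obtain ⟨S, hS⟩ := (summable_iff_vanishing_norm.1 hsum) (c * ε ^ 2) (by positivity)
    refine ⟨S, fun t ht => ?_⟩
    have h1 := hS t ht
    have h2 := hcoer' t
    have h3 : c * ‖∑ k ∈ t, x k • w k‖ ^ 2 < c * ε ^ 2 :=
      h2.trans_lt ((le_abs_self _).trans_lt h1)
    exact lt_of_pow_lt_pow_left₀ 2 hε.le (lt_of_mul_lt_mul_left h3 hc.le)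
  refine ⟨_, hsumm.hasSum.tendsto_sum_nat, ?_⟩
  rw [← map_sub]
  refine C_eq_zero_of_coef h hν fun k => ?_
  have hcont : Continuous fun v : H => D.coef (ι v) k :=
    (continuous_coef k).comp (inclusion_continuous h.incl)
  have h1 := (hcont.tendsto _).comp hsumm.hasSum.tendsto_sum_nat
  have h2 : Tendsto ((fun v : H => D.coef (ι v) k) ∘
      fun n => ∑ k ∈ Finset.range n, x k • w k) atTop (𝓝 (x k)) := by
    refine tendsto_const_nhds.congr' ?_
    filter_upwards [eventually_gt_atTop k] with n hn
    simp only [Function.comp]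
    rw [hw.coef_linear_comb hν, if_pos (Finset.mem_range.2 hn)]
  rw [map_sub, coef_sub, tendsto_nhds_unique h1 h2, hx, sub_self]

theorem IsBasis.tendsto_form (hw : D.IsBasis w) (h : IsPenalty ι p H₀)
    (hν : ∀ k, 0 < D.ν k) (f : H) :
    Tendsto (fun n => ∑ k ∈ Finset.range n, D.coef (ι f) k ^ 2) atTop
      (𝓝 ⟪D.C (ι f), ι f⟫) := by
  obtain ⟨u, hu, hC⟩ := hw.exists_tendsto h hν f
  have h1 : Tendsto (fun n => ⟪D.C (ι f), ι (∑ k ∈ Finset.range n, D.coef (ι f) k • w k)⟫)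
      atTop (𝓝 ⟪D.C (ι f), ι u⟫) :=
    ((continuous_const.inner (inclusion_continuous h.incl)).tendsto u).comp hu
  have h2 : ⟪D.C (ι f), ι u⟫ = ⟪D.C (ι f), ι f⟫ := by
    have : ⟪D.C (ι f), ι f - ι u⟫ = 0 := by rw [D.C_symm, hC, inner_zero_left]
    rw [inner_sub_right] at this
    linarith
  rw [← h2]
  refine h1.congr fun n => ?_
  rw [map_sum, inner_sum]
  refine Finset.sum_congr rfl fun k _ => ?_
  rw [map_smul, inner_smul_right, hw.incl, sq]
  rfl

/-- The expansion of a linear functional that vanishes on the kernel of `C`. -/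
theorem IsBasis.tendsto_inner (hw : D.IsBasis w) (h : IsPenalty ι p H₀)
    (hν : ∀ k, 0 < D.ν k) (f : H) {x : Lp ℝ 2 τ} (hx : ∀ g, D.C g = 0 → ⟪x, g⟫ = 0) :
    Tendsto (fun n => ∑ k ∈ Finset.range n, D.coef (ι f) k * ⟪x, D.ω k⟫) atTop
      (𝓝 ⟪x, ι f⟫) := by
  obtain ⟨u, hu, hC⟩ := hw.exists_tendsto h hν f
  have h1 : Tendsto (fun n => ⟪x, ι (∑ k ∈ Finset.range n, D.coef (ι f) k • w k)⟫)
      atTop (𝓝 ⟪x, ι u⟫) :=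
    ((continuous_const.inner (inclusion_continuous h.incl)).tendsto u).comp hu
  have h2 : ⟪x, ι u⟫ = ⟪x, ι f⟫ := by
    have := hx _ hC
    rw [inner_sub_right] at this
    linarith
  rw [← h2]
  refine h1.congr fun n => ?_
  rw [map_sum, inner_sum]
  refine Finset.sum_congr rfl fun k _ => ?_
  rw [map_smul, inner_smul_right, hw.incl]

end Design

end Geometry

end FLR


namespace FLR

/-! ### Growth of the eigenvalue ratios in the class, and the effective dimension. -/

section ClassBounds

variable {T H : Type*} [MeasurableSpace T] {τ : Measure T}
  [NormedAddCommGroup H] [InnerProductSpace ℝ H] [RKHS ℝ H T ℝ]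
  {ι : H →ₗ[ℝ] Lp ℝ 2 τ} {p : Seminorm ℝ H}

/-- The growth of `γ_k⁻¹ = ν_k⁻¹ - 1`, with constants that are uniform over the class. -/
theorem Design.growth {ρ : ℕ → ℝ} {r s M A A' : ℝ} {k₀ k₀' : ℕ}
    (hρ : Comparable A' k₀' ρ fun k => ((k : ℝ) + 1) ^ (-(2 * r))) {D : Design ι p}
    (hD : D.InClassWith ρ s M A k₀) {k : ℕ} (hk : max k₀ k₀' ≤ k) :
    (A ^ 2 * A')⁻¹ * ((k : ℝ) + 1) ^ (2 * (r + s)) ≤ (D.ν k)⁻¹ - 1 ∧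
      (D.ν k)⁻¹ - 1 ≤ A ^ 2 * A' * ((k : ℝ) + 1) ^ (2 * (r + s)) := by
  obtain ⟨hA', hρ'⟩ := hρ
  obtain ⟨hA, hμ'⟩ := hD.eigenvalues
  obtain ⟨-, hγ'⟩ := hD.ratios
  obtain ⟨h1, h2⟩ := hρ' k (le_trans (le_max_right _ _) hk)
  obtain ⟨h3, h4⟩ := hμ' k (le_trans (le_max_left _ _) hk)
  obtain ⟨h5, h6⟩ := hγ' k (le_trans (le_max_left _ _) hk)
  have hk1 : (0 : ℝ) < (k : ℝ) + 1 := by positivity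
  have hx : ((k : ℝ) + 1) ^ (2 * (r + s)) = (((k : ℝ) + 1) ^ (-(2 * r)))⁻¹ *
      (((k : ℝ) + 1) ^ (-(2 * s)))⁻¹ := by
    rw [← Real.rpow_neg hk1.le, ← Real.rpow_neg hk1.le, ← Real.rpow_add hk1]
    congr 1; ring
  have hR : 0 < ((k : ℝ) + 1) ^ (-(2 * r)) := Real.rpow_pos_of_pos hk1 _
  have hS : 0 < ((k : ℝ) + 1) ^ (-(2 * s)) := Real.rpow_pos_of_pos hk1 _
  rw [hx]
  set X := ((k : ℝ) + 1) ^ (-(2 * r))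
  set Y := ((k : ℝ) + 1) ^ (-(2 * s))
  have hρpos : 0 < ρ k := by
    by_contra hn
    nlinarith
  have hμpos : 0 < D.μ k := by
    by_contra hn
    nlinarith
  simp only [Design.γ] at h5 h6
  -- A positive multiple of γ_k dominates the positive number ρ_k μ_k, so γ_k is not the default
  -- value 0 of an inverse, and ν_k ≠ 1 for these k.
  have hpos : 0 < ((D.ν k)⁻¹ - 1)⁻¹ := by
    by_contra hn
    have := mul_pos hρpos hμpos
    nlinarith
  have hg : 0 < (D.ν k)⁻¹ - 1 := inv_pos.1 hpos
  set g := (D.ν k)⁻¹ - 1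
  constructor
  · have h7 : g⁻¹ ≤ A ^ 2 * A' * (X * Y) := by
      calc g⁻¹ ≤ A * (ρ k * D.μ k) := h5
        _ ≤ A * ((A' * X) * (A * Y)) := by gcongr
        _ = _ := by ring
    have h8 := inv_anti₀ hpos h7
    rw [inv_inv] at h8
    refine le_trans (le_of_eq ?_) h8
    rw [mul_inv (A ^ 2 * A') (X * Y), mul_inv X Y]
  · have h7 : X * Y ≤ A ^ 2 * A' * g⁻¹ := by
      calc X * Y ≤ (A' * ρ k) * (A * D.μ k) := by gcongr
        _ = A * A' * (ρ k * D.μ k) := by ring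
        _ ≤ A * A' * (A * g⁻¹) := by gcongr
        _ = _ := by ring
    rw [← mul_inv, ← div_eq_mul_inv, le_div_iff₀ (by positivity)]
    calc g * (X * Y) ≤ g * (A ^ 2 * A' * g⁻¹) := by gcongr
      _ = _ := by field_simp

/-- The growth bound gives positivity for large indices only; monotonicity of ν carries it down to
the others. -/
theorem Design.ν_pos {ρ : ℕ → ℝ} {r s M A : ℝ} {k₀ : ℕ}
    (hρ : AsympEquiv ρ fun k => ((k : ℝ) + 1) ^ (-(2 * r))) {D : Design ι p}
    (hD : D.InClassWith ρ s M A k₀) (k : ℕ) : 0 < D.ν k := by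
  obtain ⟨A', k₀', hρ⟩ := hρ
  set j := max k (max k₀ k₀')
  have h1 := (D.growth hρ hD (k := j) (le_max_right _ _)).1
  have h2 : 0 < (A ^ 2 * A')⁻¹ * ((j : ℝ) + 1) ^ (2 * (r + s)) := by
    have := hρ.1
    have := hD.eigenvalues.1
    positivity
  have h3 : 0 < D.ν j := inv_pos.1 (by linarith)
  exact h3.trans_le (D.eigenN.antitone (le_max_left _ _))

end ClassBounds

/-- A bound for the effective dimension when the inverse eigenvalue ratios grow like a power. -/
theorem tsum_effective_le {q c : ℝ} (hq : 1 ≤ q) (hc : 0 < c) {k₁ : ℕ} {g : ℕ → ℝ}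
    (hg0 : ∀ k, 0 ≤ g k) (hg : ∀ k, k₁ ≤ k → c * ((k : ℝ) + 1) ^ (2 * q) ≤ g k)
    {lam : ℝ} (hlam : 0 < lam) :
    ∑' k, ENNReal.ofReal ((1 + lam * g k)⁻¹)
      ≤ ENNReal.ofReal (k₁ + 4 * (c * lam) ^ (-(1 / (2 * q)))) := by
  set e := (c * lam) ^ (1 / (2 * q)) with he
  have hcl : 0 < c * lam := mul_pos hc hlam
  have he0 : 0 < e := Real.rpow_pos_of_pos hcl _
  have heq : e ^ (2 * q) = c * lam := by
    rw [he, ← Real.rpow_mul hcl.le, one_div, inv_mul_cancel₀ (by linarith), Real.rpow_one]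
  rw [Real.rpow_neg hcl.le, ← he]
  -- With y = e(k+1) the growth hypothesis reads y^(2q) ≤ λ g_k, and q ≥ 1 gives y² ≤ 1 + 2 λ g_k.
  -- Hence (1 + ek)(1 + e(k+1)) ≤ (1 + y)² ≤ 4(1 + λ g_k). The reciprocal of this product
  -- telescopes, with total at most 1/e.
  have hterm : ∀ k, (1 + lam * g k)⁻¹ ≤ (if k < k₁ then 1 else 0)
      + 4 * e⁻¹ * ((1 + e * k)⁻¹ - (1 + e * ((k + 1 : ℕ) : ℝ))⁻¹) := by
    intro k
    have hdiff : e⁻¹ * ((1 + e * k)⁻¹ - (1 + e * ((k + 1 : ℕ) : ℝ))⁻¹)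
        = ((1 + e * k) * (1 + e * (k + 1)))⁻¹ := by
      have h1 : (1 + e * k) ≠ 0 := by positivity
      have h2 : (1 + e * (k + 1 : ℝ)) ≠ 0 := by positivity
      push_cast
      field_simp
      ring
    have hpos : 0 < 1 + lam * g k := by
      have := mul_nonneg hlam.le (hg0 k); linarith
    rw [mul_assoc, hdiff]
    split_ifs with hk
    · have h1 : (1 + lam * g k)⁻¹ ≤ 1 := inv_le_one_of_one_le₀ (by
        have := mul_nonneg hlam.le (hg0 k); linarith)
      have h2 : 0 ≤ 4 * ((1 + e * k) * (1 + e * ((k : ℝ) + 1)))⁻¹ := by positivity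
      linarith
    · have h1 := hg k (not_lt.1 hk)
      set y := e * ((k : ℝ) + 1) with hy
      have hy0 : 0 < y := by positivity
      have h2 : y ^ (2 * q) ≤ lam * g k := by
        rw [hy, Real.mul_rpow he0.le (by positivity), heq]
        calc c * lam * ((k : ℝ) + 1) ^ (2 * q) = lam * (c * ((k : ℝ) + 1) ^ (2 * q)) := by ring
          _ ≤ _ := by gcongr
      have h3 : y ^ 2 ≤ 1 + 2 * (lam * g k) := by
        rcases le_total y 1 with hy1 | hy1
        · have := mul_nonneg hlam.le (hg0 k)
          nlinarith
        · have : y ^ (2 : ℝ) ≤ y ^ (2 * q) := Real.rpow_le_rpow_of_exponent_le hy1 (by linarith)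
          rw [Real.rpow_two] at this
          have := mul_nonneg hlam.le (hg0 k)
          linarith
      rw [zero_add, ← div_eq_mul_inv, le_div_iff₀ (by positivity), inv_mul_le_iff₀ hpos]
      have h4 : e * k ≤ y := by rw [hy]; nlinarith
      have h5 : 0 ≤ e * k := by positivity
      nlinarith [sq_nonneg (y - 1)]
  have hsum : ∀ n, ∑ k ∈ Finset.range n, (1 + lam * g k)⁻¹ ≤ k₁ + 4 * e⁻¹ := by
    intro n
    refine (Finset.sum_le_sum fun k _ => hterm k).trans ?_
    rw [Finset.sum_add_distrib, ← Finset.mul_sum]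
    have h1 : ∑ k ∈ Finset.range n, (if k < k₁ then (1 : ℝ) else 0) ≤ k₁ := by
      rw [Finset.sum_ite, Finset.sum_const_zero, add_zero, Finset.sum_const, nsmul_eq_mul, mul_one]
      have : (Finset.filter (fun k => k < k₁) (Finset.range n)).card ≤ (Finset.range k₁).card := by
        refine Finset.card_le_card fun k hk => ?_
        simp only [Finset.mem_filter, Finset.mem_range] at hk ⊢
        exact hk.2
      rw [Finset.card_range] at this
      exact_mod_cast this
    have h2 := Finset.sum_range_sub' (fun k : ℕ => (1 + e * (k : ℝ))⁻¹) n
    rw [h2]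
    have h3 : (1 + e * ((0 : ℕ) : ℝ))⁻¹ - (1 + e * (n : ℝ))⁻¹ ≤ 1 := by
      have : 0 ≤ (1 + e * (n : ℝ))⁻¹ := by positivity
      simp only [Nat.cast_zero, mul_zero, add_zero, inv_one]
      linarith
    have h4 : 4 * e⁻¹ * ((1 + e * ((0 : ℕ) : ℝ))⁻¹ - (1 + e * (n : ℝ))⁻¹) ≤ 4 * e⁻¹ * 1 := by
      gcongr
    linarith
  refine ENNReal.tsum_le_of_sum_range_le fun n => ?_
  rw [← ENNReal.ofReal_sum_of_nonneg]
  · exact ENNReal.ofReal_le_ofReal (hsum n)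
  · intro k _
    have := mul_nonneg hlam.le (hg0 k)
    positivity

end FLR


namespace FLR

/-! ### Weighted errors of empirical averages. -/

section Averages

variable {E : Type*} [MeasurableSpace E] (P : Measure E) [IsProbabilityMeasure P]

/-- The second moment of the average of `n` independent copies of a centered variable. -/
theorem lintegral_average_sq {f : E → ℝ} (hf : MemLp f 2 P) (h0 : ∫ x, f x ∂P = 0) {v : ℝ}
    (hv : ∫ x, f x ^ 2 ∂P ≤ v) (n : ℕ) :
    ∫⁻ z : Fin n → E, ENNReal.ofReal ((1 / (n : ℝ) * ∑ i, f (z i)) ^ 2)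
      ∂Measure.pi (fun _ => P) ≤ ENNReal.ofReal (v / n) := by
  have hmem : ∀ i : Fin n, MemLp (fun z : Fin n → E => f (z i)) 2 (Measure.pi fun _ => P) :=
    fun i => hf.comp_measurePreserving (measurePreserving_eval _ i)
  have hsum : MemLp (∑ i : Fin n, fun z : Fin n → E => f (z i)) 2 (Measure.pi fun _ => P) :=
    memLp_finsetSum' _ fun i _ => hmem i
  have hint : ∀ i : Fin n, ∫ z : Fin n → E, f (z i) ∂(Measure.pi fun _ => P) = 0 := by
    intro i
    have h1 : Measure.map (fun z : Fin n → E => z i) (Measure.pi fun _ => P) = P :=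
      (measurePreserving_eval (fun _ : Fin n => P) i).map_eq
    have h2 := integral_map (μ := Measure.pi fun _ : Fin n => P) (f := f)
      (φ := fun z : Fin n → E => z i) (measurable_pi_apply i).aemeasurable
      (by rw [h1]; exact hf.aestronglyMeasurable)
    rw [← h2, ← h0, h1]
  have hmean : ∫ z, (∑ i : Fin n, fun z : Fin n → E => f (z i)) z ∂(Measure.pi fun _ => P) = 0 := by
    simp only [Finset.sum_apply]
    rw [integral_finsetSum _ fun i _ => (hmem i).integrable one_le_two]
    simp [hint]
  have hvar := variance_sum_pi (ι := Fin n) (μ := fun _ => P) (X := fun _ => f) fun _ => hf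
  rw [variance_of_integral_eq_zero hsum.aestronglyMeasurable.aemeasurable hmean] at hvar
  simp only [Finset.sum_apply, variance_of_integral_eq_zero hf.aestronglyMeasurable.aemeasurable h0,
    Finset.sum_const, Finset.card_univ, Fintype.card_fin, nsmul_eq_mul] at hvar
  have hsq : Integrable (fun z : Fin n → E => (∑ i, f (z i)) ^ 2) (Measure.pi fun _ => P) := by
    have := hsum.integrable_sq
    simpa only [Finset.sum_apply] using this
  rw [← ofReal_integral_eq_lintegral_ofReal]
  · refine ENNReal.ofReal_le_ofReal ?_
    simp only [mul_pow]
    rw [integral_const_mul]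
    -- For n = 0 both sides vanish, by the convention for division by zero.
    rcases Nat.eq_zero_or_pos n with hn | hn
    · subst hn; simp
    have hn' : (0 : ℝ) < n := Nat.cast_pos.2 hn
    calc (1 / (n : ℝ)) ^ 2 * ∫ z : Fin n → E, (∑ i, f (z i)) ^ 2 ∂(Measure.pi fun _ => P)
        = (1 / (n : ℝ)) ^ 2 * (n * ∫ x, f x ^ 2 ∂P) := by rw [hvar]
      _ ≤ (1 / (n : ℝ)) ^ 2 * (n * v) := by gcongr
      _ = v / n := by field_simp
  · simp only [mul_pow]
    exact hsq.const_mul _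
  · exact Eventually.of_forall fun z => sq_nonneg _

/-- The weighted Hilbert-Schmidt distance of an empirical Gram matrix to the identity. -/
noncomputable def gramError (v : ℕ → ℝ) {n : ℕ} (x : Fin n → ℕ → ℝ) : ℝ≥0∞ :=
  ∑' q : ℕ × ℕ, ENNReal.ofReal (v q.1 * v q.2) *
    ENNReal.ofReal ((1 / (n : ℝ) * ∑ i, (x i q.1 * x i q.2 - if q.1 = q.2 then 1 else 0)) ^ 2)

/-- The weighted norm of the empirical covariance of features and noise. -/
noncomputable def noiseError (v : ℕ → ℝ) {n : ℕ} (x : Fin n → ℕ → ℝ) (e : Fin n → ℝ) : ℝ≥0∞ :=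
  ∑' k : ℕ, ENNReal.ofReal (v k) * ENNReal.ofReal ((1 / (n : ℝ) * ∑ i, e i * x i k) ^ 2)

/-- Each entry is the average of n centred independent variables, with second moment at most E g_j²
g_k² ≤ (E g_j⁴ + E g_k⁴)/2 ≤ M. Summing v_j v_k over all pairs gives the square of the sum of the
weights. -/
theorem lintegral_gramError {g : ℕ → E → ℝ} (hg : ∀ k, Measurable (g k))
    (h4 : ∀ k, Integrable (fun x => g k x ^ 4) P) {M : ℝ} (hM : ∀ k, ∫ x, g k x ^ 4 ∂P ≤ M)
    (hgram : ∀ j k, ∫ x, g j x * g k x ∂P = if j = k then 1 else 0)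
    {v : ℕ → ℝ} (hv : ∀ k, 0 ≤ v k) (n : ℕ) :
    ∫⁻ z : Fin n → E, gramError v (fun i k => g k (z i)) ∂Measure.pi (fun _ => P)
      ≤ ENNReal.ofReal (M / n) * (∑' k, ENNReal.ofReal (v k)) ^ 2 := by
  have hint2 : ∀ j k, Integrable (fun x => (g j x * g k x) ^ 2) P := by
    intro j k
    refine ((h4 j).add (h4 k)).mono (((hg j).mul (hg k)).pow_const 2).aestronglyMeasurable ?_
    refine Eventually.of_forall fun x => ?_
    simp only [Pi.add_apply, Real.norm_eq_abs]
    rw [abs_of_nonneg (by positivity), abs_of_nonneg (by positivity)]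
    nlinarith [sq_nonneg (g j x ^ 2 - g k x ^ 2), sq_nonneg (g j x ^ 2), sq_nonneg (g k x ^ 2)]
  have hmem : ∀ j k, MemLp (fun x => g j x * g k x) 2 P := fun j k =>
    (memLp_two_iff_integrable_sq ((hg j).mul (hg k)).aestronglyMeasurable).2 (hint2 j k)
  unfold gramError
  rw [lintegral_tsum]
  swap
  · intro q
    refine Measurable.aemeasurable (Measurable.const_mul ?_ _)
    refine ENNReal.measurable_ofReal.comp (Measurable.pow_const (Measurable.const_mul ?_ _) _)
    refine Finset.measurable_sum _ fun i _ => Measurable.sub_const ?_ _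
    exact ((hg _).comp (measurable_pi_apply i)).mul ((hg _).comp (measurable_pi_apply i))
  have hterm : ∀ q : ℕ × ℕ, ∫⁻ z : Fin n → E, ENNReal.ofReal (v q.1 * v q.2) *
      ENNReal.ofReal ((1 / (n : ℝ) * ∑ i, (g q.1 (z i) * g q.2 (z i)
        - if q.1 = q.2 then 1 else 0)) ^ 2) ∂Measure.pi (fun _ => P)
      ≤ ENNReal.ofReal (v q.1 * v q.2) * ENNReal.ofReal (M / n) := by
    rintro ⟨j, k⟩
    rw [lintegral_const_mul']
    swap
    · exact ENNReal.ofReal_ne_top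
    refine mul_le_mul_right (lintegral_average_sq P (f := fun x => g j x * g k x
      - if j = k then 1 else 0) ((hmem j k).sub (memLp_const _)) ?_ ?_ n) _
    · rw [integral_sub ((hmem j k).integrable one_le_two) (integrable_const _), hgram]
      simp
    · have h1 : ∫ x, (g j x * g k x - if j = k then 1 else 0) ^ 2 ∂P
          = ∫ x, (g j x * g k x) ^ 2 ∂P - if j = k then 1 else 0 := by
        have h2 : ∀ x, (g j x * g k x - if j = k then 1 else 0) ^ 2 = (g j x * g k x) ^ 2
            - (2 * (if j = k then 1 else 0) * (g j x * g k x) - if j = k then 1 else 0) := by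
          intro x; split_ifs <;> ring
        simp only [h2]
        rw [integral_sub (hint2 j k), integral_sub, integral_const_mul, hgram]
        · split_ifs <;> simp; norm_num
        · exact ((hmem j k).integrable one_le_two).const_mul _
        · exact integrable_const _
        · exact (((hmem j k).integrable one_le_two).const_mul _).sub (integrable_const _)
      have h3 : ∫ x, (g j x * g k x) ^ 2 ∂P ≤ ∫ x, (g j x ^ 4 + g k x ^ 4) / 2 ∂P := by
        refine integral_mono (hint2 j k) (((h4 j).add (h4 k)).div_const 2) fun x => ?_
        simp only
        nlinarith [sq_nonneg (g j x ^ 2 - g k x ^ 2)]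
      rw [integral_div, integral_add (h4 j) (h4 k)] at h3
      have h5 := hM j
      have h6 := hM k
      have h7 : (0 : ℝ) ≤ if j = k then 1 else 0 := by split_ifs <;> norm_num
      linarith
  refine (ENNReal.tsum_le_tsum hterm).trans (le_of_eq ?_)
  rw [ENNReal.tsum_mul_right, mul_comm, sq, ENNReal.tsum_prod']
  congr 1
  rw [← ENNReal.tsum_mul_right]
  refine tsum_congr fun j => ?_
  rw [← ENNReal.tsum_mul_left]
  exact tsum_congr fun k => ENNReal.ofReal_mul (hv j)

theorem lintegral_noiseError {g : ℕ → E → ℝ} {e : E → ℝ}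
    (hg : ∀ k, Measurable (g k)) (he : Measurable e)
    (hint : ∀ k, MemLp (fun x => e x * g k x) 2 P) (h0 : ∀ k, ∫ x, e x * g k x ∂P = 0)
    {M₂ : ℝ} (hM : ∀ k, ∫ x, (e x * g k x) ^ 2 ∂P ≤ M₂)
    (v : ℕ → ℝ) (n : ℕ) :
    ∫⁻ z : Fin n → E, noiseError v (fun i k => g k (z i)) (fun i => e (z i))
      ∂Measure.pi (fun _ => P) ≤ ENNReal.ofReal (M₂ / n) * ∑' k, ENNReal.ofReal (v k) := by
  unfold noiseError
  rw [lintegral_tsum]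
  swap
  · intro k
    refine Measurable.aemeasurable (Measurable.const_mul ?_ _)
    refine ENNReal.measurable_ofReal.comp (Measurable.pow_const (Measurable.const_mul ?_ _) _)
    refine Finset.measurable_sum _ fun i _ => ?_
    exact (he.comp (measurable_pi_apply i)).mul ((hg _).comp (measurable_pi_apply i))
  rw [← ENNReal.tsum_mul_left]
  refine ENNReal.tsum_le_tsum fun k => ?_
  rw [lintegral_const_mul' _ _ ENNReal.ofReal_ne_top, mul_comm]
  exact mul_le_mul_left (lintegral_average_sq P (f := fun x => e x * g k x) (hint k) (h0 k)
    (hM k) n) _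

theorem measurable_gramError {g : ℕ → E → ℝ} (hg : ∀ k, Measurable (g k)) (v : ℕ → ℝ) (n : ℕ) :
    Measurable fun z : Fin n → E => gramError v (fun i k => g k (z i)) := by
  refine Measurable.tsum fun q => Measurable.const_mul ?_ _
  refine ENNReal.measurable_ofReal.comp (Measurable.pow_const (Measurable.const_mul ?_ _) _)
  refine Finset.measurable_sum _ fun i _ => Measurable.sub_const ?_ _
  exact ((hg _).comp (measurable_pi_apply i)).mul ((hg _).comp (measurable_pi_apply i))

theorem measurable_noiseError {g : ℕ → E → ℝ} {e : E → ℝ} (hg : ∀ k, Measurable (g k))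
    (he : Measurable e) (v : ℕ → ℝ) (n : ℕ) :
    Measurable fun z : Fin n → E => noiseError v (fun i k => g k (z i)) (fun i => e (z i)) := by
  refine Measurable.tsum fun k => Measurable.const_mul ?_ _
  refine ENNReal.measurable_ofReal.comp (Measurable.pow_const (Measurable.const_mul ?_ _) _)
  refine Finset.measurable_sum _ fun i _ => ?_
  exact (he.comp (measurable_pi_apply i)).mul ((hg _).comp (measurable_pi_apply i))

/-- Perturbation of a quadratic form, by the Cauchy-Schwarz inequality for matrices. -/
theorem gram_form_le {v : ℕ → ℝ} (hv : ∀ k, 0 < v k) {n : ℕ} (hn : 0 < n) {x : Fin n → ℕ → ℝ}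
    {δ : ℝ} (hδ : 0 ≤ δ) (hx : gramError v x ≤ ENNReal.ofReal (δ ^ 2)) (h : ℕ → ℝ)
    (s : Finset ℕ) :
    ∑ k ∈ s, h k ^ 2 - δ * ∑ k ∈ s, h k ^ 2 / v k
      ≤ 1 / (n : ℝ) * ∑ i, (∑ k ∈ s, h k * x i k) ^ 2 := by
  set E : ℕ × ℕ → ℝ := fun q =>
    1 / (n : ℝ) * ∑ i, (x i q.1 * x i q.2 - if q.1 = q.2 then 1 else 0) with hE
  set Q := ∑ k ∈ s, h k ^ 2 / v k with hQ
  have hQ0 : 0 ≤ Q := Finset.sum_nonneg fun k _ => div_nonneg (sq_nonneg _) (hv k).le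
  have hn' : (n : ℝ) ≠ 0 := Nat.cast_ne_zero.2 hn.ne'
  have h1 : ∑ q ∈ s ×ˢ s, v q.1 * v q.2 * E q ^ 2 ≤ δ ^ 2 := by
    have h2 : ENNReal.ofReal (∑ q ∈ s ×ˢ s, v q.1 * v q.2 * E q ^ 2) ≤ ENNReal.ofReal (δ ^ 2) := by
      rw [ENNReal.ofReal_sum_of_nonneg
        fun q _ => mul_nonneg (mul_nonneg (hv _).le (hv _).le) (sq_nonneg _)]
      refine le_trans (le_trans (le_of_eq ?_) (ENNReal.sum_le_tsum (s ×ˢ s))) hx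
      exact Finset.sum_congr rfl fun q _ => ENNReal.ofReal_mul (mul_nonneg (hv _).le (hv _).le)
    exact (ENNReal.ofReal_le_ofReal_iff (sq_nonneg _)).1 h2
  have h2 : ∑ q ∈ s ×ˢ s, h q.1 ^ 2 / v q.1 * (h q.2 ^ 2 / v q.2) = Q ^ 2 := by
    rw [Finset.sum_product, sq, hQ, Finset.sum_mul_sum]
  -- Cauchy-Schwarz after writing h_j h_k E_jk as the product of h_j h_k / √(v_j v_k) and √(v_j v_k)
  -- E_jk.
  have h3 : (∑ q ∈ s ×ˢ s, h q.1 * h q.2 * E q) ^ 2 ≤ Q ^ 2 * δ ^ 2 := by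
    have h4 := Finset.sum_mul_sq_le_sq_mul_sq (s ×ˢ s)
      (fun q => h q.1 * h q.2 / √(v q.1 * v q.2)) (fun q => √(v q.1 * v q.2) * E q)
    have hs : ∀ q : ℕ × ℕ, 0 < v q.1 * v q.2 := fun q => mul_pos (hv _) (hv _)
    have h5 : ∀ q : ℕ × ℕ, h q.1 * h q.2 / √(v q.1 * v q.2) * (√(v q.1 * v q.2) * E q)
        = h q.1 * h q.2 * E q := by
      intro q
      have := (Real.sqrt_pos.2 (hs q)).ne'
      field_simp
    have h6 : ∀ q : ℕ × ℕ, (h q.1 * h q.2 / √(v q.1 * v q.2)) ^ 2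
        = h q.1 ^ 2 / v q.1 * (h q.2 ^ 2 / v q.2) := by
      intro q
      rw [div_pow, Real.sq_sqrt (hs q).le, mul_pow, mul_div_mul_comm]
    have h7 : ∀ q : ℕ × ℕ, (√(v q.1 * v q.2) * E q) ^ 2 = v q.1 * v q.2 * E q ^ 2 := by
      intro q
      rw [mul_pow, Real.sq_sqrt (hs q).le]
    simp only [h5, h6, h7] at h4
    rw [h2] at h4
    exact h4.trans (by gcongr)
  have h4 : 1 / (n : ℝ) * ∑ i, (∑ k ∈ s, h k * x i k) ^ 2
      = ∑ k ∈ s, h k ^ 2 + ∑ q ∈ s ×ˢ s, h q.1 * h q.2 * E q := by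
    have h5 : ∀ q ∈ s ×ˢ s, h q.1 * h q.2 * E q
        = 1 / (n : ℝ) * ∑ i, (h q.1 * x i q.1) * (h q.2 * x i q.2)
          - if q.1 = q.2 then h q.1 * h q.2 else 0 := by
      intro q _
      rw [hE]
      simp only [Finset.sum_sub_distrib, Finset.sum_const, Finset.card_univ, Fintype.card_fin,
        nsmul_eq_mul]
      have h6 : ∑ i, (h q.1 * x i q.1) * (h q.2 * x i q.2)
          = h q.1 * h q.2 * ∑ i, x i q.1 * x i q.2 := by
        rw [Finset.mul_sum]
        exact Finset.sum_congr rfl fun i _ => by ring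
      rw [h6]
      split_ifs <;> [field_simp; (field_simp; ring)]
    rw [Finset.sum_congr rfl h5, Finset.sum_sub_distrib, ← Finset.mul_sum, Finset.sum_comm]
    have h7 : ∑ q ∈ s ×ˢ s, (if q.1 = q.2 then h q.1 * h q.2 else 0) = ∑ k ∈ s, h k ^ 2 := by
      rw [Finset.sum_product]
      refine Finset.sum_congr rfl fun k hk => ?_
      simp only
      rw [Finset.sum_ite_eq, if_pos hk, sq]
    have h8 : ∀ i, ∑ q ∈ s ×ˢ s, (h q.1 * x i q.1) * (h q.2 * x i q.2)
        = (∑ k ∈ s, h k * x i k) ^ 2 := by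
      intro i
      rw [sq, Finset.sum_mul_sum, Finset.sum_product]
    simp only [h7, h8]
    ring
  have h5 := abs_le_of_sq_le_sq (by rw [mul_pow]; exact h3 :
    (∑ q ∈ s ×ˢ s, h q.1 * h q.2 * E q) ^ 2 ≤ (Q * δ) ^ 2) (mul_nonneg hQ0 hδ)
  rw [h4]
  nlinarith [(abs_le.1 h5).1]

/-- The vector analogue of `gram_form_le`. One bound on the data controls the noise term for all h
at once, which is needed because the error of the estimator depends on the noise. -/
theorem noise_form_le {v : ℕ → ℝ} (hv : ∀ k, 0 < v k) {n : ℕ} {x : Fin n → ℕ → ℝ}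
    {e : Fin n → ℝ} {δ : ℝ} (hx : noiseError v x e ≤ ENNReal.ofReal (δ ^ 2))
    (h : ℕ → ℝ) (s : Finset ℕ) :
    (1 / (n : ℝ) * ∑ i, e i * ∑ k ∈ s, h k * x i k) ^ 2 ≤ δ ^ 2 * ∑ k ∈ s, h k ^ 2 / v k := by
  set E : ℕ → ℝ := fun k => 1 / (n : ℝ) * ∑ i, e i * x i k with hE
  have h1 : ∑ k ∈ s, v k * E k ^ 2 ≤ δ ^ 2 := by
    have h2 : ENNReal.ofReal (∑ k ∈ s, v k * E k ^ 2) ≤ ENNReal.ofReal (δ ^ 2) := by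
      rw [ENNReal.ofReal_sum_of_nonneg fun q _ => mul_nonneg (hv _).le (sq_nonneg _)]
      refine le_trans (le_trans (le_of_eq ?_) (ENNReal.sum_le_tsum s)) hx
      exact Finset.sum_congr rfl fun q _ => ENNReal.ofReal_mul (hv _).le
    exact (ENNReal.ofReal_le_ofReal_iff (sq_nonneg _)).1 h2
  have h4 := Finset.sum_mul_sq_le_sq_mul_sq s (fun k => h k / √(v k)) (fun k => √(v k) * E k)
  have h5 : ∀ k, h k / √(v k) * (√(v k) * E k) = h k * E k := by
    intro k
    have := (Real.sqrt_pos.2 (hv k)).ne'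
    field_simp
  have h6 : ∀ k, (h k / √(v k)) ^ 2 = h k ^ 2 / v k := fun k => by
    rw [div_pow, Real.sq_sqrt (hv k).le]
  have h7 : ∀ k, (√(v k) * E k) ^ 2 = v k * E k ^ 2 := fun k => by
    rw [mul_pow, Real.sq_sqrt (hv k).le]
  simp only [h5, h6, h7] at h4
  have h8 : 1 / (n : ℝ) * ∑ i, e i * ∑ k ∈ s, h k * x i k = ∑ k ∈ s, h k * E k := by
    simp only [hE, Finset.mul_sum]
    rw [Finset.sum_comm]
    exact Finset.sum_congr rfl fun k _ => Finset.sum_congr rfl fun i _ => by ring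
  have hQ0 : 0 ≤ ∑ k ∈ s, h k ^ 2 / v k :=
    Finset.sum_nonneg fun k _ => div_nonneg (sq_nonneg _) (hv k).le
  rw [h8, mul_comm]
  exact h4.trans (by gcongr)

end Averages

end FLR


namespace FLR

/-! ### The constant feature and the coordinates of the centred random function. -/

section Features

variable {T H : Type*} [MeasurableSpace T] {τ : Measure T}
  [NormedAddCommGroup H] [InnerProductSpace ℝ H] [CompleteSpace H] [RKHS ℝ H T ℝ]
  {ι : H →ₗ[ℝ] Lp ℝ 2 τ} {p : Seminorm ℝ H}

namespace Design

/-- The mean function. -/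
noncomputable def mean (D : Design ι p) : Lp ℝ 2 τ := ∫ y, y ∂D.law

/-- The constant feature, followed by the coordinates of the centered random function. -/
noncomputable def feature (D : Design ι p) : ℕ → Lp ℝ 2 τ → ℝ
  | 0, _ => 1
  | k + 1, x => ⟪x - D.mean, D.ω k⟫

variable (D : Design ι p)

theorem measurable_feature (k : ℕ) : Measurable (D.feature k) := by
  cases k with
  | zero => exact measurable_const
  | succ k =>
    refine Continuous.measurable ?_
    change Continuous fun x => ⟪x - D.mean, D.ω k⟫
    fun_prop

theorem integral_inner_mul (f g : Lp ℝ 2 τ) :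
    ∫ x, ⟪x - D.mean, f⟫ * ⟪x - D.mean, g⟫ ∂D.law = ⟪D.C f, g⟫ := by
  rw [D.cov_spec, covarianceBilin_apply D.memLp]
  refine integral_congr_ae (Eventually.of_forall fun x => ?_)
  change ⟪x - D.mean, f⟫ * ⟪x - D.mean, g⟫ = ⟪f, x - D.mean⟫ * ⟪g, x - D.mean⟫
  rw [real_inner_comm f, real_inner_comm g]

theorem memLp_inner (f : Lp ℝ 2 τ) : MemLp (fun x => ⟪x - D.mean, f⟫) 2 D.law := by
  have h1 : MemLp (fun x : Lp ℝ 2 τ => x - D.mean) 2 D.law := D.memLp.sub (memLp_const _)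
  exact (h1.inner_const (𝕜 := ℝ) f)

theorem integral_inner (f : Lp ℝ 2 τ) : ∫ x, ⟪x - D.mean, f⟫ ∂D.law = 0 := by
  have hi : Integrable (fun x : Lp ℝ 2 τ => x) D.law := D.memLp.integrable one_le_two
  have h1 : Integrable (fun x : Lp ℝ 2 τ => x - D.mean) D.law := hi.sub (integrable_const _)
  have h2 : ∫ x, ⟪x - D.mean, f⟫ ∂D.law = ⟪f, ∫ x, (x - D.mean) ∂D.law⟫ := by
    rw [← _root_.integral_inner h1]
    simp only [real_inner_comm]
  rw [h2, integral_sub hi (integrable_const _)]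
  simp [mean]

/-- For g in the kernel of C the variable ⟨X - EX, g⟩ has variance zero. A countable dense subset of
the kernel and continuity give one exceptional set for all g. This is what allows ⟨X - EX, b⟩ to be
expanded in the ω_k, which see b only modulo the kernel. -/
theorem ae_orthogonal [SecondCountableTopology (Lp ℝ 2 τ)] :
    ∀ᵐ x ∂D.law, ∀ g, D.C g = 0 → ⟪x - D.mean, g⟫ = 0 := by
  let N : Set (Lp ℝ 2 τ) := {g | D.C g = 0}
  obtain ⟨u, hu⟩ : ∃ u : ℕ → N, DenseRange u :=
    have : Nonempty N := ⟨⟨0, map_zero _⟩⟩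
    TopologicalSpace.exists_dense_seq N
  have h1 : ∀ᵐ x ∂D.law, ∀ n, ⟪x - D.mean, (u n : Lp ℝ 2 τ)⟫ = 0 := by
    refine ae_all_iff.2 fun n => ?_
    have h2 := D.integral_inner_mul (u n) (u n)
    have h3 : D.C (u n) = 0 := (u n).2
    rw [h3, inner_zero_left] at h2
    simp only [← sq] at h2
    have h4 := (integral_eq_zero_iff_of_nonneg (fun x => sq_nonneg _)
      (D.memLp_inner (u n)).integrable_sq).1 h2
    filter_upwards [h4] with x hx
    exact pow_eq_zero_iff two_ne_zero |>.1 hx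
  filter_upwards [h1] with x hx g hg
  have hc : Continuous fun g : N => ⟪x - D.mean, (g : Lp ℝ 2 τ)⟫ := by fun_prop
  have h5 : (fun g : N => ⟪x - D.mean, (g : Lp ℝ 2 τ)⟫) = fun _ => 0 :=
    hu.equalizer hc continuous_const (funext hx)
  exact congrFun h5 ⟨g, hg⟩

theorem integral_feature_mul (hν : ∀ k, 0 < D.ν k) (j k : ℕ) :
    ∫ x, D.feature j x * D.feature k x ∂D.law = if j = k then 1 else 0 := by
  cases j with
  | zero =>
    cases k with
    | zero => simp [feature]
    | succ k => simp [feature, D.integral_inner]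
  | succ j =>
    cases k with
    | zero => simp [feature, D.integral_inner]
    | succ k =>
      simp only [feature, D.integral_inner_mul, D.inner_omega hν, Nat.add_right_cancel_iff]

theorem memLp_feature (k : ℕ) : MemLp (D.feature k) 2 D.law := by
  cases k with
  | zero => exact memLp_const _
  | succ k => exact D.memLp_inner _

variable {D}

theorem InClassWith.integrable_feature {ρ : ℕ → ℝ} {s M A : ℝ} {k₀ : ℕ}
    (hD : D.InClassWith ρ s M A k₀) (k : ℕ) :
    Integrable (fun x => D.feature k x ^ 4) D.law := by
  cases k with
  | zero => simp [feature]
  | succ k =>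
    refine (hD.fourth_integrable (D.ω k)).congr (Eventually.of_forall fun x => ?_)
    change ⟪D.ω k, x - D.mean⟫ ^ 4 = ⟪x - D.mean, D.ω k⟫ ^ 4
    rw [real_inner_comm]

/-- The coordinates have variance one, so the kurtosis condition bounds their fourth moments by M;
the constant feature needs 1 ≤ M. -/
theorem InClassWith.integral_feature {ρ : ℕ → ℝ} {s M A : ℝ} {k₀ : ℕ}
    (hD : D.InClassWith ρ s M A k₀) (hM : 1 ≤ M) (hν : ∀ k, 0 < D.ν k) (k : ℕ) :
    ∫ x, D.feature k x ^ 4 ∂D.law ≤ M := by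
  cases k with
  | zero => simpa [feature] using hM
  | succ k =>
    have h1 := hD.fourth_moment (D.ω k)
    have h2 : ∫ x, ⟪D.ω k, x - ∫ y, y ∂D.law⟫ ^ 2 ∂D.law = 1 := by
      have := D.integral_inner_mul (D.ω k) (D.ω k)
      rw [D.inner_omega hν, if_pos rfl] at this
      rw [← this]
      refine integral_congr_ae (Eventually.of_forall fun x => ?_)
      simp only
      rw [sq, real_inner_comm]
      rfl
    rw [h2, one_pow, mul_one] at h1
    refine le_trans (le_of_eq ?_) h1
    refine integral_congr_ae (Eventually.of_forall fun x => ?_)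
    change ⟪x - D.mean, D.ω k⟫ ^ 4 = ⟪D.ω k, x - D.mean⟫ ^ 4
    rw [real_inner_comm]

theorem InClassWith.lintegral_gramError {ρ : ℕ → ℝ} {s M A : ℝ} {k₀ : ℕ}
    (hD : D.InClassWith ρ s M A k₀) (hM : 1 ≤ M) (hν : ∀ k, 0 < D.ν k) (noise : Measure ℝ)
    [IsProbabilityMeasure noise] {v : ℕ → ℝ} (hv : ∀ k, 0 ≤ v k) (n : ℕ) :
    ∫⁻ z : Fin n → Lp ℝ 2 τ × ℝ, gramError v (fun i k => D.feature k (z i).1)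
      ∂Measure.pi (fun _ => D.law.prod noise)
      ≤ ENNReal.ofReal (M / n) * (∑' k, ENNReal.ofReal (v k)) ^ 2 := by
  refine FLR.lintegral_gramError (D.law.prod noise) (g := fun k z => D.feature k z.1)
    (fun k => (D.measurable_feature k).comp measurable_fst)
    (fun k => (hD.integrable_feature k).comp_fst noise) (fun k => ?_) (fun j k => ?_) hv n
  · rw [integral_fun_fst (fun x => D.feature k x ^ 4)]
    simpa using hD.integral_feature hM hν k
  · rw [integral_fun_fst (fun x => D.feature j x * D.feature k x)]
    simpa using D.integral_feature_mul hν j k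

theorem lintegral_noiseError (hν : ∀ k, 0 < D.ν k) {M₂ : ℝ} {noise : Measure ℝ}
    (hnoise : IsNoise M₂ noise) (v : ℕ → ℝ) (n : ℕ) :
    ∫⁻ z : Fin n → Lp ℝ 2 τ × ℝ, noiseError v (fun i k => D.feature k (z i).1)
      (fun i => (z i).2) ∂Measure.pi (fun _ => D.law.prod noise)
      ≤ ENNReal.ofReal (M₂ / n) * ∑' k, ENNReal.ofReal (v k) := by
  have := hnoise.isProb
  have hsq : Integrable (fun e : ℝ => e ^ 2) noise := hnoise.memLp.integrable_sq
  have hprod : ∀ k, Integrable (fun z : Lp ℝ 2 τ × ℝ => (z.2 * D.feature k z.1) ^ 2)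
      (D.law.prod noise) := by
    intro k
    refine ((D.memLp_feature k).integrable_sq.mul_prod hsq).congr
      (Eventually.of_forall fun z => ?_)
    simp only
    ring
  have hmeas : ∀ k, Measurable fun z : Lp ℝ 2 τ × ℝ => z.2 * D.feature k z.1 := fun k =>
    measurable_snd.mul ((D.measurable_feature k).comp measurable_fst)
  refine FLR.lintegral_noiseError (D.law.prod noise) (g := fun k z => D.feature k z.1)
    (e := fun z => z.2) (fun k => (D.measurable_feature k).comp measurable_fst) measurable_snd
    (fun k => (memLp_two_iff_integrable_sq (hmeas k).aestronglyMeasurable).2 (hprod k))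
    (fun k => ?_) (fun k => ?_) v n
  · have h1 := integral_prod_mul (μ := D.law) (ν := noise) (D.feature k) (fun e : ℝ => e)
    rw [hnoise.centered, mul_zero] at h1
    rw [← h1]
    exact integral_congr_ae (Eventually.of_forall fun z => mul_comm _ _)
  · have h1 := integral_prod_mul (μ := D.law) (ν := noise) (fun x => D.feature k x ^ 2)
      (fun e : ℝ => e ^ 2)
    have h2 : ∫ x, D.feature k x ^ 2 ∂D.law = 1 := by
      have := D.integral_feature_mul hν k k
      simpa [sq] using this
    have h3 : ∫ e, e ^ 2 ∂noise ≤ M₂ := by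
      have := hnoise.variance_le
      rw [variance_of_integral_eq_zero aemeasurable_id (by simpa using hnoise.centered)] at this
      simpa using this
    rw [h2, one_mul] at h1
    have h4 : ∫ z : Lp ℝ 2 τ × ℝ, (z.2 * D.feature k z.1) ^ 2 ∂(D.law.prod noise)
        = ∫ e, e ^ 2 ∂noise := by
      rw [← h1]
      refine integral_congr_ae (Eventually.of_forall fun z => ?_)
      simp only
      ring
    rw [h4]
    exact h3

end Design

end Features

/-! ### The deterministic error bound for the regularized estimator. -/

section Deterministic

variable {T H : Type*} [MeasurableSpace T] {τ : Measure T}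
  [NormedAddCommGroup H] [InnerProductSpace ℝ H] [CompleteSpace H] [RKHS ℝ H T ℝ]
  {ι : H →ₗ[ℝ] Lp ℝ 2 τ} {p : Seminorm ℝ H} {H₀ : Submodule ℝ H} [FiniteDimensional ℝ H₀]

/-- The weights of the features: `1` for the constant, `(1 + lam γ_k⁻¹)⁻¹` for the coordinates. -/
noncomputable def Design.weight (D : Design ι p) (lam : ℝ) : ℕ → ℝ
  | 0 => 1
  | k + 1 => (1 + lam * ((D.ν k)⁻¹ - 1))⁻¹

theorem Design.weight_pos {D : Design ι p} (hν : ∀ k, 0 < D.ν k) (hν1 : ∀ k, D.ν k ≤ 1)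
    {lam : ℝ} (hlam : 0 < lam) (k : ℕ) : 0 < D.weight lam k := by
  cases k with
  | zero => exact one_pos
  | succ k =>
    have h1 : 0 ≤ (D.ν k)⁻¹ - 1 := sub_nonneg.2 ((one_le_inv₀ (hν k)).2 (hν1 k))
    have := mul_nonneg hlam.le h1
    change 0 < (1 + lam * ((D.ν k)⁻¹ - 1))⁻¹
    positivity

/-- The error bound for the regularized estimator, for given data. -/
theorem regularized_error {D : Design ι p} {w : ℕ → H} (hw : D.IsBasis w)
    (h : IsPenalty ι p H₀) (hν : ∀ k, 0 < D.ν k) {lam : ℝ} (hlam : 0 < lam) {n : ℕ}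
    (hn : 0 < n) (z : Fin n → Lp ℝ 2 τ × ℝ) {α₀ : ℝ} {β₀ β : H}
    (horth : ∀ i, ∀ g, D.C g = 0 → ⟪(z i).1 - D.mean, g⟫ = 0)
    (hβ : IsRegularized ι p lam (fun i => ((z i).1, α₀ + ⟪(z i).1, ι β₀⟫ + (z i).2)) β)
    (hgram : gramError (D.weight lam) (fun i k => D.feature k (z i).1)
      ≤ ENNReal.ofReal ((1 / 4) ^ 2)) {δ : ℝ}
    (hnoise : noiseError (D.weight lam) (fun i k => D.feature k (z i).1) (fun i => (z i).2)
      ≤ ENNReal.ofReal (δ ^ 2)) (K : ℕ) :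
    ∑ k ∈ Finset.range K, (1 + lam * ((D.ν k)⁻¹ - 1)) * D.coef (ι β - ι β₀) k ^ 2
      ≤ 64 * δ ^ 2 + 16 * (lam * p β₀ ^ 2) := by
  have hν1 := hw.ν_le_one h hν
  have hv := Design.weight_pos hν hν1 hlam
  obtain ⟨α, hα⟩ := hβ
  have hQ := hα α₀ β₀
  set b : H := β - β₀ with hb
  -- The intercept error after centring. It serves as the coefficient of the constant feature, and
  -- u_i below is the difference of the fitted and the true regression function at the i-th
  -- observation. It is unrelated to the ratios γ_k.
  set γ : ℝ := α + ⟪D.mean, ι b⟫ - α₀ with hγ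
  set x : Fin n → Lp ℝ 2 τ := fun i => (z i).1 - D.mean with hx
  set e : Fin n → ℝ := fun i => (z i).2 with he
  set u : Fin n → ℝ := fun i => γ + ⟪x i, ι b⟫ with hu
  have hn' : (0 : ℝ) < n := Nat.cast_pos.2 hn
  -- the basic inequality
  have hbasic : 1 / (n : ℝ) * ∑ i, u i ^ 2 + lam * p b ^ 2 / 2
      ≤ 2 * (1 / (n : ℝ) * ∑ i, e i * u i) + 2 * (lam * p β₀ ^ 2) := by
    have h1 : ∀ i, α₀ + ⟪(z i).1, ι β₀⟫ + (z i).2 - (α + ⟪(z i).1, ι β⟫) = e i - u i := by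
      intro i
      simp only [hu, hγ, hx, he, hb, map_sub, inner_sub_left, inner_sub_right]
      ring
    have h2 : ∀ i, α₀ + ⟪(z i).1, ι β₀⟫ + (z i).2 - (α₀ + ⟪(z i).1, ι β₀⟫) = e i :=
      fun i => by simp [he]
    simp only [h1, h2] at hQ
    have h3 : ∑ i, (e i - u i) ^ 2 = ∑ i, e i ^ 2 - 2 * ∑ i, e i * u i + ∑ i, u i ^ 2 := by
      rw [Finset.mul_sum, ← Finset.sum_sub_distrib, ← Finset.sum_add_distrib]
      exact Finset.sum_congr rfl fun i _ => by ring
    rw [h3] at hQ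
    -- The penalty of β is traded for that of b = β - β₀, at the cost of a factor 1/2 and a second
    -- copy of the penalty of β₀.
    have h4 : p b ≤ p β + p β₀ := by rw [hb]; exact map_sub_le_add p _ _
    have h5 : p b ^ 2 ≤ 2 * p β ^ 2 + 2 * p β₀ ^ 2 := by
      have := apply_nonneg p b
      nlinarith [sq_nonneg (p β - p β₀)]
    have h6 : lam * p b ^ 2 ≤ lam * (2 * p β ^ 2 + 2 * p β₀ ^ 2) := by gcongr
    have h7 : 1 / (n : ℝ) * (∑ i, e i ^ 2 - 2 * ∑ i, e i * u i + ∑ i, u i ^ 2)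
        = 1 / (n : ℝ) * ∑ i, e i ^ 2 - 2 * (1 / (n : ℝ) * ∑ i, e i * u i)
          + 1 / (n : ℝ) * ∑ i, u i ^ 2 := by ring
    rw [h7] at hQ
    linarith
  -- the quadratic form that controls the error
  set Q : ℝ := γ ^ 2 + ⟪D.C (ι b), ι b⟫ + lam * p b ^ 2 with hQdef
  let c : ℕ → ℝ := fun k => Nat.casesOn k γ (fun j => D.coef (ι b) j)
  have hQK : ∀ K, ∑ k ∈ Finset.range (K + 1), c k ^ 2 / D.weight lam k
      = γ ^ 2 + ∑ k ∈ Finset.range K, (1 + lam * ((D.ν k)⁻¹ - 1)) * D.coef (ι b) k ^ 2 := by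
    intro K
    rw [Finset.sum_range_succ', add_comm]
    simp only [c, Design.weight, div_one, div_inv_eq_mul, mul_comm]
    rfl
  have hQle : ∀ K, ∑ k ∈ Finset.range (K + 1), c k ^ 2 / D.weight lam k ≤ Q := by
    intro K
    rw [hQK]
    have h1 := hw.sum_le_form hν (Finset.range K) b
    have h2 := hw.sum_le_penalty h hν (Finset.range K) b
    have h3 : ∑ k ∈ Finset.range K, (1 + lam * ((D.ν k)⁻¹ - 1)) * D.coef (ι b) k ^ 2
        = ∑ k ∈ Finset.range K, D.coef (ι b) k ^ 2
          + lam * ∑ k ∈ Finset.range K, ((D.ν k)⁻¹ - 1) * D.coef (ι b) k ^ 2 := by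
      rw [Finset.mul_sum, ← Finset.sum_add_distrib]
      exact Finset.sum_congr rfl fun i _ => by ring
    rw [h3]
    have h4 : lam * ∑ k ∈ Finset.range K, ((D.ν k)⁻¹ - 1) * D.coef (ι b) k ^ 2
      ≤ lam * p b ^ 2 := by gcongr
    linarith
  have hQ0 : 0 ≤ Q := by
    have := D.C_nonneg (ι b)
    have := mul_nonneg hlam.le (sq_nonneg (p b))
    positivity
  have huK : ∀ K i, ∑ k ∈ Finset.range (K + 1), c k * D.feature k (z i).1
      = γ + ∑ k ∈ Finset.range K, D.coef (ι b) k * ⟪x i, D.ω k⟫ := by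
    intro K i
    rw [Finset.sum_range_succ', add_comm]
    simp only [c, Design.feature, mul_one]
    rfl
  -- The bounds for finite sums hold uniformly in K. Orthogonality of the centred data to the kernel
  -- of C lets them pass to the full error.
  have hlim : ∀ i, Tendsto (fun K => ∑ k ∈ Finset.range (K + 1), c k * D.feature k (z i).1)
      atTop (𝓝 (u i)) := by
    intro i
    simp only [huK]
    exact (hw.tendsto_inner h hν b (horth i)).const_add γ
  have hlower : γ ^ 2 + ⟪D.C (ι b), ι b⟫ - 1 / 4 * Q ≤ 1 / (n : ℝ) * ∑ i, u i ^ 2 := by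
    have h1 : Tendsto (fun K => γ ^ 2 + ∑ k ∈ Finset.range K, D.coef (ι b) k ^ 2 - 1 / 4 * Q)
        atTop (𝓝 (γ ^ 2 + ⟪D.C (ι b), ι b⟫ - 1 / 4 * Q)) :=
      ((hw.tendsto_form h hν b).const_add _).sub_const _
    have h2 : Tendsto (fun K => 1 / (n : ℝ) *
        ∑ i, (∑ k ∈ Finset.range (K + 1), c k * D.feature k (z i).1) ^ 2)
        atTop (𝓝 (1 / (n : ℝ) * ∑ i, u i ^ 2)) :=
      (tendsto_finsetSum _ fun i _ => (hlim i).pow 2).const_mul _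
    refine le_of_tendsto_of_tendsto' h1 h2 fun K => ?_
    have h3 := gram_form_le hv hn (x := fun i k => D.feature k (z i).1) (by norm_num) hgram c
      (Finset.range (K + 1))
    have h4 := hQle K
    have h5 : ∑ k ∈ Finset.range (K + 1), c k ^ 2
        = γ ^ 2 + ∑ k ∈ Finset.range K, D.coef (ι b) k ^ 2 := by
      rw [Finset.sum_range_succ', add_comm]
      rfl
    rw [h5] at h3
    linarith
  have hupper : (1 / (n : ℝ) * ∑ i, e i * u i) ^ 2 ≤ δ ^ 2 * Q := by
    have h2 : Tendsto (fun K => (1 / (n : ℝ) *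
        ∑ i, e i * ∑ k ∈ Finset.range (K + 1), c k * D.feature k (z i).1) ^ 2)
        atTop (𝓝 ((1 / (n : ℝ) * ∑ i, e i * u i) ^ 2)) :=
      ((tendsto_finsetSum _ fun i _ => (hlim i).const_mul _).const_mul _).pow 2
    refine le_of_tendsto' h2 fun K => ?_
    refine (noise_form_le hv hnoise c (Finset.range (K + 1))).trans ?_
    have := hQle K
    gcongr
  -- Of Q at least one half appears on the left of the basic inequality, and the Gram error takes
  -- away a quarter. The noise costs 2W ≤ 2δ√Q ≤ Q/8 + 8δ². An eighth of Q remains, which gives the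
  -- factors 64 and 16.
  have hfin : Q ≤ 64 * δ ^ 2 + 16 * (lam * p β₀ ^ 2) := by
    set W := 1 / (n : ℝ) * ∑ i, e i * u i
    have h1 : Q / 4 ≤ 2 * W + 2 * (lam * p β₀ ^ 2) := by
      have := mul_nonneg hlam.le (sq_nonneg (p b))
      have := D.C_nonneg (ι b)
      have := sq_nonneg γ
      rw [hQdef] at hlower ⊢
      linarith
    have h2 : 2 * W ≤ Q / 8 + 8 * δ ^ 2 := by
      refine abs_le_of_sq_le_sq' (a := 2 * W) (b := Q / 8 + 8 * δ ^ 2) ?_ (by positivity) |>.2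
      nlinarith [sq_nonneg (Q / 8 - 8 * δ ^ 2)]
    linarith
  have h1 := hQle K
  rw [hQK] at h1
  rw [← map_sub, ← hb]
  linarith [sq_nonneg γ]

end Deterministic

end FLR


namespace FLR

/-! ### The upper bound. -/

section Upper

variable {T H : Type*} [MeasurableSpace T] {τ : Measure T} [SecondCountableTopology (Lp ℝ 2 τ)]
  [NormedAddCommGroup H] [InnerProductSpace ℝ H] [CompleteSpace H] [RKHS ℝ H T ℝ]
  {ι : H →ₗ[ℝ] Lp ℝ 2 τ} {p : Seminorm ℝ H} {H₀ : Submodule ℝ H} [FiniteDimensional ℝ H₀]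

theorem Design.ae_orthogonal_pi (D : Design ι p) (noise : Measure ℝ) [IsProbabilityMeasure noise]
    (n : ℕ) :
    ∀ᵐ z : Fin n → Lp ℝ 2 τ × ℝ ∂Measure.pi (fun _ => D.law.prod noise),
      ∀ i, ∀ g, D.C g = 0 → ⟪(z i).1 - D.mean, g⟫ = 0 := by
  refine ae_all_iff.2 fun i => ?_
  have h1 : ∀ᵐ y ∂D.law.prod noise, ∀ g, D.C g = 0 → ⟪y.1 - D.mean, g⟫ = 0 :=
    Measure.quasiMeasurePreserving_fst.ae D.ae_orthogonal
  exact (measurePreserving_eval (fun _ : Fin n => D.law.prod noise) i).quasiMeasurePreserving.ae h1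

/-- With y = λ g one has g^a = λ^(-a) y^a, and y^a ≤ 1 + y because 0 ≤ a ≤ 1. This passes from the
norm controlled by the penalized criterion to the loss norm. -/
theorem one_add_rpow_le {a lam g : ℝ} (ha0 : 0 ≤ a) (ha1 : a ≤ 1) (hlam : 0 < lam) (hg : 0 ≤ g) :
    1 + g ^ a ≤ (1 + lam ^ (-a)) * (1 + lam * g) := by
  have h0 := mul_nonneg hlam.le hg
  have h1 : (lam * g) ^ a ≤ 1 + lam * g := by
    rcases le_total (lam * g) 1 with h | h
    · exact (Real.rpow_le_one h0 h ha0).trans (by linarith)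
    · calc (lam * g) ^ a ≤ (lam * g) ^ (1 : ℝ) := Real.rpow_le_rpow_of_exponent_le h ha1
        _ ≤ _ := by rw [Real.rpow_one]; linarith
  have hl : 0 < lam ^ (-a) := Real.rpow_pos_of_pos hlam _
  have h2 : g ^ a = lam ^ (-a) * (lam * g) ^ a := by
    rw [Real.mul_rpow hlam.le hg, ← mul_assoc, ← Real.rpow_add hlam]
    simp
  rw [h2]
  nlinarith

theorem normSq_le {D : Design ι p} (hν : ∀ k, 0 < D.ν k) (hν1 : ∀ k, D.ν k ≤ 1) {a lam Q : ℝ}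
    (ha0 : 0 ≤ a) (ha1 : a ≤ 1) (hlam : 0 < lam) {f : Lp ℝ 2 τ}
    (hQ : ∀ K, ∑ k ∈ Finset.range K, (1 + lam * ((D.ν k)⁻¹ - 1)) * D.coef f k ^ 2 ≤ Q) :
    D.normSq a f ≤ ENNReal.ofReal ((1 + lam ^ (-a)) * Q) := by
  have hg : ∀ k, 0 ≤ (D.ν k)⁻¹ - 1 := fun k => sub_nonneg.2 ((one_le_inv₀ (hν k)).2 (hν1 k))
  refine ENNReal.tsum_le_of_sum_range_le fun K => ?_
  rw [← ENNReal.ofReal_sum_of_nonneg]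
  · refine ENNReal.ofReal_le_ofReal ?_
    have hl : 0 < lam ^ (-a) := Real.rpow_pos_of_pos hlam _
    refine le_trans ?_ (mul_le_mul_of_nonneg_left (hQ K) (by positivity))
    rw [Finset.mul_sum]
    refine Finset.sum_le_sum fun k _ => ?_
    rw [← mul_assoc]
    exact mul_le_mul_of_nonneg_right (one_add_rpow_le ha0 ha1 hlam (hg k)) (sq_nonneg _)
  · intro k _
    have := Real.rpow_nonneg (hg k) a
    positivity

/-- A bound for the error probability of the regularized estimator for a fixed sample size. -/
theorem errProb_regularized_le (h : IsPenalty ι p H₀) {ρ : ℕ → ℝ} {r s M M₂ a α₀ A B : ℝ}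
    {k₀ : ℕ} (hM : 1 ≤ M) (ha0 : 0 ≤ a) (ha1 : a ≤ 1)
    (hρ : AsympEquiv ρ fun k => ((k : ℝ) + 1) ^ (-(2 * r))) {D : Design ι p}
    (hD : D.InClassWith ρ s M A k₀) {noise : Measure ℝ} (hnoise : IsNoise M₂ noise)
    {β₀ : H} (hβ₀ : p β₀ ^ 2 ≤ B) {n : ℕ} (hn : 0 < n) {lam : ℝ} (hlam : 0 < lam)
    {βhat : (Fin n → Lp ℝ 2 τ × ℝ) → H}
    (hβ : ∀ data, IsRegularized ι p lam data (βhat data)) {N : ℝ} (hN0 : 0 ≤ N)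
    (hN : ∑' k, ENNReal.ofReal ((1 + lam * ((D.ν k)⁻¹ - 1))⁻¹) ≤ ENNReal.ofReal N)
    {t u : ℝ} (ht : 0 < t) (hu : (1 + lam ^ (-a)) * (64 * t + 16 * (lam * B)) ≤ u) :
    errProb D noise a α₀ β₀ (fun data => ι (βhat data)) u
      ≤ ENNReal.ofReal (16 * M * ((1 + N) ^ 2 / n)) + ENNReal.ofReal (M₂ * ((1 + N) / n) / t) := by
  have := hnoise.isProb
  have hν := D.ν_pos hρ hD
  obtain ⟨w, hw⟩ := D.exists_isBasis h
  have hν1 := hw.ν_le_one h hν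
  have hv := Design.weight_pos hν hν1 hlam
  have hM₂ : 0 ≤ M₂ := (variance_nonneg _ _).trans hnoise.variance_le
  have hsum : ∑' k, ENNReal.ofReal (D.weight lam k) ≤ ENNReal.ofReal (1 + N) := by
    rw [tsum_eq_zero_add' ENNReal.summable, ENNReal.ofReal_add zero_le_one hN0]
    exact add_le_add le_rfl hN
  set P := Measure.pi (fun _ : Fin n => D.law.prod noise) with hP
  set G : (Fin n → Lp ℝ 2 τ × ℝ) → ℝ≥0∞ := fun z =>
    gramError (D.weight lam) (fun i k => D.feature k (z i).1) with hG
  set W : (Fin n → Lp ℝ 2 τ × ℝ) → ℝ≥0∞ := fun z =>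
    noiseError (D.weight lam) (fun i k => D.feature k (z i).1) (fun i => (z i).2) with hW
  have hfm : ∀ k, Measurable fun z : Lp ℝ 2 τ × ℝ => D.feature k z.1 := fun k =>
    (D.measurable_feature k).comp measurable_fst
  have hGm : Measurable G := measurable_gramError hfm _ n
  have hWm : Measurable W := measurable_noiseError hfm measurable_snd _ n
  -- Markov's inequality at the level (1/4)² under which the deterministic bound applies; hence the
  -- factor 16.
  have hP1 : P {z | ENNReal.ofReal ((1 / 4) ^ 2) ≤ G z}
      ≤ ENNReal.ofReal (16 * M * ((1 + N) ^ 2 / n)) := by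
    refine (meas_ge_le_lintegral_div hGm.aemeasurable (by norm_num) ENNReal.ofReal_ne_top).trans ?_
    refine ENNReal.div_le_of_le_mul ?_
    refine (hD.lintegral_gramError hM hν noise (fun k => (hv k).le) n).trans ?_
    calc ENNReal.ofReal (M / n) * (∑' k, ENNReal.ofReal (D.weight lam k)) ^ 2
        ≤ ENNReal.ofReal (M / n) * ENNReal.ofReal (1 + N) ^ 2 := by gcongr
      _ = ENNReal.ofReal (16 * M * ((1 + N) ^ 2 / n)) * ENNReal.ofReal ((1 / 4) ^ 2) := by
        rw [← ENNReal.ofReal_pow (by positivity), ← ENNReal.ofReal_mul (by positivity),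
          ← ENNReal.ofReal_mul (by positivity)]
        congr 1
        ring
  have hP2 : P {z | ENNReal.ofReal t ≤ W z} ≤ ENNReal.ofReal (M₂ * ((1 + N) / n) / t) := by
    refine (meas_ge_le_lintegral_div hWm.aemeasurable (by simpa using ht)
      ENNReal.ofReal_ne_top).trans ?_
    refine ENNReal.div_le_of_le_mul ?_
    refine (Design.lintegral_noiseError hν hnoise _ n).trans ?_
    calc ENNReal.ofReal (M₂ / n) * ∑' k, ENNReal.ofReal (D.weight lam k)
        ≤ ENNReal.ofReal (M₂ / n) * ENNReal.ofReal (1 + N) := by gcongr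
      _ = ENNReal.ofReal (M₂ * ((1 + N) / n) / t) * ENNReal.ofReal t := by
        rw [← ENNReal.ofReal_mul (by positivity), ← ENNReal.ofReal_mul (by positivity)]
        congr 1
        field_simp
  have hP0 : P {z | ¬ ∀ i, ∀ g, D.C g = 0 → ⟪(z i).1 - D.mean, g⟫ = 0} = 0 :=
    D.ae_orthogonal_pi noise n
  have hsub : {z : Fin n → Lp ℝ 2 τ × ℝ | ENNReal.ofReal u
      < D.normSq a (ι (βhat (fun i => ((z i).1, α₀ + ⟪(z i).1, ι β₀⟫ + (z i).2))) - ι β₀)}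
      ⊆ {z | ¬ ∀ i, ∀ g, D.C g = 0 → ⟪(z i).1 - D.mean, g⟫ = 0} ∪
        ({z | ENNReal.ofReal ((1 / 4) ^ 2) ≤ G z} ∪ {z | ENNReal.ofReal t ≤ W z}) := by
    intro z hz
    by_contra hcon
    simp only [Set.mem_union, Set.mem_ofPred_eq, not_or, not_not, not_le] at hcon hz
    obtain ⟨h1, h2, h3⟩ := hcon
    have h4 := regularized_error hw h hν hlam hn z h1
      (hβ (fun i => ((z i).1, α₀ + ⟪(z i).1, ι β₀⟫ + (z i).2))) h2.le (δ := √t)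
      (by rw [Real.sq_sqrt ht.le]; exact h3.le)
    have h5 := normSq_le hν hν1 ha0 ha1 hlam h4
    rw [Real.sq_sqrt ht.le] at h5
    refine absurd (hz.trans_le (h5.trans (ENNReal.ofReal_le_ofReal (le_trans ?_ hu)))) (lt_irrefl _)
    have hl : 0 < lam ^ (-a) := Real.rpow_pos_of_pos hlam _
    gcongr
  calc errProb D noise a α₀ β₀ (fun data => ι (βhat data)) u ≤ P _ := measure_mono hsub
    _ ≤ _ := measure_union_le _ _
    _ ≤ 0 + (P {z | ENNReal.ofReal ((1 / 4) ^ 2) ≤ G z} + P {z | ENNReal.ofReal t ≤ W z}) :=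
      add_le_add hP0.le (measure_union_le _ _)
    _ ≤ _ := by
      rw [zero_add]
      exact add_le_add hP1 hP2

/-- The regularized estimator attains the rate, uniformly over the class. -/
theorem tendsto_limsup_worstProb (h : IsPenalty ι p H₀) {ρ : ℕ → ℝ} {r s M M₂ a α₀ A B : ℝ}
    {k₀ : ℕ} (hr : 1 / 2 < r) (hs : 1 / 2 < s) (hM : 1 ≤ M) (hM₂ : 0 < M₂) (hA : 0 < A)
    (hB : 0 < B) (ha0 : 0 ≤ a) (ha1 : a ≤ 1)
    (hρ : AsympEquiv ρ fun k => ((k : ℝ) + 1) ^ (-(2 * r)))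
    {lam : ℕ → ℝ} (hlam : ∀ n, 0 < lam n)
    (hlam' : AsympEquiv lam fun n => (n : ℝ) ^ (-(2 * (r + s) / (2 * (r + s) + 1))))
    {βhat : ∀ n : ℕ, (Fin n → Lp ℝ 2 τ × ℝ) → H}
    (hβ : ∀ n data, IsRegularized ι p (lam n) data (βhat n data)) :
    Tendsto (fun c : ℝ => limsup (fun n : ℕ =>
      worstProb {D : Design ι p | D.InClassWith ρ s M A k₀} M₂ B a α₀
        (fun data : Fin n → Lp ℝ 2 τ × ℝ => ι (βhat n data)) (c * rate r s a n)) atTop)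
      atTop (𝓝 0) := by
  obtain ⟨A', k₀', hρ'⟩ := id hρ
  obtain ⟨A₂, n₀, hA₂, hlamA⟩ := hlam'
  have hA' := hρ'.1
  set q := r + s with hq
  have hq1 : 1 < q := by linarith
  set k₁ := max k₀ k₀'
  set c₁ := (A ^ 2 * A')⁻¹ with hc₁
  have hc₁0 : 0 < c₁ := by positivity
  set CN : ℝ := 1 + k₁ + 4 * (c₁ / A₂) ^ (-(1 / (2 * q))) with hCN
  have hCN0 : 0 < CN := by positivity
  set κ₀ : ℝ := 1 + A₂ ^ a with hκ₀
  have hκ₀0 : 0 < κ₀ := by positivity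
  -- The solution of κ₀ (64 S + 16 A₂ B) = c. The noise error is allowed to be S(c) L with L =
  -- n^(-2q/(2q+1)), and the resulting loss is then at most c times the rate.
  let S : ℝ → ℝ := fun c => (c / κ₀ - 16 * (A₂ * B)) / 64
  have hS : Tendsto S atTop atTop :=
    (tendsto_atTop_add_const_right _ _ (tendsto_id.atTop_div_const hκ₀0)).atTop_div_const
      (by norm_num)
  have hmain : ∀ c, 0 < S c → ∀ n, max n₀ 1 ≤ n →
      worstProb {D : Design ι p | D.InClassWith ρ s M A k₀} M₂ B a α₀
        (fun data : Fin n → Lp ℝ 2 τ × ℝ => ι (βhat n data)) (c * rate r s a n)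
      ≤ ENNReal.ofReal (16 * M * CN ^ 2 * (n : ℝ) ^ (-((2 * q - 1) / (2 * q + 1))))
        + ENNReal.ofReal (M₂ * CN / S c) := by
    intro c hc n hn
    obtain ⟨hl1, hl2⟩ := hlamA n (le_trans (le_max_left _ _) hn)
    have hn1 : 1 ≤ n := le_trans (le_max_right _ _) hn
    have hn0 : (0 : ℝ) < n := by exact_mod_cast hn1
    have hn1' : (1 : ℝ) ≤ n := by exact_mod_cast hn1
    set L := (n : ℝ) ^ (-(2 * q / (2 * q + 1))) with hL
    have hL0 : 0 < L := Real.rpow_pos_of_pos hn0 _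
    have hL1 : L ≤ 1 := Real.rpow_le_one_of_one_le_of_nonpos hn1' (by
      have : 0 < 2 * q / (2 * q + 1) := by positivity
      linarith)
    set m := (n : ℝ) ^ (1 / (2 * q + 1)) with hm
    have hm1 : 1 ≤ m := Real.one_le_rpow hn1' (by positivity)
    have hml : 0 < lam n := hlam n
    have hmL : m / n = L := by
      rw [hm, hL, ← Real.rpow_sub_one hn0.ne']
      congr 1
      field_simp
      ring
    have hm2 : m ^ 2 / n = (n : ℝ) ^ (-((2 * q - 1) / (2 * q + 1))) := by
      rw [hm, ← Real.rpow_natCast, ← Real.rpow_mul hn0.le, ← Real.rpow_sub_one hn0.ne']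
      congr 1
      field_simp
      push_cast
      ring
    have hrate : rate r s a n = L ^ (1 - a) := by
      rw [rate, hL, ← Real.rpow_mul hn0.le]
      congr 1
      rw [← hq]
      field_simp
    -- the effective dimension
    set N := k₁ + 4 * (c₁ * lam n) ^ (-(1 / (2 * q))) with hN
    have hN0 : 0 ≤ N := by positivity
    have hNm : 1 + N ≤ CN * m := by
      have h1 : c₁ / A₂ * L ≤ c₁ * lam n := by
        rw [div_mul_eq_mul_div, div_le_iff₀ hA₂]
        calc c₁ * L ≤ c₁ * (A₂ * lam n) := by gcongr
          _ = _ := by ring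
      have h2 : (c₁ * lam n) ^ (-(1 / (2 * q))) ≤ (c₁ / A₂ * L) ^ (-(1 / (2 * q))) :=
        Real.rpow_le_rpow_of_nonpos (by positivity) h1 (by
          have : 0 < 1 / (2 * q) := by positivity
          linarith)
      have h3 : L ^ (-(1 / (2 * q))) = m := by
        rw [hL, hm, ← Real.rpow_mul hn0.le]
        congr 1
        field_simp
      rw [Real.mul_rpow (by positivity) hL0.le, h3] at h2
      have h4 : 1 + (k₁ : ℝ) ≤ (1 + k₁) * m := le_mul_of_one_le_right (by positivity) hm1
      rw [hN, hCN]
      nlinarith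
    refine iSup₂_le fun D hD => iSup₂_le fun noise hnoise => iSup₂_le fun β₀ hβ₀ => ?_
    have hν := D.ν_pos hρ hD
    obtain ⟨w, hw⟩ := D.exists_isBasis h
    have hν1 := hw.ν_le_one h hν
    have hNle := tsum_effective_le (q := q) hq1.le hc₁0 (k₁ := k₁) (g := fun k => (D.ν k)⁻¹ - 1)
      (fun k => sub_nonneg.2 ((one_le_inv₀ (hν k)).2 (hν1 k)))
      (fun k hk => (D.growth hρ' hD hk).1) hml
    have hla : lam n ^ (-a) ≤ A₂ ^ a * L ^ (-a) := by
      have h1 : L / A₂ ≤ lam n := by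
        rw [div_le_iff₀ hA₂, mul_comm]; exact hl2
      calc lam n ^ (-a) ≤ (L / A₂) ^ (-a) :=
            Real.rpow_le_rpow_of_nonpos (by positivity) h1 (by linarith)
        _ = A₂ ^ a * L ^ (-a) := by
            rw [Real.div_rpow hL0.le hA₂.le, Real.rpow_neg hA₂.le, div_inv_eq_mul, mul_comm]
    have hLa : 1 ≤ L ^ (-a) :=
      Real.one_le_rpow_of_pos_of_le_one_of_nonpos hL0 hL1 (by linarith)
    have hu : (1 + lam n ^ (-a)) * (64 * (S c * L) + 16 * (lam n * B)) ≤ c * rate r s a n := by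
      rw [hrate]
      have h1 : L ^ (1 - a) = L ^ (-a) * L := by
        rw [sub_eq_neg_add, Real.rpow_add hL0, Real.rpow_one]
      have h2 : 1 + lam n ^ (-a) ≤ κ₀ * L ^ (-a) := by rw [hκ₀]; linarith
      have h3 : 64 * (S c * L) + 16 * (lam n * B) ≤ (64 * S c + 16 * (A₂ * B)) * L := by
        have : lam n * B ≤ A₂ * L * B := by gcongr
        linarith
      have h4 : κ₀ * (64 * S c + 16 * (A₂ * B)) = c := by
        simp only [S]
        field_simp
        ring
      calc (1 + lam n ^ (-a)) * (64 * (S c * L) + 16 * (lam n * B))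
          ≤ (κ₀ * L ^ (-a)) * ((64 * S c + 16 * (A₂ * B)) * L) := by
            gcongr
        _ = κ₀ * (64 * S c + 16 * (A₂ * B)) * (L ^ (-a) * L) := by ring
        _ = _ := by rw [h4, h1]
    refine (errProb_regularized_le h hM ha0 ha1 hρ hD hnoise hβ₀ hn1 hml (hβ n) hN0 hNle
      (mul_pos hc hL0) hu).trans (add_le_add ?_ ?_)
    · refine ENNReal.ofReal_le_ofReal ?_
      rw [← hm2]
      calc 16 * M * ((1 + N) ^ 2 / n) ≤ 16 * M * ((CN * m) ^ 2 / n) := by gcongr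
        _ = _ := by ring
    · refine ENNReal.ofReal_le_ofReal ?_
      calc M₂ * ((1 + N) / n) / (S c * L) ≤ M₂ * ((CN * m) / n) / (S c * L) := by gcongr
        _ = M₂ * CN * (m / n) / (S c * L) := by ring
        _ = _ := by rw [hmL]; field_simp
  -- The Gram term vanishes as n grows because 2q > 1. The noise term is free of n and vanishes as c
  -- tends to infinity.
  have hlim : ∀ c, 0 < S c → limsup (fun n : ℕ =>
      worstProb {D : Design ι p | D.InClassWith ρ s M A k₀} M₂ B a α₀
        (fun data : Fin n → Lp ℝ 2 τ × ℝ => ι (βhat n data)) (c * rate r s a n)) atTop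
      ≤ ENNReal.ofReal (M₂ * CN / S c) := by
    intro c hc
    have h1 : Tendsto (fun n : ℕ =>
        ENNReal.ofReal (16 * M * CN ^ 2 * (n : ℝ) ^ (-((2 * q - 1) / (2 * q + 1))))
        + ENNReal.ofReal (M₂ * CN / S c)) atTop
        (𝓝 (ENNReal.ofReal (16 * M * CN ^ 2 * 0) + ENNReal.ofReal (M₂ * CN / S c))) := by
      refine Tendsto.add_const _ (ENNReal.tendsto_ofReal (Tendsto.const_mul _ ?_))
      exact (tendsto_rpow_neg_atTop (div_pos (by linarith) (by linarith))).comp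
        tendsto_natCast_atTop_atTop
    rw [mul_zero, ENNReal.ofReal_zero, zero_add] at h1
    rw [← h1.limsup_eq]
    exact limsup_le_limsup (eventually_atTop.2 ⟨_, hmain c hc⟩)
  have h0 : Tendsto (fun c => ENNReal.ofReal (M₂ * CN / S c)) atTop (𝓝 0) := by
    rw [← ENNReal.ofReal_zero]
    exact ENNReal.tendsto_ofReal (hS.const_div_atTop _)
  refine tendsto_of_tendsto_of_tendsto_of_le_of_le' tendsto_const_nhds h0
    (Eventually.of_forall fun _ => zero_le) ?_
  filter_upwards [hS.eventually_gt_atTop 0] with c hc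
  exact hlim c hc

end Upper

end FLR


namespace FLR

/-! ### Two-point comparison for Gaussian shifts. -/

section TwoPoint

/-- It suffices to compare the measures of boxes, where independence of the coordinates factorizes
the integral of the product density. -/
theorem pi_withDensity {ι Ω : Type*} [Fintype ι] [MeasurableSpace Ω] (P : Measure Ω)
    [IsProbabilityMeasure P] {f : Ω → ℝ≥0∞} (hf : Measurable f) [SigmaFinite (P.withDensity f)] :
    Measure.pi (fun _ : ι => P.withDensity f)
      = (Measure.pi fun _ : ι => P).withDensity fun z => ∏ i, f (z i) := by
  refine Measure.pi_eq fun s hs => ?_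
  rw [withDensity_apply _ (MeasurableSet.univ_pi hs)]
  have h1 : ∀ i, Measurable ((s i).indicator f) := fun i => hf.indicator (hs i)
  have h2 := lintegral_prod_eq_prod_lintegral_of_indepFun (μ := Measure.pi fun _ : ι => P)
    Finset.univ (fun i z => (s i).indicator f (z i))
    (iIndepFun_pi (μ := fun _ : ι => P) fun i => (h1 i).aemeasurable)
    fun i => (h1 i).comp (measurable_pi_apply i)
  rw [← lintegral_indicator (MeasurableSet.univ_pi hs)]
  have h3 : (Set.univ.pi s).indicator (fun z : ι → Ω => ∏ i, f (z i))
      = fun z => ∏ i, (s i).indicator f (z i) := by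
    funext z
    by_cases hz : z ∈ Set.univ.pi s
    · rw [Set.indicator_of_mem hz]
      refine Finset.prod_congr rfl fun i _ => ?_
      rw [Set.indicator_of_mem (hz i (Set.mem_univ _))]
    · rw [Set.indicator_of_notMem hz]
      simp only [Set.mem_univ_pi, not_forall] at hz
      obtain ⟨i, hi⟩ := hz
      exact (Finset.prod_eq_zero (Finset.mem_univ i) (Set.indicator_of_notMem hi f)).symm
  rw [h3, h2]
  refine Finset.prod_congr rfl fun i _ => ?_
  rw [withDensity_apply _ (hs i), ← lintegral_indicator (hs i)]
  have h4 := (measurePreserving_eval (fun _ : ι => P) i).lintegral_comp (h1 i)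
  exact h4

theorem gaussianReal_shift {v : NNReal} (hv : v ≠ 0) (c : ℝ) :
    (gaussianReal 0 v).map (· + c)
      = (gaussianReal 0 v).withDensity
        fun e => ENNReal.ofReal (Real.exp (e * c / v - c ^ 2 / (2 * v))) := by
  have hv' : (v : ℝ) ≠ 0 := by exact_mod_cast hv
  rw [gaussianReal_map_add_const, zero_add, gaussianReal_of_var_ne_zero _ hv,
    gaussianReal_of_var_ne_zero _ hv, ← withDensity_mul _ (measurable_gaussianPDF _ _)
      (by fun_prop)]
  congr 1
  funext e
  simp only [Pi.mul_apply, gaussianPDF]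
  rw [← ENNReal.ofReal_mul (gaussianPDFReal_nonneg _ _ _)]
  congr 1
  simp only [gaussianPDFReal]
  rw [mul_assoc _ (Real.exp _), ← Real.exp_add]
  congr 2
  field_simp
  ring

variable {Ω : Type*} [MeasurableSpace Ω] (μ : Measure Ω) [IsProbabilityMeasure μ]

/-- The shift depends on the covariate, but for a fixed covariate it is a constant shift of the
noise, so the one-dimensional formula applies slice by slice. -/
theorem prod_gaussian_shift {v : NNReal} (hv : v ≠ 0) {δ : Ω → ℝ} (hδ : Measurable δ) :
    (μ.prod (gaussianReal 0 v)).map (fun z => (z.1, z.2 + δ z.1))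
      = (μ.prod (gaussianReal 0 v)).withDensity
        fun z => ENNReal.ofReal (Real.exp (z.2 * δ z.1 / v - δ z.1 ^ 2 / (2 * v))) := by
  have hS : Measurable fun z : Ω × ℝ => (z.1, z.2 + δ z.1) := by fun_prop
  have hρ : Measurable fun z : Ω × ℝ =>
      ENNReal.ofReal (Real.exp (z.2 * δ z.1 / v - δ z.1 ^ 2 / (2 * v))) := by fun_prop
  refine Measure.ext fun s hs => ?_
  rw [Measure.map_apply hS hs, withDensity_apply _ hs, Measure.prod_apply (hS hs),
    ← lintegral_indicator hs, lintegral_prod _ (hρ.indicator hs).aemeasurable]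
  refine lintegral_congr fun x => ?_
  have hsx : MeasurableSet (Prod.mk x ⁻¹' s) := measurable_prodMk_left hs
  have h1 := congrArg (fun ν : Measure ℝ => ν (Prod.mk x ⁻¹' s)) (gaussianReal_shift hv (δ x))
  beta_reduce at h1
  rw [Measure.map_apply (by fun_prop) hsx, withDensity_apply _ hsx,
    ← lintegral_indicator hsx] at h1
  exact h1

/-- Two shifts of Gaussian data that are close in mean square cannot be told apart. -/
theorem two_point_bound {v : NNReal} (hv : v ≠ 0) {δ : Ω → ℝ} (hδ : Measurable δ)
    (hδ2 : MemLp δ 2 μ) {n : ℕ} (hn : 0 < n) (hsmall : n * ∫ x, δ x ^ 2 ∂μ ≤ v / 6)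
    {B₁ B₂ : Set (Fin n → Ω × ℝ)} (hB₂ : MeasurableSet B₂)
    (hB : B₁ ∪ B₂ = Set.univ) :
    1 / 2 ≤ (Measure.pi fun _ => μ.prod (gaussianReal 0 v)).real B₁
      + (Measure.pi fun _ => μ.prod (gaussianReal 0 v)).real
        ((fun z i => ((z i).1, (z i).2 + δ (z i).1)) ⁻¹' B₂) := by
  set P := μ.prod (gaussianReal 0 v) with hP
  set S : Ω × ℝ → Ω × ℝ := fun z => (z.1, z.2 + δ z.1) with hS
  have hSm : Measurable S := by rw [hS]; fun_prop
  have hv0 : (0 : ℝ) < v := NNReal.coe_pos.2 (pos_iff_ne_zero.2 hv)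
  set ρ : Ω × ℝ → ℝ≥0∞ := fun z =>
    ENNReal.ofReal (Real.exp (z.2 * δ z.1 / v - δ z.1 ^ 2 / (2 * v))) with hρ
  have hρm : Measurable ρ := by rw [hρ]; fun_prop
  have hmap : P.map S = P.withDensity ρ := prod_gaussian_shift μ hv hδ
  have hprob : IsProbabilityMeasure (P.map S) := Measure.isProbabilityMeasure_map hSm.aemeasurable
  have hprob' : IsProbabilityMeasure (P.withDensity ρ) := hmap ▸ hprob
  have hpi : (Measure.pi fun _ : Fin n => P).map (fun z i => S (z i))
      = (Measure.pi fun _ : Fin n => P).withDensity fun z => ∏ i, ρ (z i) := by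
    rw [Measure.pi_map_pi fun _ => hSm.aemeasurable, hmap, pi_withDensity P hρm]
  set Λ : (Fin n → Ω × ℝ) → ℝ := fun z =>
    ∑ i, ((z i).2 * δ (z i).1 / v - δ (z i).1 ^ 2 / (2 * v)) with hΛ
  have hΛm : Measurable Λ := by
    refine Finset.measurable_sum _ fun i _ => ?_
    have h1 : Measurable fun z : Ω × ℝ => z.2 * δ z.1 / v - δ z.1 ^ 2 / (2 * v) := by fun_prop
    exact h1.comp (measurable_pi_apply i)
  set Q := Measure.pi fun _ : Fin n => P with hQ
  have hprod : ∀ z : Fin n → Ω × ℝ, ∏ i, ρ (z i) = ENNReal.ofReal (Real.exp (Λ z)) := by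
    intro z
    rw [hΛ, Real.exp_sum, ENNReal.ofReal_prod_of_nonneg fun i _ => (Real.exp_pos _).le]
  -- The shifted law has density exp Λ ≥ 1 + Λ ≥ 1 - |Λ|, and the original law has density 1 ≥ 1 -
  -- |Λ|. Since B₁ and B₂ cover the space, the two probabilities add up to at least the integral of
  -- (1 - |Λ|)⁺; `ENNReal.ofReal` takes the positive part.
  have h2 : ∫⁻ z in B₂, ENNReal.ofReal (1 - |Λ z|) ∂Q ≤ Q ((fun z i => S (z i)) ⁻¹' B₂) := by
    have hSn : Measurable fun (z : Fin n → Ω × ℝ) i => S (z i) :=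
      measurable_pi_lambda _ fun i => hSm.comp (measurable_pi_apply i)
    rw [← Measure.map_apply hSn hB₂, hpi, withDensity_apply _ hB₂]
    refine lintegral_mono fun z => ?_
    rw [hprod]
    refine ENNReal.ofReal_le_ofReal ?_
    have h3 := Real.add_one_le_exp (Λ z)
    have h4 := neg_abs_le (Λ z)
    linarith
  have h1 : ∫⁻ z in B₁, ENNReal.ofReal (1 - |Λ z|) ∂Q ≤ Q B₁ := by
    rw [← setLIntegral_one]
    refine lintegral_mono fun z => ?_
    rw [← ENNReal.ofReal_one]
    refine ENNReal.ofReal_le_ofReal ?_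
    have := abs_nonneg (Λ z)
    linarith
  have h3 : ∫⁻ z, ENNReal.ofReal (1 - |Λ z|) ∂Q
      ≤ Q B₁ + Q ((fun z i => S (z i)) ⁻¹' B₂) := by
    rw [← setLIntegral_univ, ← hB]
    exact (lintegral_union_le _ _ _).trans (add_le_add h1 h2)
  -- the mean of the log-likelihood ratio
  have hn' : (n : ℝ) ≠ 0 := Nat.cast_ne_zero.2 hn.ne'
  set x2 := ∫ x, δ x ^ 2 ∂μ with hx2
  have hδ2' : Integrable (fun z : Ω × ℝ => δ z.1 ^ 2) P :=
    hδ2.integrable_sq.comp_fst (gaussianReal 0 v)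
  have hgsq : Integrable (fun e : ℝ => e ^ 2) (gaussianReal 0 v) :=
    (memLp_id_gaussianReal' 2 ENNReal.ofNat_ne_top).integrable_sq
  have hU : ∫⁻ z, ENNReal.ofReal ((∑ i, (z i).2 * δ (z i).1 / v) ^ 2) ∂Q
      ≤ ENNReal.ofReal (1 / 6) := by
    set f : Ω × ℝ → ℝ := fun z => n * (z.2 * δ z.1 / v) with hf
    have hfm : Measurable f := by rw [hf]; fun_prop
    have hfsq : (fun z => f z ^ 2) = fun z => (n / v : ℝ) ^ 2 * (δ z.1 ^ 2 * z.2 ^ 2) := by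
      funext z; rw [hf]; field_simp
    have hfi : Integrable (fun z => f z ^ 2) P := by
      rw [hfsq]
      exact (hδ2.integrable_sq.mul_prod hgsq).const_mul _
    have hf0 : ∫ z, f z ∂P = 0 := by
      have h5 := integral_prod_mul (μ := μ) (ν := gaussianReal 0 v) δ (fun e : ℝ => e)
      rw [integral_id_gaussianReal, mul_zero] at h5
      have h6 : f = fun z => (n / v : ℝ) * (δ z.1 * z.2) := by
        funext z; rw [hf]; field_simp
      rw [h6, integral_const_mul, h5, mul_zero]
    have hf2 : ∫ z, f z ^ 2 ∂P = (n / v : ℝ) ^ 2 * (x2 * v) := by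
      have h5 := integral_prod_mul (μ := μ) (ν := gaussianReal 0 v) (fun x => δ x ^ 2)
        (fun e : ℝ => e ^ 2)
      have h6 : ∫ e, e ^ 2 ∂gaussianReal 0 v = v := by
        have h7 := variance_id_gaussianReal (μ := 0) (v := v)
        rw [variance_of_integral_eq_zero aemeasurable_id
          (by simp)] at h7
        simpa using h7
      rw [hfsq, integral_const_mul, h5, h6]
    have h5 := lintegral_average_sq P ((memLp_two_iff_integrable_sq hfm.aestronglyMeasurable).2 hfi)
      hf0 hf2.le n
    have h6 : ∀ z : Fin n → Ω × ℝ, 1 / (n : ℝ) * ∑ i, f (z i) = ∑ i, (z i).2 * δ (z i).1 / v := by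
      intro z
      rw [Finset.mul_sum]
      refine Finset.sum_congr rfl fun i _ => ?_
      rw [hf]; field_simp
    simp only [h6] at h5
    refine h5.trans (ENNReal.ofReal_le_ofReal ?_)
    have h7 : (n / v : ℝ) ^ 2 * (x2 * v) / n = n * x2 / v := by field_simp
    rw [h7, div_le_iff₀ hv0]
    linarith
  have hV : ∫⁻ z, ENNReal.ofReal (∑ i, δ (z i).1 ^ 2 / (2 * v)) ∂Q ≤ ENNReal.ofReal (1 / 12) := by
    have hnn : ∀ z : Fin n → Ω × ℝ, ∀ i ∈ Finset.univ, 0 ≤ δ (z i).1 ^ 2 / (2 * v) :=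
      fun z i _ => by positivity
    simp only [ENNReal.ofReal_sum_of_nonneg (hnn _)]
    rw [lintegral_finsetSum]
    swap
    · intro i _
      have h5 : Measurable fun z : Ω × ℝ => ENNReal.ofReal (δ z.1 ^ 2 / (2 * v)) := by fun_prop
      exact h5.comp (measurable_pi_apply i)
    have h5 : ∀ i : Fin n, ∫⁻ z, ENNReal.ofReal (δ (z i).1 ^ 2 / (2 * v)) ∂Q
        = ENNReal.ofReal (x2 / (2 * v)) := by
      intro i
      have h6 : Measurable fun z : Ω × ℝ => ENNReal.ofReal (δ z.1 ^ 2 / (2 * v)) := by fun_prop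
      have h7 := (measurePreserving_eval (fun _ : Fin n => P) i).lintegral_comp h6
      refine h7.trans ?_
      rw [← ofReal_integral_eq_lintegral_ofReal (hδ2'.div_const _)
        (Eventually.of_forall fun z => by positivity), integral_div,
        integral_fun_fst (fun x => δ x ^ 2)]
      simp [hx2]
    simp only [h5, Finset.sum_const, Finset.card_univ, Fintype.card_fin, nsmul_eq_mul]
    rw [← ENNReal.ofReal_natCast, ← ENNReal.ofReal_mul (by positivity)]
    refine ENNReal.ofReal_le_ofReal ?_
    rw [mul_div_assoc', div_le_iff₀ (by positivity)]
    linarith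
  -- With Λ = U - V and |U| ≤ 1/4 + U², the mean of |Λ| is at most 1/4 + 1/6 + 1/12 = 1/2.
  have hI : (1 : ℝ≥0∞) ≤ ∫⁻ z, ENNReal.ofReal (1 - |Λ z|) ∂Q + ENNReal.ofReal (1 / 2) := by
    have h5 : ∀ z : Fin n → Ω × ℝ, (1 : ℝ≥0∞) ≤ ENNReal.ofReal (1 - |Λ z|)
        + (ENNReal.ofReal (1 / 4) + (ENNReal.ofReal ((∑ i, (z i).2 * δ (z i).1 / v) ^ 2)
          + ENNReal.ofReal (∑ i, δ (z i).1 ^ 2 / (2 * v)))) := by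
      intro z
      have hnn : 0 ≤ ∑ i, δ (z i).1 ^ 2 / (2 * (v : ℝ)) :=
        Finset.sum_nonneg fun i _ => by positivity
      rw [← ENNReal.ofReal_add (sq_nonneg _) hnn,
        ← ENNReal.ofReal_add (by norm_num) (by positivity), ← ENNReal.ofReal_one]
      refine le_trans (ENNReal.ofReal_le_ofReal ?_) (ENNReal.ofReal_add_le)
      have h6 : Λ z = ∑ i, (z i).2 * δ (z i).1 / v - ∑ i, δ (z i).1 ^ 2 / (2 * v) := by
        rw [hΛ, ← Finset.sum_sub_distrib]
      set U := ∑ i, (z i).2 * δ (z i).1 / v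
      have h7 : |Λ z| ≤ |U| + |∑ i, δ (z i).1 ^ 2 / (2 * (v : ℝ))| := by
        rw [h6]; exact abs_sub _ _
      rw [abs_of_nonneg hnn] at h7
      have h8 : |U| ≤ 1 / 4 + U ^ 2 := by
        rw [← sq_abs U]
        nlinarith [sq_nonneg (|U| - 1 / 2)]
      linarith
    have h6 : ∫⁻ _ : Fin n → Ω × ℝ, (1 : ℝ≥0∞) ∂Q = 1 := by simp
    rw [← h6]
    refine (lintegral_mono h5).trans ?_
    rw [lintegral_add_left (by fun_prop), lintegral_add_left (by fun_prop), lintegral_add_left]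
    · refine add_le_add le_rfl ?_
      have h7 : ∫⁻ _ : Fin n → Ω × ℝ, ENNReal.ofReal (1 / 4) ∂Q = ENNReal.ofReal (1 / 4) := by simp
      rw [h7]
      refine (add_le_add le_rfl (add_le_add hU hV)).trans (le_of_eq ?_)
      rw [← ENNReal.ofReal_add (by norm_num) (by norm_num),
        ← ENNReal.ofReal_add (by norm_num) (by norm_num)]
      norm_num
    · refine ENNReal.measurable_ofReal.comp (Measurable.pow_const ?_ _)
      refine Finset.measurable_sum _ fun i _ => ?_
      have h7 : Measurable fun z : Ω × ℝ => z.2 * δ z.1 / v := by fun_prop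
      exact h7.comp (measurable_pi_apply i)
  have h4 : (1 : ℝ≥0∞) ≤ Q B₁ + Q ((fun z i => S (z i)) ⁻¹' B₂) + ENNReal.ofReal (1 / 2) :=
    hI.trans (add_le_add h3 le_rfl)
  have h5 := ENNReal.toReal_mono (by finiteness) h4
  rw [ENNReal.toReal_add (by finiteness) (by finiteness),
    ENNReal.toReal_add (by finiteness) (by finiteness), ENNReal.toReal_one,
    ENNReal.toReal_ofReal (by norm_num)] at h5
  change 1 / 2 ≤ (Q B₁).toReal + (Q ((fun z i => S (z i)) ⁻¹' B₂)).toReal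
  linarith

end TwoPoint

/-! ### Assouad's lemma. -/

section Assouad

/-- Assouad's lemma, as a lower bound for a probability: if at every coordinate neighbours in the
cube are confused with probability at least `1/2` in total, then for some vertex at least an eighth
of the coordinates are wrong, with probability at least `1/8`. -/
theorem assouad {Z : Type*} [MeasurableSpace Z] (Q : Measure Z) [IsProbabilityMeasure Q]
    (S : Finset ℕ) (hS : S.Nonempty) (W : Finset ℕ → ℕ → Set Z)
    (hW : ∀ θ k, MeasurableSet (W θ k))
    (h : ∀ θ, ∀ k ∈ S, 1 / 2 ≤ Q.real (W θ k) + Q.real (W (symmDiff θ {k}) k)) :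
    ∃ θ, ∀ N : Z → ℝ, (∀ z, N z = ∑ k ∈ S, (W θ k).indicator 1 z) →
      1 / 8 ≤ Q.real {z | (S.card : ℝ) / 8 ≤ N z} := by
  have hcard : (0 : ℝ) < S.card := Nat.cast_pos.2 hS.card_pos
  -- Average over the cube of subsets of S. Flipping coordinate k permutes the cube, so both terms
  -- of the hypothesis have the same average, and the expected number of wrong coordinates is on
  -- average at least a quarter of the cardinality.
  obtain ⟨θ, hθ⟩ : ∃ θ, (S.card : ℝ) / 4 ≤ ∑ k ∈ S, Q.real (W θ k) := by
    by_contra hcon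
    push Not at hcon
    have h1 : ∑ θ ∈ S.powerset, ∑ k ∈ S, Q.real (W θ k) < ∑ θ ∈ S.powerset, (S.card : ℝ) / 4 :=
      Finset.sum_lt_sum_of_nonempty ⟨∅, Finset.empty_mem_powerset _⟩ fun θ _ => hcon θ
    have h2 : ∀ k ∈ S, ∑ θ ∈ S.powerset, Q.real (W (symmDiff θ {k}) k)
        = ∑ θ ∈ S.powerset, Q.real (W θ k) := by
      intro k hk
      have hmem : ∀ θ ∈ S.powerset, symmDiff θ {k} ∈ S.powerset := by
        intro θ hθ
        rw [Finset.mem_powerset] at hθ ⊢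
        intro j hj
        rw [Finset.mem_symmDiff] at hj
        rcases hj with hj | hj
        · exact hθ hj.1
        · rw [Finset.mem_singleton.1 hj.1]; exact hk
      refine Finset.sum_nbij' (fun θ => symmDiff θ {k}) (fun θ => symmDiff θ {k}) hmem hmem ?_ ?_
        fun _ _ => rfl
      · intro θ _; exact symmDiff_symmDiff_cancel_right _ _
      · intro θ _; exact symmDiff_symmDiff_cancel_right _ _
    have h3 : ∑ k ∈ S, ∑ θ ∈ S.powerset, (1 / 2 : ℝ)
        ≤ ∑ k ∈ S, ∑ θ ∈ S.powerset, (Q.real (W θ k) + Q.real (W (symmDiff θ {k}) k)) :=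
      Finset.sum_le_sum fun k hk => Finset.sum_le_sum fun θ _ => h θ k hk
    have h4 : ∑ k ∈ S, ∑ θ ∈ S.powerset, (Q.real (W θ k) + Q.real (W (symmDiff θ {k}) k))
        = 2 * ∑ θ ∈ S.powerset, ∑ k ∈ S, Q.real (W θ k) := by
      rw [Finset.sum_comm (s := S.powerset), Finset.mul_sum]
      refine Finset.sum_congr rfl fun k hk => ?_
      rw [Finset.sum_add_distrib, h2 k hk]
      ring
    rw [h4] at h3
    simp only [Finset.sum_const, nsmul_eq_mul] at h1 h3
    nlinarith
  refine ⟨θ, fun N hN => ?_⟩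
  have hNm : Measurable N := by
    have : N = fun z => ∑ k ∈ S, (W θ k).indicator 1 z := funext hN
    rw [this]
    exact Finset.measurable_sum _ fun k _ => measurable_one.indicator (hW θ k)
  set G : Set Z := {z | (S.card : ℝ) / 8 ≤ N z} with hG
  have hGm : MeasurableSet G := measurableSet_le measurable_const hNm
  have hint : ∀ k ∈ S, Integrable ((W θ k).indicator (1 : Z → ℝ)) Q := fun k _ =>
    (integrable_const (1 : ℝ)).indicator (hW θ k)
  have h1 : ∫ z, N z ∂Q = ∑ k ∈ S, Q.real (W θ k) := by
    simp only [hN]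
    rw [integral_finsetSum _ hint]
    exact Finset.sum_congr rfl fun k _ => integral_indicator_one (hW θ k)
  have hNle : ∀ z, N z ≤ S.card := by
    intro z
    rw [hN, ← nsmul_one, ← Finset.sum_const]
    refine Finset.sum_le_sum fun k _ => ?_
    exact Set.indicator_le_self' (fun _ _ => zero_le_one) z
  -- A reverse Markov inequality: N is at most the full cardinality on G and less than an eighth of
  -- it elsewhere, so a mean of a quarter forces G to have probability at least 1/8.
  have h2 : ∫ z, N z ∂Q ≤ ∫ z, ((S.card : ℝ) * G.indicator 1 z + (S.card : ℝ) / 8) ∂Q := by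
    refine integral_mono ?_ ?_ fun z => ?_
    · have : N = fun z => ∑ k ∈ S, (W θ k).indicator 1 z := funext hN
      rw [this]
      exact integrable_finsetSum _ hint
    · exact (((integrable_const (1 : ℝ)).indicator hGm).const_mul _).add (integrable_const _)
    · by_cases hz : z ∈ G
      · simp only [Set.indicator_of_mem hz, Pi.one_apply]
        linarith [hNle z]
      · simp only [Set.indicator_of_notMem hz, mul_zero, zero_add]
        exact (not_le.1 hz).le
  have hGi : Integrable (G.indicator (1 : Z → ℝ)) Q := (integrable_const (1 : ℝ)).indicator hGm
  rw [integral_add (hGi.const_mul _) (integrable_const _), integral_const_mul, integral_indicator_one hGm, h1] at h2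
  simp only [integral_const, probReal_univ, smul_eq_mul, one_mul] at h2
  nlinarith

end Assouad

end FLR


namespace FLR

/-! ### Translation of a design to mean zero. -/

section Center

variable {T H : Type*} [MeasurableSpace T] {τ : Measure T}
  [NormedAddCommGroup H] [InnerProductSpace ℝ H] [CompleteSpace H] [RKHS ℝ H T ℝ]
  {ι : H →ₗ[ℝ] Lp ℝ 2 τ} {p : Seminorm ℝ H}

theorem memLp_map_const_add {E : Type*} [NormedAddCommGroup E] [MeasurableSpace E] [BorelSpace E]
    {μ : Measure E} [IsFiniteMeasure μ] (h : MemLp id 2 μ) (c : E) :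
    MemLp id 2 (μ.map (fun x => c + x)) :=
  (measurableEmbedding_addLeft _).memLp_map_measure_iff.mpr <| (memLp_const c).add h

/-- The design with the random function replaced by its deviation from the mean. -/
noncomputable def Design.center (D : Design ι p) : Design ι p :=
  { D with
    law := D.law.map (fun x => -D.mean + x)
    isProb := Measure.isProbabilityMeasure_map (by fun_prop)
    memLp := memLp_map_const_add D.memLp _
    cov_spec := fun f g => by rw [covarianceBilin_map_const_add, D.cov_spec] }

theorem Design.mean_center (D : Design ι p) : D.center.mean = 0 := by
  change ∫ y, y ∂(D.law.map (fun x => -D.mean + x)) = 0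
  have hi : Integrable (fun x : Lp ℝ 2 τ => x) D.law := D.memLp.integrable one_le_two
  rw [(measurableEmbedding_addLeft (-D.mean)).integral_map, integral_add (integrable_const _) hi]
  simp [mean]

/-- The class conditions involve only the covariance and the centred random function, which a
translation leaves unchanged. The lower bound uses this because the intercept is fixed there: E⟨X,
f⟩² equals ⟨C f, f⟩ for every f only when the mean vanishes. -/
theorem Design.InClassWith.center {ρ : ℕ → ℝ} {s M A : ℝ} {k₀ : ℕ} {D : Design ι p}
    (hD : D.InClassWith ρ s M A k₀) : D.center.InClassWith ρ s M A k₀ := by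
  have hmean : ∫ y, y ∂D.center.law = 0 := D.mean_center
  have hemb := measurableEmbedding_addLeft (-D.mean)
  have hint : ∀ (f : Lp ℝ 2 τ) (k : ℕ),
      ∫ x, ⟪f, x - ∫ y, y ∂D.center.law⟫ ^ k ∂D.center.law
        = ∫ x, ⟪f, x - ∫ y, y ∂D.law⟫ ^ k ∂D.law := by
    intro f k
    rw [hmean]
    change ∫ x, ⟪f, x - 0⟫ ^ k ∂(D.law.map (fun x => -D.mean + x)) = _
    rw [hemb.integral_map]
    refine integral_congr_ae (Eventually.of_forall fun x => ?_)
    simp only [sub_zero, neg_add_eq_sub]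
    rfl
  refine ⟨hD.eigenvalues, fun f => ?_, fun f => ?_, hD.ratios⟩
  · rw [hmean]
    change Integrable _ (D.law.map (fun x => -D.mean + x))
    rw [hemb.integrable_map_iff]
    refine (hD.fourth_integrable f).congr (Eventually.of_forall fun x => ?_)
    simp only [Function.comp, sub_zero, neg_add_eq_sub]
    rfl
  · rw [hint, hint]
    exact hD.fourth_moment f

end Center

/-! ### The minimax lower bound for slopes of bounded penalty. -/

section Lower

variable {T H : Type*} [MeasurableSpace T] {τ : Measure T}
  [NormedAddCommGroup H] [InnerProductSpace ℝ H] [CompleteSpace H] [RKHS ℝ H T ℝ]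
  {ι : H →ₗ[ℝ] Lp ℝ 2 τ} {p : Seminorm ℝ H} {H₀ : Submodule ℝ H} [FiniteDimensional ℝ H₀]

/-- The data generated by the slope `β`. -/
noncomputable def sample (ι : H →ₗ[ℝ] Lp ℝ 2 τ) (α₀ : ℝ) {n : ℕ} (β : H)
    (z : Fin n → Lp ℝ 2 τ × ℝ) : Fin n → Lp ℝ 2 τ × ℝ :=
  fun i => ((z i).1, α₀ + ⟪(z i).1, ι β⟫ + (z i).2)

theorem measurable_inner_left (f : Lp ℝ 2 τ) : Measurable fun x : Lp ℝ 2 τ => ⟪x, f⟫ :=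
  Continuous.measurable (by fun_prop)

theorem measurable_sample (α₀ : ℝ) {n : ℕ} (β : H) :
    Measurable (sample (n := n) ι α₀ β) := by
  refine measurable_pi_lambda _ fun i => ?_
  have h1 : Measurable fun z : Lp ℝ 2 τ × ℝ => (z.1, α₀ + ⟪z.1, ι β⟫ + z.2) :=
    measurable_fst.prodMk
      (((((measurable_inner_left (ι β)).comp measurable_fst)).const_add α₀).add measurable_snd)
  exact h1.comp (measurable_pi_apply i)

theorem isNoise_gaussianReal (v : NNReal) : IsNoise (v : ℝ) (gaussianReal 0 v) where
  isProb := inferInstance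
  memLp := memLp_id_gaussianReal' 2 ENNReal.ofNat_ne_top
  centered := integral_id_gaussianReal
  variance_le := variance_id_gaussianReal.le

/-- Coordinatewise lower bound for the loss. -/
theorem sum_le_normSq {D : Design ι p} (a : ℝ) (f : Lp ℝ 2 τ) (S : Finset ℕ) :
    ∑ k ∈ S, ENNReal.ofReal ((1 + ((D.ν k)⁻¹ - 1) ^ a) * D.coef f k ^ 2) ≤ D.normSq a f :=
  ENNReal.sum_le_tsum S

/-- The minimax lower bound over a cube of slopes spanned by the basis elements in `S`. -/
theorem exists_errProb_ge {D : Design ι p} {w : ℕ → H} (hw : D.IsBasis w)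
    (h : IsPenalty ι p H₀) (hν : ∀ k, 0 < D.ν k) (hmean : D.mean = 0) {v : NNReal} (hv : v ≠ 0)
    {n : ℕ} (hn : 0 < n) {S : Finset ℕ} (hS : S.Nonempty) {x : ℝ} (hx : 0 < x)
    (hsmall : n * x ^ 2 ≤ v / 6) {a B : ℝ}
    (hB : ∑ k ∈ S, ((D.ν k)⁻¹ - 1) * x ^ 2 ≤ B) {L : ℝ}
    (hL : ∀ k ∈ S, L ≤ 1 + ((D.ν k)⁻¹ - 1) ^ a) {t : ℝ} (ht : 0 ≤ t)
    (htL : t < S.card / 8 * (L * (x ^ 2 / 4))) (α₀ : ℝ)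
    {b : (Fin n → Lp ℝ 2 τ × ℝ) → Lp ℝ 2 τ} (hb : Measurable b) :
    ∃ β₀ : H, p β₀ ^ 2 ≤ B ∧ 1 / 8 ≤ errProb D (gaussianReal 0 v) a α₀ β₀ b t := by
  classical
  set Q := Measure.pi fun _ : Fin n => D.law.prod (gaussianReal 0 v) with hQ
  let β : Finset ℕ → H := fun θ => ∑ k ∈ S, (if k ∈ θ then x else 0) • w k
  have hcoefβ : ∀ θ, ∀ k ∈ S, D.coef (ι (β θ)) k = if k ∈ θ then x else 0 := by
    intro θ k hk
    rw [hw.coef_linear_comb hν, if_pos hk]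
  let c : Finset ℕ → ℕ → (Fin n → Lp ℝ 2 τ × ℝ) → ℝ := fun θ k z =>
    D.coef (b (sample ι α₀ (β θ) z)) k
  have hcm : ∀ θ k, Measurable (c θ k) := fun θ k =>
    (Design.continuous_coef k).measurable.comp (hb.comp (measurable_sample α₀ _))
  let W : Finset ℕ → ℕ → Set (Fin n → Lp ℝ 2 τ × ℝ) := fun θ k =>
    {z | x ^ 2 / 4 ≤ (c θ k z - if k ∈ θ then x else 0) ^ 2}
  have hWm : ∀ θ k, MeasurableSet (W θ k) := fun θ k =>
    measurableSet_le measurable_const (((hcm θ k).sub_const _).pow_const 2)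
  have hmem : ∀ (θ : Finset ℕ) (k : ℕ), (k ∈ symmDiff θ {k} ↔ k ∉ θ) := by
    intro θ k
    rw [Finset.mem_symmDiff]
    simp
  have htwo : ∀ θ, ∀ k ∈ S, 1 / 2 ≤ Q.real (W θ k) + Q.real (W (symmDiff θ {k}) k) := by
    intro θ k hk
    set θ' := symmDiff θ {k} with hθ'
    set ε : ℝ := if k ∈ θ then -x else x with hε
    have hε2 : ε ^ 2 = x ^ 2 := by rw [hε]; split_ifs <;> ring
    have hβ' : β θ' = β θ + ε • w k := by
      have h1 : ∀ j ∈ S, (if j ∈ θ' then x else 0) • w j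
          = (if j ∈ θ then x else 0) • w j + if j = k then ε • w k else 0 := by
        intro j _
        by_cases hj : j = k
        · subst hj
          rw [if_pos rfl, ← add_smul]
          congr 1
          have := hmem θ j
          by_cases hjθ : j ∈ θ
          · simp [hε, hθ', hjθ, this]
          · simp [hε, hθ', hjθ, this]
        · rw [if_neg hj, add_zero]
          have : j ∈ θ' ↔ j ∈ θ := by
            rw [hθ', Finset.mem_symmDiff]
            simp [hj]
          simp only [this]
      change ∑ j ∈ S, _ = _
      rw [Finset.sum_congr rfl h1, Finset.sum_add_distrib, Finset.sum_ite_eq', if_pos hk]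
    set δ : Lp ℝ 2 τ → ℝ := fun y => ⟪y, ι (ε • w k)⟫ with hδ
    have hδm : Measurable δ := measurable_inner_left _
    have hmem2 := D.memLp_inner (ι (ε • w k))
    have hint2 := D.integral_inner_mul (ι (ε • w k)) (ι (ε • w k))
    rw [hmean] at hmem2 hint2
    simp only [sub_zero, ← sq] at hmem2 hint2
    have hC : ⟪D.C (ι (ε • w k)), ι (ε • w k)⟫ = x ^ 2 := by
      rw [map_smul, map_smul, inner_smul_left, inner_smul_right, hw.incl, D.inner_omega hν,
        if_pos rfl]
      simp only [RCLike.conj_to_real, mul_one]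
      rw [← sq, hε2]
    rw [hC] at hint2
    have hB₂ : MeasurableSet {z | x ^ 2 / 4 ≤ (c θ k z - if k ∈ θ' then x else 0) ^ 2} :=
      measurableSet_le measurable_const (((hcm θ k).sub_const _).pow_const 2)
    -- Changing one coordinate of the slope alters the responses exactly as adding δ to the noise
    -- does. Both error events thus concern the same estimate, at vertex θ, under the original and
    -- under the shifted noise.
    have hpre : W θ' k = (fun (z : Fin n → Lp ℝ 2 τ × ℝ) i => ((z i).1, (z i).2 + δ (z i).1)) ⁻¹'
        {z | x ^ 2 / 4 ≤ (c θ k z - if k ∈ θ' then x else 0) ^ 2} := by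
      ext z
      have h1 : sample ι α₀ (β θ') z
          = sample ι α₀ (β θ) (fun i => ((z i).1, (z i).2 + δ (z i).1)) := by
        funext i
        simp only [sample, hβ', map_add, inner_add_right, hδ]
        congr 1
        ring
      change x ^ 2 / 4 ≤ (D.coef (b (sample ι α₀ (β θ') z)) k - _) ^ 2 ↔
        x ^ 2 / 4 ≤ (D.coef (b (sample ι α₀ (β θ) _)) k - _) ^ 2
      rw [h1]
    rw [hpre]
    refine two_point_bound D.law hv hδm hmem2 hn ?_ hB₂ ?_
    · rw [hint2]; exact hsmall
    -- One number cannot be closer than x/2 to both 0 and x, so at least one of the two errors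
    -- occurs.
    · refine Set.eq_univ_of_forall fun z => ?_
      by_contra hcon
      have h1 : (c θ k z - if k ∈ θ then x else 0) ^ 2 < x ^ 2 / 4 := by
        by_contra hne
        exact hcon (Or.inl (not_lt.1 hne))
      have h2 : (c θ k z - if k ∈ θ' then x else 0) ^ 2 < x ^ 2 / 4 := by
        by_contra hne
        exact hcon (Or.inr (not_lt.1 hne))
      have h3 := hmem θ k
      by_cases hkθ : k ∈ θ
      · rw [if_pos hkθ] at h1
        rw [if_neg (by rw [hθ', h3]; exact not_not.2 hkθ)] at h2
        nlinarith [sq_nonneg (2 * c θ k z - x)]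
      · rw [if_neg hkθ] at h1
        rw [if_pos (by rw [hθ', h3]; exact hkθ)] at h2
        nlinarith [sq_nonneg (2 * c θ k z - x)]
  obtain ⟨θ, hθ⟩ := assouad Q S hS W hWm htwo
  have h8 := hθ (fun z => ∑ k ∈ S, (W θ k).indicator 1 z) fun z => rfl
  have hg : ∀ k, 0 ≤ (D.ν k)⁻¹ - 1 := fun k =>
    sub_nonneg.2 ((one_le_inv₀ (hν k)).2 (hw.ν_le_one h hν k))
  refine ⟨β θ, ?_, ?_⟩
  · rw [hw.penalty_linear_comb h hν]
    refine (Finset.sum_le_sum fun k _ => mul_le_mul_of_nonneg_left ?_ (hg k)).trans hB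
    split_ifs
    · exact le_rfl
    · rw [zero_pow two_ne_zero]; positivity
  · have h9 : ENNReal.ofReal (1 / 8)
        ≤ Q {z | (S.card : ℝ) / 8 ≤ ∑ k ∈ S, (W θ k).indicator 1 z} :=
      ENNReal.ofReal_le_of_le_toReal h8
    have h10 : (1 / 8 : ℝ≥0∞) = ENNReal.ofReal (1 / 8) := by
      rw [ENNReal.ofReal_div_of_pos (by norm_num), ENNReal.ofReal_one, ENNReal.ofReal_ofNat]
    rw [h10]
    refine h9.trans (measure_mono fun z hz => ?_)
    change ENNReal.ofReal t < D.normSq a (b (sample ι α₀ (β θ) z) - ι (β θ))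
    refine lt_of_lt_of_le ?_ (sum_le_normSq a _ S)
    rw [← ENNReal.ofReal_sum_of_nonneg fun k _ =>
      mul_nonneg (by have := Real.rpow_nonneg (hg k) a; positivity) (sq_nonneg _)]
    have hL0 : 0 < L * (x ^ 2 / 4) := by
      have h1 : (0 : ℝ) ≤ S.card / 8 := by positivity
      by_contra hcon
      nlinarith [mul_nonneg h1 (neg_nonneg.2 (not_lt.1 hcon))]
    have h11 : S.card / 8 * (L * (x ^ 2 / 4)) ≤ ∑ k ∈ S, (1 + ((D.ν k)⁻¹ - 1) ^ a)
        * D.coef (b (sample ι α₀ (β θ) z) - ι (β θ)) k ^ 2 := by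
      refine (mul_le_mul_of_nonneg_right hz hL0.le).trans ?_
      rw [Finset.sum_mul]
      refine Finset.sum_le_sum fun k hk => ?_
      rw [Design.coef_sub, hcoefβ θ k hk]
      have h12 := Real.rpow_nonneg (hg k) a
      by_cases hzW : z ∈ W θ k
      · rw [Set.indicator_of_mem hzW, Pi.one_apply, one_mul]
        have h13 : x ^ 2 / 4 ≤ (D.coef (b (sample ι α₀ (β θ) z)) k
          - if k ∈ θ then x else 0) ^ 2 := hzW
        exact mul_le_mul (hL k hk) h13 (by positivity) (by positivity)
      · rw [Set.indicator_of_notMem hzW, zero_mul]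
        positivity
    exact (ENNReal.ofReal_lt_ofReal_iff_of_nonneg ht).2 (htL.trans_le h11)

/-- The minimax lower bound over slopes with bounded penalty. -/
theorem lower_bound (h : IsPenalty ι p H₀) {ρ : ℕ → ℝ} {r s M M₂ a α₀ A B : ℝ}
    {k₀ : ℕ} (hr : 1 / 2 < r) (hs : 1 / 2 < s) (hM₂ : 0 < M₂)
    (hB : 0 < B) (ha0 : 0 ≤ a)
    (hρ : AsympEquiv ρ fun k => ((k : ℝ) + 1) ^ (-(2 * r)))
    {D : Design ι p} (hD : D.InClassWith ρ s M A k₀) :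
    ∃ d : ℝ, 0 < d ∧ 0 < liminf (fun n : ℕ => ⨅ b : Estimator τ n,
      worstProb {D : Design ι p | D.InClassWith ρ s M A k₀} M₂ B a α₀ b.1
        (d * rate r s a n)) atTop := by
  obtain ⟨A', k₀', hρ'⟩ := id hρ
  have hA' := hρ'.1
  have hA := hD.eigenvalues.1
  set q := r + s with hq
  have hq1 : 1 < q := by linarith
  set k₁ := max k₀ k₀'
  set c₁ := (A ^ 2 * A')⁻¹ with hc₁
  set c₂ := A ^ 2 * A' with hc₂
  have hc₂0 : 0 < c₂ := by positivity
  have hc₁0 : 0 < c₁ := by positivity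
  -- The constant in x² = c₃/n. The first bound gives n x² ≤ M₂/6, so neighbours are
  -- indistinguishable. The second keeps the penalty below B: at most 2m coordinates contribute,
  -- each at most c₂ (4m)^(2q) c₃/n, and m^(2q+1) = n.
  set c₃ : ℝ := min (M₂ / 6) (B / (c₂ * (2 * 4 ^ (2 * q)))) with hc₃
  have hc₃0 : 0 < c₃ := lt_min (by positivity) (by positivity)
  -- The loss reaches 1/8 · 1/4 = 1/32 of the comparison quantity; half of this leaves room for the
  -- strict inequality.
  set d : ℝ := c₁ ^ a * c₃ / 64 with hd
  have hd0 : 0 < d := by positivity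
  have hDc := hD.center
  have hν := D.center.ν_pos hρ hDc
  obtain ⟨w, hw⟩ := D.center.exists_isBasis h
  let v : NNReal := ⟨M₂, hM₂.le⟩
  have hv : v ≠ 0 := fun h0 => hM₂.ne' (congrArg NNReal.toReal h0)
  refine ⟨d, hd0, ?_⟩
  have hexp : Tendsto (fun n : ℕ => (n : ℝ) ^ (1 / (2 * q + 1))) atTop atTop :=
    (tendsto_rpow_atTop (by positivity)).comp tendsto_natCast_atTop_atTop
  have hmain : ∀ᶠ n : ℕ in atTop, (1 / 8 : ℝ≥0∞) ≤ ⨅ b : Estimator τ n,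
      worstProb {D : Design ι p | D.InClassWith ρ s M A k₀} M₂ B a α₀ b.1
        (d * rate r s a n) := by
    filter_upwards [hexp.eventually_ge_atTop (max 1 k₁), eventually_gt_atTop 0] with n hn hn0
    refine le_iInf fun b => ?_
    have hn0' : (0 : ℝ) < n := Nat.cast_pos.2 hn0
    set m := (n : ℝ) ^ (1 / (2 * q + 1)) with hm
    have hm1 : 1 ≤ m := (le_max_left _ _).trans hn
    have hm0 : 0 < m := by linarith
    have hmk : (k₁ : ℝ) ≤ m := (le_max_right _ _).trans hn
    have hmn : m ^ (2 * q + 1) = n := by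
      rw [hm, ← Real.rpow_mul hn0'.le, one_div, inv_mul_cancel₀ (by positivity), Real.rpow_one]
    set j := ⌈m⌉₊ with hj
    have hj1 : m ≤ j := Nat.le_ceil _
    have hj2 : (j : ℝ) ≤ 2 * m := (Nat.ceil_lt_add_one hm0.le).le.trans (by linarith)
    have hjpos : 0 < j := Nat.ceil_pos.2 hm0
    have hkj : k₁ ≤ j := by exact_mod_cast hmk.trans hj1
    set S := Finset.Ico j (2 * j) with hS
    have hcard : S.card = j := by rw [hS, Nat.card_Ico]; omega
    set x := √(c₃ / n) with hx
    have hx2 : x ^ 2 = c₃ / n := Real.sq_sqrt (by positivity)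
    have hgrow : ∀ k ∈ S, c₁ * m ^ (2 * q) ≤ (D.center.ν k)⁻¹ - 1 ∧
        (D.center.ν k)⁻¹ - 1 ≤ c₂ * (4 * m) ^ (2 * q) := by
      intro k hk
      rw [hS, Finset.mem_Ico] at hk
      obtain ⟨h1, h2⟩ := D.center.growth hρ' hDc (k := k) (hkj.trans hk.1)
      have h3 : m ≤ (k : ℝ) + 1 := by
        have : (j : ℝ) ≤ k := by exact_mod_cast hk.1
        linarith
      have h4 : (k : ℝ) + 1 ≤ 4 * m := by
        have : (k : ℝ) + 1 ≤ 2 * j := by exact_mod_cast hk.2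
        linarith
      constructor
      · refine le_trans ?_ h1
        gcongr
      · refine h2.trans ?_
        gcongr
    obtain ⟨β₀, hβ₀, hprob⟩ := exists_errProb_ge hw h hν D.mean_center hv hn0
      (S := S) (Finset.card_pos.1 (by rw [hcard]; exact hjpos)) (x := x)
      (Real.sqrt_pos.2 (by positivity)) (a := a) (B := B)
      (L := c₁ ^ a * m ^ (2 * q * a)) (t := d * rate r s a n) (by
        rw [hx2, mul_div_cancel₀ _ hn0'.ne']
        exact min_le_left _ _) (by
        rw [hx2]
        calc ∑ k ∈ S, ((D.center.ν k)⁻¹ - 1) * (c₃ / n)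
            ≤ ∑ k ∈ S, (c₂ * (4 * m) ^ (2 * q)) * (c₃ / n) := by
              refine Finset.sum_le_sum fun k hk => ?_
              have := (hgrow k hk).2
              gcongr
          _ = j * ((c₂ * (4 * m) ^ (2 * q)) * (c₃ / n)) := by
              rw [Finset.sum_const, hcard, nsmul_eq_mul]
          _ ≤ (2 * m) * ((c₂ * (4 * m) ^ (2 * q)) * (c₃ / n)) := by gcongr
          _ = c₂ * (2 * 4 ^ (2 * q)) * c₃ * (m ^ (2 * q) * m / n) := by
              rw [Real.mul_rpow (by norm_num) hm0.le]; ring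
          _ = c₂ * (2 * 4 ^ (2 * q)) * c₃ := by
              rw [← Real.rpow_add_one hm0.ne', hmn, div_self hn0'.ne', mul_one]
          _ ≤ c₂ * (2 * 4 ^ (2 * q)) * (B / (c₂ * (2 * 4 ^ (2 * q)))) := by
              gcongr
              exact min_le_right _ _
          _ = B := by field_simp)
      (fun k hk => by
        have h1 := (hgrow k hk).1
        have h2 : (c₁ * m ^ (2 * q)) ^ a ≤ ((D.center.ν k)⁻¹ - 1) ^ a :=
          Real.rpow_le_rpow (by positivity) h1 ha0
        rw [Real.mul_rpow hc₁0.le (by positivity), ← Real.rpow_mul hm0.le] at h2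
        linarith)
      (by rw [rate]; positivity) (by
        rw [hcard, hx2]
        have h1 : rate r s a n = m * m ^ (2 * q * a) / n := by
          rw [rate, ← hq, hm, ← Real.rpow_mul hn0'.le, ← Real.rpow_add hn0',
            ← Real.rpow_sub_one hn0'.ne']
          congr 1
          field_simp
          ring
        rw [h1, hd]
        have h2 : 0 < m ^ (2 * q * a) := by positivity
        calc c₁ ^ a * c₃ / 64 * (m * m ^ (2 * q * a) / n)
            < c₁ ^ a * c₃ / 32 * (m * m ^ (2 * q * a) / n) := by gcongr; norm_num
          _ = m / 8 * (c₁ ^ a * m ^ (2 * q * a) * (c₃ / n / 4)) := by ring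
          _ ≤ _ := by gcongr) α₀ b.2
    refine hprob.trans ?_
    exact le_iSup₂_of_le D.center hDc (le_iSup₂_of_le (gaussianReal 0 v) (isNoise_gaussianReal v)
      (le_iSup₂_of_le β₀ hβ₀ le_rfl))
  exact lt_of_lt_of_le (by norm_num) (le_liminf_of_le (by isBoundedDefault) hmain)

end Lower

end FLR


/-! ### The lower bound for unrestricted slopes. -/

namespace FLR

/-- A set none of whose points can be moved within the set by a large multiple of a unit vector `u`
fills at most a quarter of a large cube. -/
theorem volume_le_of_separated {n : ℕ} {δ T : ℝ} (hδ : 0 < δ)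
    (hT : T = 6 * 2 ^ (n + 2) * δ) {u : Fin n → ℝ} (hu : ‖u‖ = 1) {S : Set (Fin n → ℝ)}
    (hS : MeasurableSet S) (hsub : S ⊆ Set.Icc 0 (fun _ => T))
    (hsep : ∀ x ∈ S, ∀ y ∈ S, ∀ c : ℝ, x - y = c • u → |c| < 3 * δ) :
    volume S ≤ volume (Set.Icc (0 : Fin n → ℝ) fun _ => T) / 4 := by
  -- The translates of S by the first N multiples of 3δ u are disjoint. Since 3δ N = T/2 they lie in
  -- a cube of side 2T, of volume 2^n T^n, which leaves at most a quarter of T^n for each of them.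
  set N := 2 ^ (n + 2) with hN
  have hT0 : 0 < T := by rw [hT]; positivity
  let v : Fin N → Fin n → ℝ := fun j => ((j : ℝ) * (3 * δ)) • u
  let S' : Fin N → Set (Fin n → ℝ) := fun j => (fun x => v j + x) '' S
  have hvol : ∀ j, volume (S' j) = volume S := fun j => by
    simp only [S', Set.image_add_left, measure_preimage_add]
  have hmeas : ∀ j, MeasurableSet (S' j) := fun j =>
    (measurableEmbedding_addLeft (v j)).measurableSet_image.2 hS
  have hdisj : Pairwise (Function.onFun Disjoint S') := by
    intro i j hij
    rw [Function.onFun, Set.disjoint_left]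
    rintro _ ⟨x, hx, rfl⟩ ⟨y, hy, hxy⟩
    simp only at hxy
    have h1 : y - x = (((i : ℝ) - j) * (3 * δ)) • u := by
      have h2 : y - x = v i - v j := by
        rw [sub_eq_sub_iff_add_eq_add, add_comm y, hxy]
      rw [h2]
      simp only [v]
      rw [← sub_smul]
      congr 1
      ring
    have h3 := hsep y hy x hx _ h1
    rw [abs_mul, abs_of_pos (by positivity : (0 : ℝ) < 3 * δ)] at h3
    have h4 : (1 : ℝ) ≤ |(i : ℝ) - j| := by
      have h5 : ((i : ℕ) : ℤ) - ((j : ℕ) : ℤ) ≠ 0 := by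
        intro h0
        exact hij (Fin.ext (by omega))
      have h6 := Int.one_le_abs h5
      have h7 : ((1 : ℤ) : ℝ) ≤ ((|((i : ℕ) : ℤ) - ((j : ℕ) : ℤ)| : ℤ) : ℝ) := by exact_mod_cast h6
      simpa using h7
    nlinarith
  have hcover : (⋃ j, S' j) ⊆ Set.Icc (fun _ => -(T / 2)) (fun _ => T + T / 2) := by
    refine Set.iUnion_subset fun j => ?_
    rintro _ ⟨x, hx, rfl⟩
    have hxI := hsub hx
    have hvj : ∀ i, |v j i| ≤ T / 2 := by
      intro i
      have h1 : |u i| ≤ 1 := by rw [← hu]; exact norm_le_pi_norm u i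
      have h2 : (j : ℝ) ≤ 2 ^ (n + 2) := by
        have : (j : ℕ) ≤ N := j.2.le
        have h3 : ((j : ℕ) : ℝ) ≤ ((N : ℕ) : ℝ) := by exact_mod_cast this
        refine h3.trans (le_of_eq ?_)
        rw [hN]
        push_cast
        rfl
      simp only [v, Pi.smul_apply, smul_eq_mul, abs_mul]
      rw [abs_of_nonneg (by positivity : (0 : ℝ) ≤ j), abs_of_pos (by norm_num : (0 : ℝ) < 3),
        abs_of_pos hδ, hT]
      calc (j : ℝ) * (3 * δ) * |u i| ≤ 2 ^ (n + 2) * (3 * δ) * 1 := by gcongr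
        _ = _ := by ring
    refine ⟨fun i => ?_, fun i => ?_⟩
    · have h1 := (abs_le.1 (hvj i)).1
      have h2 := hxI.1 i
      simp only [Pi.zero_apply, Pi.add_apply] at h2 ⊢
      linarith
    · have h1 := (abs_le.1 (hvj i)).2
      have h2 := hxI.2 i
      simp only [Pi.add_apply] at h2 ⊢
      linarith
  have h1 : (N : ℝ≥0∞) * volume S ≤ 2 ^ n * ENNReal.ofReal T ^ n := by
    have h2 := measure_mono (μ := volume) hcover
    rw [measure_iUnion hdisj hmeas, tsum_fintype, Finset.sum_congr rfl fun j _ => hvol j,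
      Finset.sum_const, Finset.card_univ, Fintype.card_fin, nsmul_eq_mul, Real.volume_Icc_pi] at h2
    refine h2.trans (le_of_eq ?_)
    have h3 : T + T / 2 - -(T / 2) = 2 * T := by ring
    simp only [h3, Finset.prod_const, Finset.card_univ, Fintype.card_fin]
    rw [ENNReal.ofReal_mul (by norm_num), mul_pow, ENNReal.ofReal_ofNat]
  rw [Real.volume_Icc_pi]
  simp only [Pi.zero_apply, sub_zero, Finset.prod_const, Finset.card_univ, Fintype.card_fin]
  rw [ENNReal.le_div_iff_mul_le (by simp) (by simp)]
  have h2 : (2 : ℝ≥0∞) ^ n * (volume S * 4) ≤ 2 ^ n * ENNReal.ofReal T ^ n := by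
    refine le_trans (le_of_eq ?_) h1
    rw [hN]
    push_cast
    ring
  exact (ENNReal.mul_le_mul_iff_right (by simp) (by finiteness)).1 h2

section Unbounded

variable {T H : Type*} [MeasurableSpace T] {τ : Measure T}
  [NormedAddCommGroup H] [InnerProductSpace ℝ H] [CompleteSpace H] [RKHS ℝ H T ℝ]
  {ι : H →ₗ[ℝ] Lp ℝ 2 τ} {p : Seminorm ℝ H} {H₀ : Submodule ℝ H} [FiniteDimensional ℝ H₀]

/-- With slopes of unbounded size no estimator has a bounded error, since the data do not determine
all the coordinates of the slope. -/
theorem exists_errProb_ge_half {D : Design ι p} {w : ℕ → H} (hw : D.IsBasis w)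
    (h : IsPenalty ι p H₀) (hν : ∀ k, 0 < D.ν k) (noise : Measure ℝ) [IsProbabilityMeasure noise]
    (a α₀ t : ℝ) {n : ℕ} {b : (Fin n → Lp ℝ 2 τ × ℝ) → Lp ℝ 2 τ} (hb : Measurable b) :
    ∃ β₀ : H, 1 / 2 ≤ errProb D noise a α₀ β₀ b t := by
  set Q := Measure.pi fun _ : Fin n => D.law.prod noise with hQ
  set V := Fin (n + 1) → ℝ
  let β : V → H := fun x => ∑ k, x k • w k
  have hinner : ∀ (y : Lp ℝ 2 τ) (x : V), ⟪y, ι (β x)⟫ = ∑ k, x k * ⟪y, D.ω k⟫ := by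
    intro y x
    simp only [β, map_sum, map_smul, inner_sum, inner_smul_right, hw.incl]
  have hcoefβ : ∀ (x : V) (k : Fin (n + 1)), D.coef (ι (β x)) k = x k := by
    intro x k
    simp only [β, map_sum, map_smul, Design.coef_sum, Design.coef_smul, hw.coef_basis hν]
    rw [Finset.sum_eq_single k]
    · simp
    · intro j _ hj
      rw [if_neg (fun h0 => hj (Fin.ext h0)), mul_zero]
    · simp
  let c : V → (Fin n → Lp ℝ 2 τ × ℝ) → V := fun x z k =>
    D.coef (b (sample ι α₀ (β x) z)) k
  have hsm : Measurable fun q : V × (Fin n → Lp ℝ 2 τ × ℝ) => sample ι α₀ (β q.1) q.2 := by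
    refine measurable_pi_lambda _ fun i => ?_
    simp only [sample, hinner]
    have h1 : Measurable fun q : V × (Fin n → Lp ℝ 2 τ × ℝ) => (q.2 i).1 :=
      measurable_fst.comp ((measurable_pi_apply i).comp measurable_snd)
    have h2 : Measurable fun q : V × (Fin n → Lp ℝ 2 τ × ℝ) => (q.2 i).2 :=
      measurable_snd.comp ((measurable_pi_apply i).comp measurable_snd)
    refine h1.prodMk ((Measurable.const_add ?_ α₀).add h2)
    refine Finset.measurable_sum _ fun k _ => ?_
    exact ((measurable_pi_apply k).comp measurable_fst).mul
      ((measurable_inner_left (D.ω k)).comp h1)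
  have hcm : ∀ k, Measurable fun q : V × (Fin n → Lp ℝ 2 τ × ℝ) => c q.1 q.2 k := fun k =>
    (Design.continuous_coef _).measurable.comp (hb.comp hsm)
  -- An error above δ in a single coordinate already makes the loss exceed t, because the factor 1 +
  -- γ^(-a) is at least 1. The maximum covers negative t.
  set δ := √(max t 0) + 1 with hδ
  have hδ0 : 0 < δ := by positivity
  let G : Set (V × (Fin n → Lp ℝ 2 τ × ℝ)) := {q | ∀ k, |c q.1 q.2 k - q.1 k| ≤ δ}
  have hGm : MeasurableSet G := by
    have : G = ⋂ k, {q | |c q.1 q.2 k - q.1 k| ≤ δ} := by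
      ext q; simp [G]
    rw [this]
    refine MeasurableSet.iInter fun k => measurableSet_le ?_ measurable_const
    exact ((hcm k).sub ((measurable_pi_apply k).comp measurable_fst)).norm
  set R := 6 * 2 ^ (n + 1 + 2) * δ with hR
  have hR0 : 0 < R := by positivity
  set X : Set V := Set.Icc 0 (fun _ => R) with hX
  -- the volume of the slices
  have hslice : ∀ z, volume (X ∩ (fun x => (x, z)) ⁻¹' G) ≤ volume X / 4 := by
    intro z
    let A : V →ₗ[ℝ] (Fin n → ℝ) :=
      { toFun := fun x i => ∑ k, x k * ⟪(z i).1, D.ω k⟫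
        map_add' := fun x y => by
          funext i
          change _ = ∑ k, x k * ⟪(z i).1, D.ω k⟫ + ∑ k, y k * ⟪(z i).1, D.ω k⟫
          rw [← Finset.sum_add_distrib]
          exact Finset.sum_congr rfl fun k _ => add_mul _ _ _
        map_smul' := fun r x => by
          funext i
          change _ = r * ∑ k, x k * ⟪(z i).1, D.ω k⟫
          rw [Finset.mul_sum]
          exact Finset.sum_congr rfl fun k _ => mul_assoc _ _ _ }
    -- There are n linear equations for n + 1 coefficients. Moving the slope in a kernel direction
    -- changes neither the data nor the estimate, so slopes on such a line that are estimated within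
    -- δ lie within 2δ < 3δ of each other.
    have hker : LinearMap.ker A ≠ ⊥ := LinearMap.ker_ne_bot_of_finrank_lt (by
      simp [V])
    obtain ⟨u₀, hu₀, hu₀0⟩ := Submodule.exists_mem_ne_zero_of_ne_bot hker
    set u := ‖u₀‖⁻¹ • u₀ with hu
    have hu1 : ‖u‖ = 1 := by
      rw [hu, norm_smul, norm_inv, norm_norm, inv_mul_cancel₀ (norm_ne_zero_iff.2 hu₀0)]
    have hAu : A u = 0 := by rw [hu, map_smul, LinearMap.mem_ker.1 hu₀, smul_zero]
    refine volume_le_of_separated hδ0 hR hu1 ?_ Set.inter_subset_left ?_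
    · exact measurableSet_Icc.inter (measurable_prodMk_right hGm)
    · rintro x ⟨-, hx⟩ y ⟨-, hy⟩ r hxy
      have hxy' : x = y + r • u := by rw [← hxy]; abel
      have h1 : sample ι α₀ (β x) z = sample ι α₀ (β y) z := by
        funext i
        have h2 : A x = A y := by rw [hxy', map_add, map_smul, hAu, smul_zero, add_zero]
        have h3 := congrFun h2 i
        change ∑ k, x k * ⟪(z i).1, D.ω k⟫ = ∑ k, y k * ⟪(z i).1, D.ω k⟫ at h3
        simp only [sample, hinner, h3]
      have h2 : c x z = c y z := by
        funext k
        simp only [c, h1]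
      have h3 : ‖x - y‖ ≤ 2 * δ := by
        rw [pi_norm_le_iff_of_nonneg (by positivity)]
        intro k
        have h4 : |c x z k - x k| ≤ δ := hx k
        have h5 : |c y z k - y k| ≤ δ := hy k
        rw [h2] at h4
        rw [Pi.sub_apply, Real.norm_eq_abs]
        have h6 : x k - y k = (c y z k - y k) - (c y z k - x k) := by ring
        rw [h6]
        exact (abs_sub _ _).trans (by linarith)
      rw [hxy, norm_smul, hu1, mul_one, Real.norm_eq_abs] at h3
      linarith
  have hXvol : volume X = ENNReal.ofReal R ^ (n + 1) := by
    have h1 : volume (Set.Icc (0 : Fin (n + 1) → ℝ) fun _ => R) = ENNReal.ofReal R ^ (n + 1) := by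
      rw [Real.volume_Icc_pi]
      simp
    exact h1
  have hX0 : volume X ≠ 0 := by
    rw [hXvol]
    exact pow_ne_zero _ (by simpa using hR0)
  have hXt : volume X ≠ ∞ := by rw [hXvol]; finiteness
  -- Fubini's theorem: if every slope in the cube were estimated within δ with probability above
  -- 1/2, then G would have at least half the volume of the cube, whereas its slices at fixed z give
  -- at most a quarter.
  obtain ⟨x, -, hx⟩ : ∃ x ∈ X, Q (Prod.mk x ⁻¹' G) ≤ 1 / 2 := by
    by_contra hcon
    push Not at hcon
    have h1 : (volume.restrict X).prod Q G ≤ volume X / 4 := by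
      rw [Measure.prod_apply_symm hGm]
      calc ∫⁻ z, volume.restrict X ((fun x => (x, z)) ⁻¹' G) ∂Q
          ≤ ∫⁻ _, volume X / 4 ∂Q := by
            refine lintegral_mono fun z => ?_
            rw [Measure.restrict_apply (measurable_prodMk_right hGm), Set.inter_comm]
            exact hslice z
        _ = volume X / 4 := by simp
    have h2 : volume X / 2 ≤ (volume.restrict X).prod Q G := by
      rw [Measure.prod_apply hGm]
      calc volume X / 2 = ∫⁻ _ in X, 1 / 2 ∂(volume : Measure V) := by
            rw [setLIntegral_const, mul_comm, ENNReal.div_eq_inv_mul, one_div, mul_comm, mul_comm]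
        _ ≤ _ := setLIntegral_mono' measurableSet_Icc fun x hx => (hcon x hx).le
    have h3 := ENNReal.toReal_mono (by finiteness) (h2.trans h1)
    rw [ENNReal.toReal_div, ENNReal.toReal_div] at h3
    have h4 := ENNReal.toReal_pos hX0 hXt
    norm_num at h3
    linarith
  refine ⟨β x, ?_⟩
  have h1 : 1 / 2 ≤ Q (Prod.mk x ⁻¹' G)ᶜ := by
    rw [prob_compl_eq_one_sub (measurable_prodMk_left hGm)]
    calc (1 / 2 : ℝ≥0∞) = 1 - 1 / 2 := by
          rw [one_div, ENNReal.one_sub_inv_two]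
      _ ≤ _ := tsub_le_tsub_left hx 1
  refine h1.trans (measure_mono fun z hz => ?_)
  change ENNReal.ofReal t < D.normSq a (b (sample ι α₀ (β x) z) - ι (β x))
  simp only [G, Set.mem_compl_iff, Set.mem_preimage, Set.mem_ofPred_eq, not_forall, not_le] at hz
  obtain ⟨k, hk⟩ := hz
  refine lt_of_lt_of_le ?_ (sum_le_normSq a _ {(k : ℕ)})
  rw [Finset.sum_singleton, Design.coef_sub, hcoefβ]
  have hg := Real.rpow_nonneg (sub_nonneg.2 ((one_le_inv₀ (hν k)).2 (hw.ν_le_one h hν k))) a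
  have h2 : max t 0 < (c x z k - x k) ^ 2 := by
    rw [← sq_abs, ← Real.sq_sqrt (le_max_right t 0)]
    refine pow_lt_pow_left₀ ?_ (Real.sqrt_nonneg _) two_ne_zero
    linarith
  have h3 : max t 0 < (1 + ((D.ν k)⁻¹ - 1) ^ a) * (c x z k - x k) ^ 2 := by
    nlinarith [sq_nonneg (c x z k - x k)]
  calc ENNReal.ofReal t ≤ ENNReal.ofReal (max t 0) := ENNReal.ofReal_le_ofReal (le_max_left _ _)
    _ < _ := (ENNReal.ofReal_lt_ofReal_iff_of_nonneg (le_max_right _ _)).2 h3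

/-- The minimax lower bound over all slopes, for a given noise law. -/
theorem lower_bound_unbounded (h : IsPenalty ι p H₀) {ρ : ℕ → ℝ} {r s M M₂ : ℝ}
    (hρ : AsympEquiv ρ fun k => ((k : ℝ) + 1) ^ (-(2 * r)))
    {D : Design ι p} (hD : D.InClass ρ s M) {noise : Measure ℝ} (hnoise : IsNoise M₂ noise)
    (a α₀ : ℝ) (t : ℕ → ℝ) :
    0 < liminf (fun n : ℕ => ⨅ b : Estimator τ n,
        ⨆ (D : Design ι p) (_ : D.InClass ρ s M) (β₀ : H),
          errProb D noise a α₀ β₀ b.1 (t n)) atTop := by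
  have := hnoise.isProb
  obtain ⟨A, k₀, hD'⟩ := id hD
  have hν := D.ν_pos hρ hD'
  obtain ⟨w, hw⟩ := D.exists_isBasis h
  have hmain : ∀ n : ℕ, (1 / 2 : ℝ≥0∞) ≤ ⨅ b : Estimator τ n,
        ⨆ (D : Design ι p) (_ : D.InClass ρ s M) (β₀ : H),
          errProb D noise a α₀ β₀ b.1 (t n) := by
    intro n
    refine le_iInf fun b => ?_
    obtain ⟨β₀, hβ₀⟩ := exists_errProb_ge_half hw h hν noise a α₀ (t n) b.2
    exact hβ₀.trans (le_iSup₂_of_le D hD (le_iSup_of_le β₀ le_rfl))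
  exact lt_of_lt_of_le (by norm_num)
    (le_liminf_of_le (by isBoundedDefault) (Eventually.of_forall hmain))

end Unbounded

end FLR


namespace FLR

/-! ### Square roots of positive operators on a real Hilbert space. -/

section SquareRoot

/-- The square root of `1 - A` for `‖A‖ ≤ 1` in a Banach algebra, in the form of the solution of
`Y = (A + Y²) / 2` obtained by iteration. -/
theorem exists_fixedPoint_half_add_sq {𝔸 : Type*} [NormedRing 𝔸] [NormedAlgebra ℝ 𝔸]
    [CompleteSpace 𝔸] {A : 𝔸} (hA : ‖A‖ ≤ 1) {s : Set 𝔸} (hs : IsClosed s) (h0 : (0 : 𝔸) ∈ s)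
    (hstep : ∀ Y ∈ s, (1 / 2 : ℝ) • (A + Y * Y) ∈ s) :
    ∃ Y ∈ s, ‖Y‖ ≤ 1 ∧ Y = (1 / 2 : ℝ) • (A + Y * Y) := by
  let Y : ℕ → 𝔸 := fun n => Nat.rec 0 (fun _ y => (1 / 2 : ℝ) • (A + y * y)) n
  -- The scalar recursion with A replaced by 1 increases within [0, 1]. Its increments dominate
  -- those of Y in norm, so Y is a Cauchy sequence.
  let y : ℕ → ℝ := fun n => Nat.rec 0 (fun _ y => (1 + y * y) / 2) n
  have hY : ∀ n, Y (n + 1) = (1 / 2 : ℝ) • (A + Y n * Y n) := fun n => rfl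
  have hy : ∀ n, y (n + 1) = (1 + y n * y n) / 2 := fun n => rfl
  have hy01 : ∀ n, 0 ≤ y n ∧ y n ≤ 1 := by
    intro n
    induction n with
    | zero => exact ⟨le_rfl, zero_le_one⟩
    | succ n ih =>
      rw [hy]
      constructor <;> nlinarith [ih.1, ih.2]
  have hYy : ∀ n, ‖Y n‖ ≤ y n := by
    intro n
    induction n with
    | zero => exact norm_zero.le
    | succ n ih =>
      rw [hY, hy, norm_smul, Real.norm_of_nonneg (by norm_num)]
      have h1 : ‖A + Y n * Y n‖ ≤ 1 + y n * y n :=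
        (norm_add_le _ _).trans (add_le_add hA ((norm_mul_le _ _).trans
          (mul_le_mul ih ih (norm_nonneg _) (hy01 n).1)))
      linarith
  have hdiff : ∀ n, ‖Y (n + 1) - Y n‖ ≤ y (n + 1) - y n := by
    intro n
    induction n with
    | zero =>
      have h1 : Y 0 = 0 := rfl
      have h2 : y 0 = 0 := rfl
      have := hYy 1
      rw [h1, h2]
      simpa using this
    | succ n ih =>
      have h1 : Y (n + 1 + 1) - Y (n + 1)
          = (1 / 2 : ℝ) • (Y (n + 1) * (Y (n + 1) - Y n) + (Y (n + 1) - Y n) * Y n) := by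
        rw [hY (n + 1), hY n, ← smul_sub, ← hY n]
        congr 1
        noncomm_ring
      rw [h1, norm_smul, Real.norm_of_nonneg (by norm_num), hy (n + 1)]
      have h2 : ‖Y (n + 1) * (Y (n + 1) - Y n) + (Y (n + 1) - Y n) * Y n‖
          ≤ y (n + 1) * (y (n + 1) - y n) + (y (n + 1) - y n) * y n := by
        refine (norm_add_le _ _).trans (add_le_add ?_ ?_)
        · exact (norm_mul_le _ _).trans (mul_le_mul (hYy (n + 1)) ih (norm_nonneg _) (hy01 (n + 1)).1)
        · exact (norm_mul_le _ _).trans (mul_le_mul ih (hYy n) (norm_nonneg _)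
            ((norm_nonneg _).trans ih))
      have h3 := hy n
      nlinarith
  have hsum : Summable fun n => y (n + 1) - y n := by
    refine summable_of_sum_range_le (c := 1) (fun n => (norm_nonneg _).trans (hdiff n)) fun n => ?_
    rw [Finset.sum_range_sub]
    have h2 : y 0 = 0 := rfl
    rw [h2, sub_zero]
    exact (hy01 n).2
  have hcau : CauchySeq Y := cauchySeq_of_dist_le_of_summable _ (fun n => by
    rw [dist_comm, dist_eq_norm]; exact hdiff n) hsum
  obtain ⟨Z, hZ⟩ := cauchySeq_tendsto_of_complete hcau
  have hmem : ∀ n, Y n ∈ s := by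
    intro n
    induction n with
    | zero => exact h0
    | succ n ih => exact hstep _ ih
  refine ⟨Z, hs.mem_of_tendsto hZ (Eventually.of_forall hmem), ?_, ?_⟩
  · exact le_of_tendsto' hZ.norm fun n => (hYy n).trans (hy01 n).2
  · have h1 : Tendsto (fun n => Y (n + 1)) atTop (𝓝 Z) := hZ.comp (tendsto_add_atTop_nat 1)
    have h2 : Tendsto (fun n => (1 / 2 : ℝ) • (A + Y n * Y n)) atTop
        (𝓝 ((1 / 2 : ℝ) • (A + Z * Z))) := ((hZ.mul hZ).const_add A).const_smul _
    exact tendsto_nhds_unique h1 h2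

variable {E : Type*} [NormedAddCommGroup E] [InnerProductSpace ℝ E] [CompleteSpace E]

/-- Positivity at x - R x together with ⟨R R x, R x⟩ ≤ ‖R x‖² gives ‖R x‖² ≤ ⟨R x, x⟩, and the
expansion of ‖x - R x‖² is then at most ‖x‖². -/
theorem norm_one_sub_le_of_isPositive {R : E →L[ℝ] E} (hR : R.IsPositive) (hR1 : ‖R‖ ≤ 1) :
    ‖(1 : E →L[ℝ] E) - R‖ ≤ 1 := by
  have hsymm : ∀ x y, ⟪R x, y⟫ = ⟪x, R y⟫ := hR.isSymmetric
  have hpos : ∀ x, 0 ≤ ⟪R x, x⟫ := fun x => by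
    have := hR.inner_nonneg_left x
    simpa using this
  refine ContinuousLinearMap.opNorm_le_bound _ zero_le_one fun x => ?_
  rw [one_mul]
  have h1 : ⟪R (R x), R x⟫ ≤ ‖R x‖ ^ 2 := by
    refine (real_inner_le_norm _ _).trans ?_
    have h2 : ‖R (R x)‖ ≤ 1 * ‖R x‖ := R.le_of_opNorm_le hR1 _
    nlinarith [norm_nonneg (R x)]
  have h2 := hpos (x - R x)
  simp only [map_sub, inner_sub_left, inner_sub_right] at h2
  have h3 : ⟪R (R x), x⟫ = ‖R x‖ ^ 2 := by
    rw [hsymm, real_inner_self_eq_norm_sq]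
  have h4 : ⟪R x, R x⟫ = ‖R x‖ ^ 2 := real_inner_self_eq_norm_sq _
  rw [h3, h4] at h2
  change ‖x - R x‖ ≤ ‖x‖
  refine le_of_sq_le_sq ?_ (norm_nonneg _)
  rw [norm_sub_sq_real, real_inner_comm]
  linarith [sq_nonneg ‖R x‖]

theorem isPositive_one_sub {Y : E →L[ℝ] E} (hY : IsSelfAdjoint Y) (hY1 : ‖Y‖ ≤ 1) :
    ((1 : E →L[ℝ] E) - Y).IsPositive := by
  rw [ContinuousLinearMap.isPositive_iff]
  have h0 : IsSelfAdjoint ((1 : E →L[ℝ] E) - Y) := (IsSelfAdjoint.one _).sub hY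
  refine ⟨h0.isSymmetric, fun x => ?_⟩
  change 0 ≤ ⟪x - Y x, x⟫
  rw [inner_sub_left, real_inner_self_eq_norm_sq]
  have h1 := real_inner_le_norm (Y x) x
  have h2 : ‖Y x‖ ≤ 1 * ‖x‖ := Y.le_of_opNorm_le hY1 _
  nlinarith [norm_nonneg x]

/-- The fixed point Y for A = 1 - R satisfies (1 - Y)² = 1 - 2Y + Y² = R. Self-adjointness is a
closed condition kept by the iteration, and ‖Y‖ ≤ 1 makes 1 - Y positive. -/
theorem exists_isPositive_sqrt_of_norm_le {R : E →L[ℝ] E} (hR : R.IsPositive) (hR1 : ‖R‖ ≤ 1) :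
    ∃ S : E →L[ℝ] E, S.IsPositive ∧ S * S = R := by
  have hsa : IsSelfAdjoint ((1 : E →L[ℝ] E) - R) := (IsSelfAdjoint.one _).sub hR.isSelfAdjoint
  have hclosed : IsClosed {Y : E →L[ℝ] E | IsSelfAdjoint Y} :=
    isClosed_eq continuous_star continuous_id
  obtain ⟨Y, hYs, hY1, hY⟩ := exists_fixedPoint_half_add_sq
    (norm_one_sub_le_of_isPositive hR hR1) hclosed (IsSelfAdjoint.zero _) (fun Y hY => by
      have hY' : IsSelfAdjoint Y := hY
      have h1 : IsSelfAdjoint (Y * Y) := by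
        rw [IsSelfAdjoint, star_mul, hY'.star_eq]
      exact IsSelfAdjoint.smul (IsSelfAdjoint.all _) (hsa.add h1))
  refine ⟨1 - Y, isPositive_one_sub hYs hY1, ?_⟩
  have h1 : (2 : ℝ) • Y = (1 - R) + Y * Y := by
    have h2 := congrArg (fun Z => (2 : ℝ) • Z) hY
    simp only [smul_smul] at h2
    rw [h2]
    norm_num
  have h2 : ((1 : E →L[ℝ] E) - Y) * (1 - Y) = 1 - (2 : ℝ) • Y + Y * Y := by
    rw [two_smul]; noncomm_ring
  rw [h2, h1]
  abel

theorem exists_isPositive_sqrt {R : E →L[ℝ] E} (hR : R.IsPositive) :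
    ∃ S : E →L[ℝ] E, S.IsPositive ∧ S ∘L S = R := by
  have hc0 : 0 < ‖R‖ + 1 := by positivity
  obtain ⟨S, hS, hSS⟩ := exists_isPositive_sqrt_of_norm_le
    (R := (‖R‖ + 1)⁻¹ • R) (hR.smul_of_nonneg (inv_nonneg.2 hc0.le)) (by
      rw [norm_smul, Real.norm_of_nonneg (inv_nonneg.2 hc0.le), inv_mul_le_iff₀ hc0]
      linarith)
  refine ⟨√(‖R‖ + 1) • S, hS.smul_of_nonneg (Real.sqrt_nonneg _), ?_⟩
  rw [← ContinuousLinearMap.mul_def, smul_mul_smul_comm, Real.mul_self_sqrt hc0.le, hSS, smul_smul,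
    mul_inv_cancel₀ hc0.ne', one_smul]

end SquareRoot

end FLR


namespace FLR

/-! ### Moments of sums of random signs. -/

section Signs

variable {Ω : Type*} [MeasurableSpace Ω]

/-- A sequence of random signs whose joint law is invariant under the change of any one sign. -/
structure IsSignSequence (P : Measure Ω) (ε : ℕ → Ω → ℝ) : Prop where
  measurable : ∀ k, Measurable (ε k)
  sq : ∀ k ω, ε k ω ^ 2 = 1
  flip : ∀ k, ∃ f : Ω → Ω, MeasurePreserving f P P ∧ (∀ ω, ε k (f ω) = -ε k ω) ∧
    ∀ j, j ≠ k → ∀ ω, ε j (f ω) = ε j ω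

/-- Fair coin tosses: exchanging the two outcomes in one coordinate preserves the product measure.
This symmetry is all that the moment computations need. -/
theorem exists_isSignSequence :
    ∃ (P : Measure (ℕ → Bool)) (ε : ℕ → (ℕ → Bool) → ℝ),
      IsProbabilityMeasure P ∧ IsSignSequence P ε := by
  let P₁ : Measure Bool := (2⁻¹ : ℝ≥0∞) • (Measure.dirac true + Measure.dirac false)
  have hP₁ : IsProbabilityMeasure P₁ := ⟨by
    simp only [P₁, Measure.smul_apply, Measure.add_apply, measure_univ, smul_eq_mul]
    rw [one_add_one_eq_two]
    exact ENNReal.inv_mul_cancel (by norm_num) (by norm_num)⟩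
  have hnot : P₁.map not = P₁ := by
    have hm : Measurable not := measurable_of_finite not
    simp only [P₁, Measure.map_smul, Measure.map_add _ _ hm, Measure.map_dirac' hm, Bool.not_true,
      Bool.not_false]
    rw [add_comm]
  refine ⟨Measure.infinitePi fun _ => P₁, fun k ω => if ω k then 1 else -1, inferInstance,
    fun k => ?_, fun k ω => ?_, fun k => ?_⟩
  · exact (measurable_of_finite fun b : Bool => if b then (1 : ℝ) else -1).comp
      (measurable_pi_apply k)
  · split_ifs <;> norm_num
  · let f : ℕ → Bool → Bool := fun j => if j = k then not else id
    have hf : ∀ j, Measurable (f j) := fun j => measurable_of_finite _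
    refine ⟨fun ω j => f j (ω j), ⟨by fun_prop, ?_⟩, fun ω => ?_, fun j hj ω => ?_⟩
    · rw [Measure.infinitePi_map_pi _ hf]
      congr 1
      funext j
      by_cases hj : j = k
      · simp only [f, if_pos hj, hnot]
      · simp only [f, if_neg hj, Measure.map_id]
    · cases h : ω k <;> simp [f, h]
    · simp [f, hj]

variable {P : Measure Ω} {ε : ℕ → Ω → ℝ} [IsProbabilityMeasure P]

theorem integral_eq_zero_of_comp_eq_neg {f : Ω → Ω} (hf : MeasurePreserving f P P) {g : Ω → ℝ}
    (hg : Measurable g) (h : ∀ ω, g (f ω) = -g ω) : ∫ ω, g ω ∂P = 0 := by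
  have h1 : ∫ ω, g ω ∂P = ∫ ω, g (f ω) ∂P := by
    conv_lhs => rw [← hf.map_eq]
    exact integral_map hf.measurable.aemeasurable hg.aestronglyMeasurable
  simp only [h, integral_neg] at h1
  linarith

theorem integral_add_four {f₁ f₂ f₃ f₄ : Ω → ℝ} (h₁ : Integrable f₁ P) (h₂ : Integrable f₂ P)
    (h₃ : Integrable f₃ P) (h₄ : Integrable f₄ P) :
    ∫ ω, f₁ ω + f₂ ω + f₃ ω + f₄ ω ∂P
      = ∫ ω, f₁ ω ∂P + ∫ ω, f₂ ω ∂P + ∫ ω, f₃ ω ∂P + ∫ ω, f₄ ω ∂P := by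
  have h₁₂ : Integrable (fun ω => f₁ ω + f₂ ω) P := h₁.add h₂
  have h₁₂₃ : Integrable (fun ω => f₁ ω + f₂ ω + f₃ ω) P := h₁₂.add h₃
  rw [integral_add h₁₂₃ h₄, integral_add h₁₂ h₃, integral_add h₁ h₂]

namespace IsSignSequence

variable (hε : IsSignSequence P ε)
include hε

theorem measurable_sum (x : ℕ → ℝ) (n : ℕ) :
    Measurable fun ω => ∑ k ∈ Finset.range n, x k * ε k ω :=
  Finset.measurable_sum _ fun k _ => (hε.measurable k).const_mul _

theorem abs_eq_one (k : ℕ) (ω : Ω) : |ε k ω| = 1 := by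
  have := hε.sq k ω
  rw [← sq_abs] at this
  exact (pow_eq_one_iff_of_nonneg (abs_nonneg _) two_ne_zero).1 this

theorem abs_sum_le (x : ℕ → ℝ) (n : ℕ) (ω : Ω) :
    |∑ k ∈ Finset.range n, x k * ε k ω| ≤ ∑ k ∈ Finset.range n, |x k| := by
  refine (Finset.abs_sum_le_sum_abs _ _).trans (le_of_eq ?_)
  simp [abs_mul, hε.abs_eq_one]

/-- Any monomial in two partial sums and one sign is integrable. -/
theorem integrable_monomial (x y : ℕ → ℝ) (n i j l : ℕ) :
    Integrable (fun ω => (∑ k ∈ Finset.range n, x k * ε k ω) ^ i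
      * (∑ k ∈ Finset.range n, y k * ε k ω) ^ j * ε n ω ^ l) P := by
  refine Integrable.of_bound (C := (∑ k ∈ Finset.range n, |x k|) ^ i
    * (∑ k ∈ Finset.range n, |y k|) ^ j) ?_ (Eventually.of_forall fun ω => ?_)
  · exact ((((hε.measurable_sum x n).pow_const i).mul ((hε.measurable_sum y n).pow_const j)).mul
      ((hε.measurable n).pow_const l)).aestronglyMeasurable
  · rw [Real.norm_eq_abs, abs_mul, abs_mul, abs_pow, abs_pow, abs_pow, hε.abs_eq_one, one_pow,
      mul_one]
    gcongr
    · exact hε.abs_sum_le x n ω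
    · exact hε.abs_sum_le y n ω

/-- Monomials which are odd in the last sign have mean zero. -/
theorem integral_monomial_mul_sign (x y : ℕ → ℝ) (n i j : ℕ) :
    ∫ ω, (∑ k ∈ Finset.range n, x k * ε k ω) ^ i
      * (∑ k ∈ Finset.range n, y k * ε k ω) ^ j * ε n ω ∂P = 0 := by
  obtain ⟨f, hf, hf1, hf2⟩ := hε.flip n
  refine integral_eq_zero_of_comp_eq_neg hf ?_ fun ω => ?_
  · exact (((hε.measurable_sum x n).pow_const i).mul ((hε.measurable_sum y n).pow_const j)).mul
      (hε.measurable n)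
  · have h1 : ∀ x : ℕ → ℝ, ∑ k ∈ Finset.range n, x k * ε k (f ω)
        = ∑ k ∈ Finset.range n, x k * ε k ω := fun x =>
      Finset.sum_congr rfl fun k hk => by rw [hf2 k (Finset.mem_range.1 hk).ne]
    rw [h1, h1, hf1]
    ring

theorem integral_sum (x : ℕ → ℝ) (n : ℕ) :
    ∫ ω, ∑ k ∈ Finset.range n, x k * ε k ω ∂P = 0 := by
  have hint : ∀ k, Integrable (ε k) P := fun k => by
    simpa using hε.integrable_monomial 0 0 k 0 0 1
  rw [integral_finsetSum _ fun k _ => (hint k).const_mul _]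
  refine Finset.sum_eq_zero fun k _ => ?_
  rw [integral_const_mul]
  have := hε.integral_monomial_mul_sign 0 0 k 0 0
  simp only [pow_zero, one_mul] at this
  rw [this, mul_zero]

theorem integral_sum_mul_sum (x y : ℕ → ℝ) (n : ℕ) :
    ∫ ω, (∑ k ∈ Finset.range n, x k * ε k ω) * (∑ k ∈ Finset.range n, y k * ε k ω) ∂P
      = ∑ k ∈ Finset.range n, x k * y k := by
  induction n with
  | zero => simp
  | succ n ih =>
    have h1 := hε.integrable_monomial x y n 1 1 0
    have h2 := hε.integrable_monomial x y n 1 0 1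
    have h3 := hε.integrable_monomial x y n 0 1 1
    have h4 := hε.integral_monomial_mul_sign x y n 1 0
    have h5 := hε.integral_monomial_mul_sign x y n 0 1
    simp only [pow_zero, pow_one, mul_one, one_mul] at h1 h2 h3 h4 h5
    have h6 : ∀ ω, (∑ k ∈ Finset.range (n + 1), x k * ε k ω)
          * (∑ k ∈ Finset.range (n + 1), y k * ε k ω)
        = (∑ k ∈ Finset.range n, x k * ε k ω) * (∑ k ∈ Finset.range n, y k * ε k ω)
          + y n * ((∑ k ∈ Finset.range n, x k * ε k ω) * ε n ω)
          + x n * ((∑ k ∈ Finset.range n, y k * ε k ω) * ε n ω) + x n * y n := fun ω => by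
      rw [Finset.sum_range_succ, Finset.sum_range_succ]
      linear_combination x n * y n * hε.sq n ω
    simp only [h6]
    rw [integral_add_four h1 (h2.const_mul _) (h3.const_mul _) (integrable_const _),
      integral_const_mul, integral_const_mul, h4, h5, ih, Finset.sum_range_succ]
    simp

/-- By induction: terms odd in the new sign vanish, so with σ² the previous variance the bound
becomes 3σ⁴ + 6σ²x² + x⁴ ≤ 3(σ² + x²)². -/
theorem integral_sum_pow_four_le (x : ℕ → ℝ) (n : ℕ) :
    ∫ ω, (∑ k ∈ Finset.range n, x k * ε k ω) ^ 4 ∂P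
      ≤ 3 * (∑ k ∈ Finset.range n, x k ^ 2) ^ 2 := by
  induction n with
  | zero => simp
  | succ n ih =>
    have h1 := hε.integrable_monomial x 0 n 4 0 0
    have h2 := hε.integrable_monomial x 0 n 3 0 1
    have h3 := hε.integrable_monomial x 0 n 2 0 0
    have h4 := hε.integrable_monomial x 0 n 1 0 1
    have h5 := hε.integral_monomial_mul_sign x 0 n 3 0
    have h6 := hε.integral_monomial_mul_sign x 0 n 1 0
    simp only [pow_zero, mul_one, pow_one] at h1 h2 h3 h4 h5 h6
    have h7 := hε.integral_sum_mul_sum x x n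
    rw [show (fun ω => (∑ k ∈ Finset.range n, x k * ε k ω) * (∑ k ∈ Finset.range n, x k * ε k ω))
        = fun ω => (∑ k ∈ Finset.range n, x k * ε k ω) ^ 2 from funext fun ω => (pow_two _).symm,
      Finset.sum_congr rfl fun k _ => (pow_two (x k)).symm] at h7
    have h8 : ∀ ω, (∑ k ∈ Finset.range (n + 1), x k * ε k ω) ^ 4
        = (∑ k ∈ Finset.range n, x k * ε k ω) ^ 4
          + 4 * x n * ((∑ k ∈ Finset.range n, x k * ε k ω) ^ 3 * ε n ω)
          + 6 * x n ^ 2 * (∑ k ∈ Finset.range n, x k * ε k ω) ^ 2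
          + 4 * x n ^ 3 * ((∑ k ∈ Finset.range n, x k * ε k ω) * ε n ω) + x n ^ 4 := fun ω => by
      rw [Finset.sum_range_succ]
      set S := ∑ k ∈ Finset.range n, x k * ε k ω
      linear_combination (6 * S ^ 2 * x n ^ 2 + 4 * S * x n ^ 3 * ε n ω
        + x n ^ 4 * (ε n ω ^ 2 + 1)) * hε.sq n ω
    simp only [h8]
    have h9 : Integrable (fun ω => (∑ k ∈ Finset.range n, x k * ε k ω) ^ 4
        + 4 * x n * ((∑ k ∈ Finset.range n, x k * ε k ω) ^ 3 * ε n ω)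
        + 6 * x n ^ 2 * (∑ k ∈ Finset.range n, x k * ε k ω) ^ 2
        + 4 * x n ^ 3 * ((∑ k ∈ Finset.range n, x k * ε k ω) * ε n ω)) P :=
      ((h1.add (h2.const_mul _)).add (h3.const_mul _)).add (h4.const_mul _)
    rw [integral_add h9 (integrable_const _),
      integral_add_four h1 (h2.const_mul _) (h3.const_mul _) (h4.const_mul _), integral_const_mul, integral_const_mul,
      integral_const_mul, h5, h6, h7, Finset.sum_range_succ]
    simp only [integral_const, probReal_univ, one_smul]
    nlinarith [sq_nonneg (x n), sq_nonneg (x n ^ 2)]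

end IsSignSequence

end Signs

/-! ### Random series and operators with prescribed eigenvectors. -/

section Series

variable {E : Type*} [NormedAddCommGroup E] [InnerProductSpace ℝ E] [CompleteSpace E]

theorem norm_sq_sum_smul_of_orthonormal {e : ℕ → E} (he : Orthonormal ℝ e) (x : ℕ → ℝ)
    (s : Finset ℕ) : ‖∑ k ∈ s, x k • e k‖ ^ 2 = ∑ k ∈ s, x k ^ 2 := by
  rw [← real_inner_self_eq_norm_sq, he.inner_sum]
  exact Finset.sum_congr rfl fun k _ => by simp [sq]

theorem summable_smul_of_orthonormal {e : ℕ → E} (he : Orthonormal ℝ e) {x : ℕ → ℝ}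
    (hx : Summable fun k => x k ^ 2) : Summable fun k => x k • e k := by
  have h1 := (he.orthogonalFamily.summable_iff_norm_sq_summable x).2 (by simpa using hx)
  simpa using h1

variable [MeasurableSpace E] [BorelSpace E] [SecondCountableTopology E]

/-- The law of the random series `∑ √m_k ε_k e_k` with independent random signs `ε_k`. -/
theorem exists_law_of_orthonormal {e : ℕ → E} (he : Orthonormal ℝ e) {m : ℕ → ℝ}
    (hm0 : ∀ k, 0 ≤ m k) (hm : Summable m) :
    ∃ Q : Measure E, IsProbabilityMeasure Q ∧ MemLp id 2 Q ∧ ∫ x, x ∂Q = 0 ∧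
      (∀ f g, HasSum (fun k => m k * (⟪e k, f⟫ * ⟪e k, g⟫)) (∫ x, ⟪f, x⟫ * ⟪g, x⟫ ∂Q)) ∧
      (∀ f, Integrable (fun x => ⟪f, x⟫ ^ 4) Q) ∧
      ∀ f, ∫ x, ⟪f, x⟫ ^ 4 ∂Q ≤ 3 * (∫ x, ⟪f, x⟫ ^ 2 ∂Q) ^ 2 := by
  obtain ⟨P, ε, hP, hε⟩ := exists_isSignSequence
  have hsq : ∀ k ω, (√(m k) * ε k ω) ^ 2 = m k := fun k ω => by
    rw [mul_pow, hε.sq, mul_one, Real.sq_sqrt (hm0 k)]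
  set S : ℕ → (ℕ → Bool) → E := fun n ω => ∑ k ∈ Finset.range n, (√(m k) * ε k ω) • e k with hS
  set X : (ℕ → Bool) → E := fun ω => ∑' k, (√(m k) * ε k ω) • e k with hX
  -- The squared coefficients sum to ∑ m_k whatever the signs. The series therefore converges for
  -- every ω with norm at most r, and dominated convergence carries the moments of the partial sums
  -- to the limit.
  set r := √(∑' k, m k) with hr
  have hlim : ∀ ω, Tendsto (fun n => S n ω) atTop (𝓝 (X ω)) := fun ω =>
    (summable_smul_of_orthonormal he (by simpa only [hsq] using hm)).hasSum.tendsto_sum_nat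
  have hSr : ∀ n ω, ‖S n ω‖ ≤ r := fun n ω => by
    refine Real.le_sqrt_of_sq_le ?_
    rw [hS, norm_sq_sum_smul_of_orthonormal he]
    simp only [hsq]
    exact hm.sum_le_tsum _ fun k _ => hm0 k
  have hXr : ∀ ω, ‖X ω‖ ≤ r := fun ω => le_of_tendsto' (hlim ω).norm fun n => hSr n ω
  have hSm : ∀ n, Measurable (S n) := fun n =>
    Finset.measurable_sum _ fun k _ => ((hε.measurable k).const_mul _).smul_const _
  have hXm : Measurable X := measurable_of_tendsto_metrizable hSm (tendsto_pi_nhds.2 hlim)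
  have hinner : ∀ f n ω, ⟪f, S n ω⟫ = ∑ k ∈ Finset.range n, (√(m k) * ⟪e k, f⟫) * ε k ω := by
    intro f n ω
    rw [hS, inner_sum]
    refine Finset.sum_congr rfl fun k _ => ?_
    rw [inner_smul_right, real_inner_comm]
    ring
  have hbd : ∀ f n ω, |⟪f, S n ω⟫| ≤ ‖f‖ * r := fun f n ω =>
    (abs_real_inner_le_norm _ _).trans (by gcongr; exact hSr n ω)
  have hbX : ∀ f ω, |⟪f, X ω⟫| ≤ ‖f‖ * r := fun f ω =>
    (abs_real_inner_le_norm _ _).trans (by gcongr; exact hXr ω)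
  have hmi : ∀ f, Measurable fun x : E => ⟪f, x⟫ := fun f =>
    (continuous_const.inner continuous_id).measurable
  -- passage to the limit in bilinear expressions of degree `i`
  have hconv : ∀ (f g : E) (i j : ℕ),
      Tendsto (fun n => ∫ ω, ⟪f, S n ω⟫ ^ i * ⟪g, S n ω⟫ ^ j ∂P) atTop
        (𝓝 (∫ ω, ⟪f, X ω⟫ ^ i * ⟪g, X ω⟫ ^ j ∂P)) := by
    intro f g i j
    refine tendsto_integral_of_dominated_convergence
      (fun _ => (‖f‖ * r) ^ i * (‖g‖ * r) ^ j) (fun n => ?_) (integrable_const _)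
      (fun n => Eventually.of_forall fun ω => ?_) (Eventually.of_forall fun ω => ?_)
    · exact ((((hmi f).comp (hSm n)).pow_const i).mul
        (((hmi g).comp (hSm n)).pow_const j)).aestronglyMeasurable
    · rw [Real.norm_eq_abs, abs_mul, abs_pow, abs_pow]
      gcongr
      · exact hbd f n ω
      · exact hbd g n ω
    · exact ((tendsto_const_nhds.inner (hlim ω)).pow i).mul
        ((tendsto_const_nhds.inner (hlim ω)).pow j)
  have hQ : ∀ φ : E → ℝ, Measurable φ → ∫ x, φ x ∂(P.map X) = ∫ ω, φ (X ω) ∂P :=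
    fun φ hφ => integral_map hXm.aemeasurable hφ.aestronglyMeasurable
  have hprob : IsProbabilityMeasure (P.map X) := Measure.isProbabilityMeasure_map hXm.aemeasurable
  have hbdQ : ∀ᵐ x ∂(P.map X), ‖x‖ ≤ r := by
    rw [ae_map_iff hXm.aemeasurable (measurableSet_le measurable_norm measurable_const)]
    exact Eventually.of_forall hXr
  have hmem : MemLp id 2 (P.map X) :=
    MemLp.of_bound aestronglyMeasurable_id r hbdQ
  have hsecond : ∀ f g, HasSum (fun k => m k * (⟪e k, f⟫ * ⟪e k, g⟫))
      (∫ x, ⟪f, x⟫ * ⟪g, x⟫ ∂(P.map X)) := by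
    intro f g
    have h1 : Tendsto (fun n => ∑ k ∈ Finset.range n, m k * (⟪e k, f⟫ * ⟪e k, g⟫)) atTop
        (𝓝 (∫ x, ⟪f, x⟫ * ⟪g, x⟫ ∂(P.map X))) := by
      rw [hQ (fun x => ⟪f, x⟫ * ⟪g, x⟫) ((hmi f).mul (hmi g))]
      have h2 := hconv f g 1 1
      simp only [pow_one, hinner, hε.integral_sum_mul_sum] at h2
      refine h2.congr fun n => Finset.sum_congr rfl fun k _ => ?_
      have := Real.mul_self_sqrt (hm0 k)
      linear_combination (⟪e k, f⟫ * ⟪e k, g⟫) * this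
    have h3 : Summable fun k => m k * (⟪e k, f⟫ * ⟪e k, g⟫) := by
      refine Summable.of_norm_bounded (hm.mul_right (‖f‖ * ‖g‖)) fun k => ?_
      rw [norm_mul, norm_mul, Real.norm_of_nonneg (hm0 k)]
      have h4 : ∀ f, ‖⟪e k, f⟫‖ ≤ ‖f‖ := fun f => by
        have := norm_inner_le_norm (𝕜 := ℝ) (e k) f
        rwa [he.1 k, one_mul] at this
      exact mul_le_mul_of_nonneg_left (mul_le_mul (h4 f) (h4 g) (norm_nonneg _) (norm_nonneg _))
        (hm0 k)
    rw [tendsto_nhds_unique h1 h3.hasSum.tendsto_sum_nat]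
    exact h3.hasSum
  refine ⟨P.map X, hprob, hmem, ?_, hsecond, fun f => ?_, fun f => ?_⟩
  · have hint : Integrable (fun x : E => x) (P.map X) := hmem.integrable (by norm_num)
    refine ext_inner_left ℝ fun f => ?_
    rw [inner_zero_right, ← integral_inner hint, hQ _ (hmi f)]
    have h2 := hconv f f 1 0
    simp only [pow_one, pow_zero, mul_one, hinner, hε.integral_sum] at h2
    exact (tendsto_nhds_unique h2 tendsto_const_nhds)
  · refine Integrable.of_bound (C := (‖f‖ * r) ^ 4)
      ((hmi f).pow_const 4).aestronglyMeasurable ?_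
    filter_upwards [hbdQ] with x hx
    rw [Real.norm_eq_abs, abs_pow]
    gcongr
    exact (abs_real_inner_le_norm _ _).trans (by gcongr)
  · have h1 := hconv f f 4 0
    have h2 := hconv f f 2 0
    simp only [pow_zero, mul_one] at h1 h2
    rw [hQ (fun x => ⟪f, x⟫ ^ 4) ((hmi f).pow_const 4),
      hQ (fun x => ⟪f, x⟫ ^ 2) ((hmi f).pow_const 2)]
    refine le_of_tendsto_of_tendsto' h1 ((h2.pow 2).const_mul 3) fun n => ?_
    simp only [hinner]
    refine (hε.integral_sum_pow_four_le _ n).trans (le_of_eq ?_)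
    have h3 := hε.integral_sum_mul_sum (fun k => √(m k) * ⟪e k, f⟫) (fun k => √(m k) * ⟪e k, f⟫) n
    rw [Finset.sum_congr rfl fun k _ => (sq (√(m k) * ⟪e k, f⟫)).symm] at h3
    rw [← h3]
    simp only [← sq]

/-- The operator with eigenvectors `e_k` and eigenvalues `m_k`. -/
theorem exists_operator_of_orthonormal {e : ℕ → E} (he : Orthonormal ℝ e) {m : ℕ → ℝ}
    (hm0 : ∀ k, 0 ≤ m k) (hm : Summable m) :
    ∃ C : E →L[ℝ] E, (∀ f g, HasSum (fun k => m k * (⟪e k, f⟫ * ⟪e k, g⟫)) ⟪C f, g⟫) ∧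
      ∀ f, HasSum (fun k => (m k * ⟪e k, f⟫) • e k) (C f) := by
  have h1 : Summable fun k => m k • InnerProductSpace.rankOne ℝ (e k) (e k) := by
    refine Summable.of_norm_bounded hm fun k => ?_
    rw [norm_smul, InnerProductSpace.norm_rankOne, he.1 k, Real.norm_of_nonneg (hm0 k)]
    simp
  have h2 : ∀ f, HasSum (fun k => (m k * ⟪e k, f⟫) • e k)
      ((∑' k, m k • InnerProductSpace.rankOne ℝ (e k) (e k)) f) := fun f => by
    have := (ContinuousLinearMap.apply ℝ E f).hasSum h1.hasSum
    simpa [smul_smul] using this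
  refine ⟨∑' k, m k • InnerProductSpace.rankOne ℝ (e k) (e k), fun f g => ?_, h2⟩
  have h3 := (innerSL ℝ g).hasSum (h2 f)
  rw [real_inner_comm]
  have h4 : (fun k => m k * (⟪e k, f⟫ * ⟪e k, g⟫))
      = fun k => innerSL ℝ g ((m k * ⟪e k, f⟫) • e k) := funext fun k => by
    change _ = ⟪g, (m k * ⟪e k, f⟫) • e k⟫
    rw [inner_smul_right, real_inner_comm g]
    ring
  rw [h4]
  exact h3

end Series

end FLR


namespace FLR

/-! ### Designs with prescribed eigenvalues. -/

section DesignOfBasis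

variable {T H : Type*} [MeasurableSpace T] {τ : Measure T}
  [NormedAddCommGroup H] [InnerProductSpace ℝ H] [CompleteSpace H] [RKHS ℝ H T ℝ]
  {ι : H →ₗ[ℝ] Lp ℝ 2 τ} {p : Seminorm ℝ H} {H₀ : Submodule ℝ H} [FiniteDimensional ℝ H₀]

/-- Existence of the reproducing kernel of `rInner` and of its integral operator. -/
theorem IsPenalty.exists_kernel_operator (h : IsPenalty ι p H₀)
    {C : Lp ℝ 2 τ →L[ℝ] Lp ℝ 2 τ} (hsymm : ∀ f g, ⟪C f, g⟫ = ⟪C g, f⟫)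
    (hpos : ∀ f, 0 ≤ ⟪C f, f⟫) (hnd : ∀ f : H, p f = 0 → f ≠ 0 → C (ι f) ≠ 0) :
    ∃ (κ : T → T → ℝ) (R : Lp ℝ 2 τ →L[ℝ] Lp ℝ 2 τ),
      IsReproducingKernel (Set.univ : Set H) (rInner ι p C) κ ∧ IsIntegralOperator κ R ∧
      R.IsPositive ∧ ∀ (u : Lp ℝ 2 τ) (v : H), (∀ f, rInner ι p C f v = ⟪ι f, u⟫) → R u = ι v := by
  obtain ⟨J, hJ⟩ := h.exists_rieszMap hsymm hpos hnd
  let L : H →L[ℝ] Lp ℝ 2 τ := ⟨ι, inclusion_continuous h.incl⟩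
  let R : Lp ℝ 2 τ →L[ℝ] Lp ℝ 2 τ := L ∘L J ∘L L.adjoint
  have hrep : ∀ (u : Lp ℝ 2 τ) (f : H), rInner ι p C f (J (L.adjoint u)) = ⟪ι f, u⟫ := fun u f => by
    rw [hJ, ContinuousLinearMap.adjoint_inner_right]
    rfl
  have hRin : ∀ u v, ⟪R u, v⟫ = rInner ι p C (J (L.adjoint u)) (J (L.adjoint v)) := fun u v =>
    (hrep v _).symm
  have hg : ∀ t : T, ∃ g : H, ∀ f : H, rInner ι p C f g = f t := fun t => by
    let ℓ : H →L[ℝ] ℝ :=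
      ⟨⟨⟨fun f => f t, fun f g => by simp⟩, fun c f => by simp⟩, RKHS.continuous_eval t⟩
    exact h.exists_representer hsymm hpos hnd ℓ
  choose g hg using hg
  have hκ : IsReproducingKernel (Set.univ : Set H) (rInner ι p C) fun s t => g t s :=
    fun t => ⟨g t, Set.mem_univ _, fun _ => rfl, fun f _ => hg t f⟩
  have hR : IsIntegralOperator (fun s t => g t s) R := fun u =>
    h.integralOperator_eq hsymm hκ (hrep u)
  refine ⟨fun s t => g t s, R, hκ, hR, ?_, fun u v hv => Lp.ext ?_⟩
  · rw [ContinuousLinearMap.isPositive_iff]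
    refine ⟨fun u v => ?_, fun u => ?_⟩
    · change ⟪R u, v⟫ = ⟪u, R v⟫
      rw [real_inner_comm (R v), hRin, hRin, rInner_comm_of h hsymm]
    · rw [hRin, h.rInner_eq hsymm]
      exact add_nonneg (hpos _) real_inner_self_nonneg
  · filter_upwards [hR u, h.integralOperator_eq hsymm hκ hv] with t h1 h2
    rw [h1, h2]

variable [SecondCountableTopology (Lp ℝ 2 τ)]

/-- Construction of a design from the eigenvectors and eigenvalues of its covariance operator and
of the operator `C R`. -/
theorem IsPenalty.exists_design (h : IsPenalty ι p H₀) {e : ℕ → Lp ℝ 2 τ}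
    (he : Orthonormal ℝ e) {m n : ℕ → ℝ} (hm : ∀ k, 0 < m k) (hm_anti : Antitone m)
    (hm_sum : Summable m) (hn : ∀ k, 0 < n k) (hn_anti : Antitone n) {v : ℕ → H}
    (hv : ∀ j k, ⟪e k, ι (v j)⟫ = if j = k then n j / m j else 0)
    (hproj : ∀ f j, ⟪H₀ᗮ.starProjection f, H₀ᗮ.starProjection (v j)⟫ = (1 - n j) * ⟪ι f, e j⟫)
    (hnd : ∀ f : H, p f = 0 → (∀ k, ⟪e k, ι f⟫ = 0) → f = 0) :
    ∃ D : Design ι p, D.μ = m ∧ D.ν = n ∧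
      (∀ f : Lp ℝ 2 τ, Integrable (fun x => ⟪f, x - ∫ y, y ∂D.law⟫ ^ 4) D.law) ∧
      ∀ f : Lp ℝ 2 τ, ∫ x, ⟪f, x - ∫ y, y ∂D.law⟫ ^ 4 ∂D.law
        ≤ 3 * (∫ x, ⟪f, x - ∫ y, y ∂D.law⟫ ^ 2 ∂D.law) ^ 2 := by
  obtain ⟨Q, hQ, hmem, hmean, hcov, hint, hfour⟩ :=
    exists_law_of_orthonormal he (fun k => (hm k).le) hm_sum
  obtain ⟨C, hC1, hC2⟩ := exists_operator_of_orthonormal he (fun k => (hm k).le) hm_sum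
  have hcov' : ∀ f g, ⟪C f, g⟫ = covarianceBilin Q f g := fun f g => by
    rw [covarianceBilin_apply hmem]
    simp only [id_eq, hmean, sub_zero]
    exact (hC1 f g).unique (hcov f g)
  have hsymm : ∀ f g, ⟪C f, g⟫ = ⟪C g, f⟫ := fun f g => by
    rw [hcov', hcov', covarianceBilin_comm]
  have hpos : ∀ f, 0 ≤ ⟪C f, f⟫ := fun f => by
    rw [hcov']; exact covarianceBilin_self_nonneg f
  have hCone : ∀ (f : Lp ℝ 2 τ) (j : ℕ) (x : ℝ), (∀ k, ⟪e k, f⟫ = if j = k then x else 0) →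
      C f = (m j * x) • e j := fun f j x hf => by
    have h1 : HasSum (fun k => (m k * ⟪e k, f⟫) • e k) ((m j * ⟪e j, f⟫) • e j) :=
      hasSum_single j fun k hk => by rw [hf, if_neg (Ne.symm hk), mul_zero, zero_smul]
    rw [(hC2 f).unique h1, hf, if_pos rfl]
  have hCe : ∀ j, C (e j) = m j • e j := fun j => by
    rw [hCone (e j) j 1 fun k => ?_, mul_one]
    rw [orthonormal_iff_ite.1 he]
    simp [eq_comm]
  have hCzero : ∀ f, (∀ k, ⟪e k, f⟫ = 0) → C f = 0 := fun f hf => by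
    rw [hCone f 0 0 fun k => by simp [hf k], mul_zero, zero_smul]
  have hCv : ∀ j, C (ι (v j)) = n j • e j := fun j => by
    rw [hCone _ j _ (hv j), mul_div_cancel₀ _ (hm j).ne']
  have hnd' : ∀ f : H, p f = 0 → f ≠ 0 → C (ι f) ≠ 0 := fun f hf hf0 hCf => by
    refine hf0 (hnd f hf fun k => ?_)
    have h1 := hsymm (ι f) (e k)
    rw [hCf, inner_zero_left, hCe, inner_smul_left] at h1
    exact (mul_eq_zero.1 h1.symm).resolve_left (hm k).ne'
  obtain ⟨κ, R, hκ, hR, hRpos, hRrep⟩ := h.exists_kernel_operator hsymm hpos hnd'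
  -- The covariance and penalty parts of ⟨f, v_j⟩_R are n_j ⟨f, e_j⟩ and (1 - n_j) ⟨f, e_j⟩, so v_j
  -- represents f ↦ ⟨f, e_j⟩.
  have hRe : ∀ j, R (e j) = ι (v j) := fun j => hRrep _ _ fun f => by
    rw [h.rInner_eq hsymm, hproj, hsymm, hCv, inner_smul_left, real_inner_comm (ι f)]
    simp only [conj_trivial]
    ring
  obtain ⟨S, hS, hSS⟩ := exists_isPositive_sqrt hRpos
  have hSsymm : ∀ f g, ⟪S f, g⟫ = ⟪f, S g⟫ := hS.isSymmetric
  have hSSe : ∀ f, S (S f) = R f := fun f => by rw [← hSS]; rfl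
  -- Since C R e_j = n_j e_j, the vector S e_j is an eigenvector of S C S with eigenvalue n_j. Its
  -- squared norm ⟨e_j, R e_j⟩ = n_j/m_j explains the normalization.
  refine ⟨⟨Q, hQ, hmem, C, hcov', hnd', m, e, ⟨he, hm_anti, hCe, hCzero⟩, κ, hκ, R, hR, S, hS, hSS,
    n, fun j => √(m j / n j) • S (e j), ⟨?_, hn_anti, fun j => ?_, fun f hf => ?_⟩⟩, rfl, rfl,
    ?_, ?_⟩
  · rw [orthonormal_iff_ite]
    intro i j
    rw [inner_smul_left, inner_smul_right, hSsymm, hSSe, hRe, hv]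
    by_cases hij : i = j
    · subst hij
      have h1 := Real.mul_self_sqrt (div_pos (hm i) (hn i)).le
      simp only [conj_trivial, if_true]
      rw [← mul_assoc, h1]
      have := (hm i).ne'
      have := (hn i).ne'
      field_simp
    · simp [hij, Ne.symm hij]
  · change S (C (S (√(m j / n j) • S (e j)))) = _
    rw [map_smul, hSSe, map_smul, hRe, hCv, map_smul, map_smul, smul_comm]
  · change S (C (S f)) = 0
    rw [hCzero, map_zero]
    intro k
    have h1 := hf k
    rw [inner_smul_left, hSsymm] at h1
    exact (mul_eq_zero.1 h1).resolve_left (Real.sqrt_pos.2 (div_pos (hm k) (hn k))).ne'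
  · simpa only [hmean, sub_zero] using hint
  · simpa only [hmean, sub_zero] using hfour

end DesignOfBasis

end FLR


namespace FLR

/-! ### Orthonormal vectors adapted to a finite-dimensional subspace and to the kernel K. -/

section OrthogonalSystem

variable {E : Type*} [NormedAddCommGroup E] [InnerProductSpace ℝ E]

theorem inner_block_sum {ψ : ℕ → E} (hψ : Orthonormal ℝ ψ) (d : ℕ) (x y : Fin d → ℝ) (j k : ℕ) :
    ⟪∑ i, x i • ψ (d * j + i), ∑ i, y i • ψ (d * k + i)⟫
      = if j = k then ∑ i, x i * y i else 0 := by
  split_ifs with h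
  · subst h
    have h1 : Orthonormal ℝ fun i : Fin d => ψ (d * j + i) :=
      hψ.comp _ fun a b hab => Fin.ext (Nat.add_left_cancel hab)
    rw [h1.inner_sum]
    simp
  · rw [sum_inner]
    refine Finset.sum_eq_zero fun a _ => ?_
    rw [inner_sum]
    refine Finset.sum_eq_zero fun b _ => ?_
    have hne : d * j + a ≠ d * k + b := by
      intro hab
      refine h ?_
      have h1 : (d * j + a) / d = j := by
        rw [Nat.mul_add_div (a.pos), Nat.div_eq_of_lt a.2, add_zero]
      have h2 : (d * k + b) / d = k := by
        rw [Nat.mul_add_div (a.pos), Nat.div_eq_of_lt b.2, add_zero]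
      rw [← h1, hab, h2]
    rw [inner_smul_left, inner_smul_right, hψ.2 hne]
    simp

/-- Given the eigenvectors `ψ` of `A` and a finite-dimensional subspace `V`, blocks of eigenvectors
contain unit vectors `θ` such that `θ` and `A θ` are orthogonal to `V`. -/
theorem exists_orthonormal_orthogonal {A : E →L[ℝ] E} {ρ : ℕ → ℝ} {ψ : ℕ → E}
    (hψ : Orthonormal ℝ ψ) (hA : ∀ k, A (ψ k) = ρ k • ψ k) (hρ : Antitone ρ)
    (V : Submodule ℝ E) [FiniteDimensional ℝ V] :
    ∃ (d : ℕ) (θ : ℕ → E) (κ : ℕ → ℝ), 0 < d ∧ Orthonormal ℝ θ ∧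
      (∀ k, ∀ x ∈ V, ⟪x, θ k⟫ = 0) ∧ (∀ k, ∀ x ∈ V, ⟪x, A (θ k)⟫ = 0) ∧
      (∀ j k, ⟪θ k, A (θ j)⟫ = if j = k then κ k else 0) ∧
      ∀ k, ρ (d * (k + 1)) ≤ κ k ∧ κ k ≤ ρ (d * k) := by
  -- Orthogonality of a vector and of its image under A to V amounts to 2 dim V linear conditions,
  -- so a block of one more eigenvector contains a nonzero solution.
  set d := 2 * Module.finrank ℝ V + 1 with hd
  have hex : ∀ k, ∃ c : Fin d → ℝ, ∑ i, c i * c i = 1 ∧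
      (∀ x ∈ V, ⟪x, ∑ i, c i • ψ (d * k + i)⟫ = 0) ∧
      ∀ x ∈ V, ⟪x, A (∑ i, c i • ψ (d * k + i))⟫ = 0 := by
    intro k
    let P : E →L[ℝ] V := V.orthogonalProjectionOnto
    let g : (Fin d → ℝ) →ₗ[ℝ] E := Fintype.linearCombination ℝ fun i : Fin d => ψ (d * k + i)
    have hg : ∀ c, g c = ∑ i, c i • ψ (d * k + i) := fun c => rfl
    let B : (Fin d → ℝ) →ₗ[ℝ] V × V :=
      (P.toLinearMap ∘ₗ g).prod (P.toLinearMap ∘ₗ A.toLinearMap ∘ₗ g)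
    have hker : LinearMap.ker B ≠ ⊥ := LinearMap.ker_ne_bot_of_finrank_lt (by
      rw [Module.finrank_prod, Module.finrank_fin_fun]
      omega)
    obtain ⟨c, hc, hc0⟩ := Submodule.exists_mem_ne_zero_of_ne_bot hker
    have hB : B c = 0 := hc
    have hB1 : P (g c) = 0 := congrArg Prod.fst hB
    have hB2 : P (A (g c)) = 0 := congrArg Prod.snd hB
    have horth : ∀ y, P y = 0 → ∀ x ∈ V, ⟪x, y⟫ = 0 := fun y hy x hx => by
      have h1 : ⟪x, y - V.starProjection y⟫ = 0 := V.sub_starProjection_mem_orthogonal y x hx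
      have h2 : V.starProjection y = 0 := congrArg Subtype.val hy
      rwa [h2, sub_zero] at h1
    set q := ∑ i, c i * c i with hq
    have hq0 : 0 < q := by
      obtain ⟨i, hi⟩ := Function.ne_iff.1 hc0
      exact Finset.sum_pos' (fun i _ => mul_self_nonneg _)
        ⟨i, Finset.mem_univ _, mul_self_pos.2 hi⟩
    have hsum : ∑ i, ((√q)⁻¹ * c i) • ψ (d * k + i) = (√q)⁻¹ • g c := by
      rw [hg, Finset.smul_sum]
      simp only [smul_smul]
    refine ⟨fun i => (√q)⁻¹ * c i, ?_, fun x hx => ?_, fun x hx => ?_⟩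
    · have h1 : ∀ i, (√q)⁻¹ * c i * ((√q)⁻¹ * c i) = q⁻¹ * (c i * c i) := fun i => by
        rw [mul_mul_mul_comm, ← mul_inv, Real.mul_self_sqrt hq0.le]
      simp only [h1]
      rw [← Finset.mul_sum, ← hq, inv_mul_cancel₀ hq0.ne']
    · rw [hsum, inner_smul_right, horth _ hB1 x hx, mul_zero]
    · rw [hsum, map_smul, inner_smul_right, horth _ hB2 x hx, mul_zero]
  choose c hc1 hc2 hc3 using hex
  have hAθ : ∀ k, A (∑ i, c k i • ψ (d * k + i))
      = ∑ i : Fin d, (c k i * ρ (d * k + i)) • ψ (d * k + i) := fun k => by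
    rw [map_sum]
    simp only [map_smul, hA, smul_smul]
  -- Here κ_k is the average of the eigenvalues of the k-th block with weights c², which places it
  -- between the values of ρ at d(k+1) and at dk.
  refine ⟨d, fun k => ∑ i, c k i • ψ (d * k + i), fun k => ∑ i, c k i * (c k i * ρ (d * k + i)),
    by omega, ?_, hc2, hc3, fun j k => ?_, fun k => ⟨?_, ?_⟩⟩
  · rw [orthonormal_iff_ite]
    intro j k
    rw [inner_block_sum hψ]
    split_ifs with h
    · subst h; exact hc1 j
    · rfl
  · rw [hAθ, inner_block_sum hψ]
    by_cases h : j = k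
    · subst h; simp
    · simp [h, Ne.symm h]
  · calc ρ (d * (k + 1)) = ∑ i, c k i * c k i * ρ (d * (k + 1)) := by
          rw [← Finset.sum_mul, hc1, one_mul]
      _ ≤ _ := Finset.sum_le_sum fun i _ => by
          rw [← mul_assoc]
          refine mul_le_mul_of_nonneg_left (hρ ?_) (mul_self_nonneg _)
          have := i.2
          rw [mul_add, mul_one]
          omega
  · calc _ ≤ ∑ i, c k i * c k i * ρ (d * k) := Finset.sum_le_sum fun i _ => by
          rw [← mul_assoc]
          exact mul_le_mul_of_nonneg_left (hρ (by omega)) (mul_self_nonneg _)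
      _ = ρ (d * k) := by rw [← Finset.sum_mul, hc1, one_mul]

theorem exists_finite_orthonormal (V : Submodule ℝ E) [FiniteDimensional ℝ V] :
    ∃ (N : ℕ) (u : ℕ → E), (∀ j < N, u j ∈ V) ∧
      (∀ i < N, ∀ j < N, ⟪u i, u j⟫ = if i = j then 1 else 0) ∧
      ∀ x ∈ V, (∀ j < N, ⟪u j, x⟫ = 0) → x = 0 := by
  let b := stdOrthonormalBasis ℝ V
  have hb : ∀ j (hj : j < Module.finrank ℝ V),
      (if h : j < Module.finrank ℝ V then (b ⟨j, h⟩ : E) else 0) = b ⟨j, hj⟩ := fun j hj =>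
    dif_pos hj
  refine ⟨Module.finrank ℝ V, fun j => if h : j < Module.finrank ℝ V then b ⟨j, h⟩ else 0,
    fun j hj => ?_, fun i hi j hj => ?_, fun x hx h0 => ?_⟩
  · dsimp only
    rw [hb j hj]
    exact (b ⟨j, hj⟩).2
  · dsimp only
    rw [hb i hi, hb j hj, ← Submodule.coe_inner, orthonormal_iff_ite.1 b.orthonormal]
    simp
  · have h1 : (⟨x, hx⟩ : V) = 0 := by
      refine b.toBasis.ext_elem fun i => ?_
      have h2 := h0 i i.2
      dsimp only at h2
      rw [hb i i.2] at h2
      rw [OrthonormalBasis.coe_toBasis_repr_apply, OrthonormalBasis.coe_toBasis_repr_apply,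
        b.repr_apply_apply, map_zero]
      exact h2
    exact congrArg Subtype.val h1

end OrthogonalSystem

section Kernel

variable {T H : Type*} [MeasurableSpace T] {τ : Measure T}
  [NormedAddCommGroup H] [InnerProductSpace ℝ H] [CompleteSpace H] [RKHS ℝ H T ℝ]
  {ι : H →ₗ[ℝ] Lp ℝ 2 τ} {H₀ : Submodule ℝ H} [FiniteDimensional ℝ H₀]

/-- The representer is the projection of ι* u on the complement of H₀, and evaluating it by the
reproducing property yields the integral operator. It supplies elements of H with prescribed
pairings in the penalty form. -/
theorem exists_orthogonal_representer (hι : ∀ f : H, ι f =ᵐ[τ] f)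
    {K : T → T → ℝ} (hK : IsReproducingKernel (H₀ᗮ : Set H) (fun f g => ⟪f, g⟫) K)
    {A : Lp ℝ 2 τ →L[ℝ] Lp ℝ 2 τ} (hA : IsIntegralOperator K A) (u : Lp ℝ 2 τ) :
    ∃ G ∈ H₀ᗮ, ι G = A u ∧ ∀ f ∈ H₀ᗮ, ⟪f, G⟫ = ⟪ι f, u⟫ := by
  let L : H →L[ℝ] Lp ℝ 2 τ := ⟨ι, inclusion_continuous hι⟩
  have hGm : H₀ᗮ.starProjection (L.adjoint u) ∈ H₀ᗮ := Submodule.starProjection_apply_mem _ _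
  have hG : ∀ f ∈ H₀ᗮ, ⟪f, H₀ᗮ.starProjection (L.adjoint u)⟫ = ⟪ι f, u⟫ := fun f hf => by
    rw [← Submodule.inner_starProjection_left_eq_right, Submodule.starProjection_eq_self_iff.2 hf,
      ContinuousLinearMap.adjoint_inner_right]
    rfl
  refine ⟨_, hGm, Lp.ext ?_, hG⟩
  filter_upwards [hι (H₀ᗮ.starProjection (L.adjoint u)), hA u] with t h1 h2
  obtain ⟨g, hg, hg1, hg2⟩ := hK t
  rw [h1, h2, ← hg2 _ hGm]
  dsimp only
  rw [real_inner_comm, hG g hg, L2.inner_def]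
  refine integral_congr_ae ?_
  filter_upwards [hι g] with x hx
  obtain ⟨g', hg', hg1', hg2'⟩ := hK x
  have h3 : g x = K t x := by
    rw [← hg2' g hg, ← hg1' t, ← hg2 g' hg']
    exact real_inner_comm _ _
  rw [hx, h3]
  simp only [RCLike.inner_apply, conj_trivial]
  rw [mul_comm]

end Kernel

end FLR


namespace FLR

/-! ### Calculus of the relation ≍. -/

section Comparison

theorem rpow_neg_le_mul_rpow_neg {x y c t : ℝ} (hx : 0 < x) (hy : 0 < y) (hc : 0 < c)
    (ht : 0 ≤ t) (h : x ≤ c * y) : y ^ (-t) ≤ c ^ t * x ^ (-t) := by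
  have h1 : (c * y) ^ (-t) ≤ x ^ (-t) := Real.rpow_le_rpow_of_nonpos hx h (neg_nonpos.2 ht)
  rw [Real.mul_rpow hc.le hy.le, Real.rpow_neg hc.le] at h1
  rwa [inv_mul_le_iff₀ (Real.rpow_pos_of_pos hc t)] at h1

theorem AsympEquiv.trans {u v w : ℕ → ℝ} (h₁ : AsympEquiv u v) (h₂ : AsympEquiv v w) :
    AsympEquiv u w := by
  obtain ⟨A, k₀, hA, hA'⟩ := h₁
  obtain ⟨B, k₁, hB, hB'⟩ := h₂
  refine ⟨A * B, max k₀ k₁, mul_pos hA hB, fun k hk => ?_⟩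
  have h1 := hA' k ((le_max_left _ _).trans hk)
  have h2 := hB' k ((le_max_right _ _).trans hk)
  constructor
  · rw [mul_assoc]
    exact h1.1.trans (by gcongr; exact h2.1)
  · rw [mul_comm A, mul_assoc]
    exact h2.2.trans (by gcongr; exact h1.2)

theorem AsympEquiv.symm {u v : ℕ → ℝ} (h : AsympEquiv u v) : AsympEquiv v u := by
  obtain ⟨A, k₀, hA, h⟩ := h
  exact ⟨A, k₀, hA, fun k hk => (h k hk).symm⟩

theorem AsympEquiv.mul_right {u v : ℕ → ℝ} (h : AsympEquiv u v) {w : ℕ → ℝ} (hw : ∀ k, 0 ≤ w k) :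
    AsympEquiv (fun k => u k * w k) fun k => v k * w k := by
  obtain ⟨A, k₀, hA, h⟩ := h
  refine ⟨A, k₀, hA, fun k hk => ?_⟩
  rw [← mul_assoc, ← mul_assoc]
  exact ⟨mul_le_mul_of_nonneg_right (h k hk).1 (hw k),
    mul_le_mul_of_nonneg_right (h k hk).2 (hw k)⟩

/-- Powers of two sequences of indices whose ratio is bounded are comparable. -/
theorem asympEquiv_rpow_neg {x y : ℕ → ℝ} {c t : ℝ} {k₀ : ℕ} (hx : ∀ k, 0 < x k)
    (hy : ∀ k, 0 < y k) (hc : 0 < c) (ht : 0 ≤ t) (hxy : ∀ k, k₀ ≤ k → x k ≤ c * y k)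
    (hyx : ∀ k, k₀ ≤ k → y k ≤ c * x k) :
    AsympEquiv (fun k => x k ^ (-t)) fun k => y k ^ (-t) :=
  ⟨c ^ t, k₀, Real.rpow_pos_of_pos hc t, fun k hk =>
    ⟨rpow_neg_le_mul_rpow_neg (hy k) (hx k) hc ht (hyx k hk),
      rpow_neg_le_mul_rpow_neg (hx k) (hy k) hc ht (hxy k hk)⟩⟩

theorem pos_of_asympEquiv_rpow {ρ : ℕ → ℝ} {r : ℝ} (hanti : Antitone ρ)
    (hρ : AsympEquiv ρ fun k => ((k : ℝ) + 1) ^ (-(2 * r))) (k : ℕ) : 0 < ρ k := by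
  obtain ⟨A, k₀, hA, h⟩ := hρ
  have h1 := (h (max k k₀) (le_max_right _ _)).2
  have h2 : (0 : ℝ) < ((max k k₀ : ℕ) + 1 : ℝ) ^ (-(2 * r)) := by positivity
  exact (pos_of_mul_pos_right (h2.trans_le h1) hA.le).trans_le (hanti (le_max_left _ _))

/-- Dilating the index by d and shifting it by N changes a power of the index by bounded factors
only, so averages over blocks decay like ρ itself. -/
theorem asympEquiv_of_blocks {ρ κ : ℕ → ℝ} {r : ℝ} {d N : ℕ} (hr : 0 ≤ r) (hd : 0 < d)
    (hρ : AsympEquiv ρ fun k => ((k : ℝ) + 1) ^ (-(2 * r)))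
    (hκ : ∀ k, ρ (d * (k + 1)) ≤ κ k ∧ κ k ≤ ρ (d * k)) :
    AsympEquiv (fun j => κ (j - N)) ρ := by
  refine AsympEquiv.trans ?_ hρ.symm
  obtain ⟨A, k₀, hA, h⟩ := hρ
  set c : ℝ := (N + 1) * (d + 1) with hc
  have hc0 : 0 < c := by positivity
  refine ⟨A * c ^ (2 * r), k₀ + N, by positivity, fun j hj => ?_⟩
  obtain ⟨k, rfl⟩ : ∃ k, j = k + N := ⟨j - N, by omega⟩
  have hk : k₀ ≤ k := by omega
  have hdk : k ≤ d * k := Nat.le_mul_of_pos_left k hd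
  have hdk' : k + 1 ≤ d * (k + 1) := Nat.le_mul_of_pos_left _ hd
  have h1 := (h (d * k) (by omega)).1
  have h2 := (h (d * (k + 1)) (by omega)).2
  have hdkR : (k : ℝ) ≤ ((d * k : ℕ) : ℝ) := by exact_mod_cast hdk
  have hk0 : (0 : ℝ) ≤ k := k.cast_nonneg
  have hN0 : (0 : ℝ) ≤ N := N.cast_nonneg
  have hd0 : (0 : ℝ) ≤ d := d.cast_nonneg
  simp only [Nat.add_sub_cancel]
  constructor
  · refine (hκ k).2.trans (h1.trans ?_)
    rw [mul_assoc]
    refine mul_le_mul_of_nonneg_left ?_ hA.le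
    refine rpow_neg_le_mul_rpow_neg (by positivity) (by positivity) hc0 (by positivity) ?_
    have h3 : ((k + N : ℕ) : ℝ) + 1 ≤ (N + 1) * (k + 1) := by
      push_cast
      nlinarith
    calc _ ≤ _ := h3
      _ ≤ (N + 1) * (d + 1) * (k + 1) := by nlinarith [mul_nonneg hN0 hk0]
      _ ≤ _ := by gcongr
  · have h3 : (((k + N : ℕ) : ℝ) + 1) ^ (-(2 * r))
        ≤ c ^ (2 * r) * (((d * (k + 1) : ℕ) : ℝ) + 1) ^ (-(2 * r)) := by
      refine rpow_neg_le_mul_rpow_neg (by positivity) (by positivity) hc0 (by positivity) ?_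
      push_cast
      have h5 : (1 : ℝ) ≤ N + 1 := by linarith
      calc (d : ℝ) * (k + 1) + 1 ≤ (d + 1) * (k + N + 1) := by
            nlinarith [mul_nonneg hd0 hN0]
        _ ≤ (N + 1) * ((d + 1) * (k + N + 1)) := le_mul_of_one_le_left (by positivity) h5
        _ = _ := by rw [hc]; ring
    have hcr : 0 ≤ c ^ (2 * r) := by positivity
    calc _ ≤ _ := h3
      _ ≤ c ^ (2 * r) * (A * ρ (d * (k + 1))) := by gcongr
      _ ≤ c ^ (2 * r) * (A * κ k) := by gcongr; exact (hκ k).1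
      _ = _ := by ring

end Comparison

/-! ### Nonemptiness of the class. -/

section Existence

variable {T H : Type*} [MeasurableSpace T] {τ : Measure T}
  [NormedAddCommGroup H] [InnerProductSpace ℝ H] [CompleteSpace H] [RKHS ℝ H T ℝ]
  {ι : H →ₗ[ℝ] Lp ℝ 2 τ} {p : Seminorm ℝ H} {H₀ : Submodule ℝ H} [FiniteDimensional ℝ H₀]
  [SecondCountableTopology (Lp ℝ 2 τ)]

/-- The class of designs is nonempty. -/
theorem IsPenalty.exists_inClass (h : IsPenalty ι p H₀) (hinj : Function.Injective ι)
    {K : T → T → ℝ} (hK : IsReproducingKernel (H₀ᗮ : Set H) (fun f g => ⟪f, g⟫) K)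
    {opK : Lp ℝ 2 τ →L[ℝ] Lp ℝ 2 τ} (hopK : IsIntegralOperator K opK)
    {ρ : ℕ → ℝ} {ψ : ℕ → Lp ℝ 2 τ} (hψ : IsEigenSystem opK ρ ψ) {r s M : ℝ}
    (hr : 0 ≤ r) (hs : 1 / 2 < s) (hM : 3 ≤ M)
    (hρ : AsympEquiv ρ fun k => ((k : ℝ) + 1) ^ (-(2 * r))) :
    ∃ D : Design ι p, D.InClass ρ s M := by
  have hρ0 := pos_of_asympEquiv_rpow hψ.antitone hρ
  obtain ⟨N, u, huV, huu, hu0⟩ := exists_finite_orthonormal (H₀.map ι)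
  obtain ⟨d, θ, κ, hd, hθ, hθV, hAθV, hAθ, hκ⟩ :=
    exists_orthonormal_orthogonal hψ.orthonormal hψ.eigen hψ.antitone (H₀.map ι)
  have hκ0 : ∀ k, 0 < κ k := fun k => (hρ0 _).trans_le (hκ k).1
  have hκa : Antitone κ := antitone_nat_of_succ_le fun k => (hκ (k + 1)).2.trans (hκ k).1
  choose b hb hιb using huV
  choose G hGm hιG hG using fun k => exists_orthogonal_representer h.incl hK hopK (θ k)
  -- The first N vectors span ι(H₀). The penalty vanishes there, which forces n_j = 1, and m_j = 1
  -- then fits with v_j in H₀. On θ_k the choice v = (1 - n) G_k turns the first condition of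
  -- `IsPenalty.exists_design` into n/m = (1 - n) κ_k, so n/(1 - n) = m κ_k is exactly γ.
  -- Orthogonality of θ_k and of its image to ι(H₀) decouples the two parts.
  set e : ℕ → Lp ℝ 2 τ := fun j => if j < N then u j else θ (j - N) with he
  set m : ℕ → ℝ := fun j => (((j - N : ℕ) : ℝ) + 1) ^ (-(2 * s)) with hm
  set n : ℕ → ℝ := fun j => if j < N then 1 else 1 - (1 + m j * κ (j - N))⁻¹ with hn
  set v : ℕ → H := fun j => if hj : j < N then b j hj else (1 - n j) • G (j - N) with hv
  have he1 : ∀ j, j < N → e j = u j := fun j hj => if_pos hj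
  have he2 : ∀ k, e (k + N) = θ k := fun k => by simp [he]
  have hm0 : ∀ j, 0 < m j := fun j => by positivity
  have hm1 : ∀ j, j < N → m j = 1 := fun j hj => by simp [hm, Nat.sub_eq_zero_of_le hj.le]
  have hn1 : ∀ j, j < N → n j = 1 := fun j hj => if_pos hj
  have hn2 : ∀ k, n (k + N) = 1 - (1 + m (k + N) * κ k)⁻¹ := fun k => by simp [hn]
  have hv1 : ∀ j (hj : j < N), v j = b j hj := fun j hj => dif_pos hj
  have hv2 : ∀ k, v (k + N) = (1 - n (k + N)) • G k := fun k => by simp [hv]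
  have hcases : ∀ j, j < N ∨ ∃ k, j = k + N := fun j => by
    rcases lt_or_ge j N with hj | hj
    · exact Or.inl hj
    · exact Or.inr ⟨j - N, by omega⟩
  have hmκ : ∀ k, 0 < m (k + N) * κ k := fun k => mul_pos (hm0 _) (hκ0 k)
  have huθ : ∀ j (_ : j < N) k, ⟪u j, θ k⟫ = 0 := fun j hj k =>
    hθV k _ (hιb j hj ▸ Submodule.mem_map_of_mem (hb j hj))
  have he_orth : Orthonormal ℝ e := by
    rw [orthonormal_iff_ite]
    intro i j
    rcases hcases i with hi | ⟨i, rfl⟩ <;> rcases hcases j with hj | ⟨j, rfl⟩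
    · rw [he1 i hi, he1 j hj, huu i hi j hj]
    · rw [he1 i hi, he2, huθ i hi, if_neg (by omega)]
    · rw [he1 j hj, he2, real_inner_comm, huθ j hj, if_neg (by omega)]
    · rw [he2, he2, orthonormal_iff_ite.1 hθ]
      simp
  have hm_anti : Antitone m := fun i j hij => by
    refine Real.rpow_le_rpow_of_nonpos (by positivity) ?_ (by linarith)
    gcongr
  have hm_asymp : AsympEquiv m fun k => ((k : ℝ) + 1) ^ (-(2 * s)) := by
    refine asympEquiv_rpow_neg (c := N + 1) (k₀ := N) (fun k => by positivity)
      (fun k => by positivity) (by positivity) (by linarith) (fun j hj => ?_) fun j hj => ?_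
    · have h1 : ((j - N : ℕ) : ℝ) ≤ j := by exact_mod_cast Nat.sub_le j N
      have h2 : (0 : ℝ) ≤ N * (j + 1) := by positivity
      linarith
    · have h1 : (j : ℝ) = ((j - N : ℕ) : ℝ) + N := by exact_mod_cast (Nat.sub_add_cancel hj).symm
      have h2 : (0 : ℝ) ≤ N * ((j - N : ℕ) : ℝ) := by positivity
      rw [h1]
      linarith
  have hm_sum : Summable m := by
    rw [← summable_nat_add_iff N]
    have h1 : Summable fun k : ℕ => ((k : ℝ)) ^ (-(2 * s)) :=
      Real.summable_nat_rpow.2 (by linarith)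
    have h2 := (summable_nat_add_iff 1).2 h1
    refine h2.congr fun k => ?_
    simp [hm]
  have hn0 : ∀ j, 0 < n j := fun j => by
    rcases hcases j with hj | ⟨k, rfl⟩
    · rw [hn1 j hj]; exact one_pos
    · rw [hn2, sub_pos]
      exact inv_lt_one_of_one_lt₀ (by linarith [hmκ k])
  have hn_anti : Antitone n := by
    refine antitone_nat_of_succ_le fun j => ?_
    rcases hcases j with hj | ⟨k, rfl⟩
    · rw [hn1 j hj]
      rcases hcases (j + 1) with hj' | ⟨k, hk⟩
      · rw [hn1 _ hj']
      · rw [hk, hn2, sub_le_self_iff, inv_nonneg]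
        linarith [hmκ k]
    · rw [show k + N + 1 = (k + 1) + N by ring, hn2, hn2]
      refine sub_le_sub_left (inv_anti₀ (by linarith [hmκ (k + 1)]) ?_) _
      have h1 : m (k + 1 + N) ≤ m (k + N) := hm_anti (by omega)
      have h2 : κ (k + 1) ≤ κ k := hκa (by omega)
      have := mul_le_mul h1 h2 (hκ0 _).le (hm0 _).le
      linarith
  have hvin : ∀ j k, ⟪e k, ι (v j)⟫ = if j = k then n j / m j else 0 := by
    intro j k
    rcases hcases j with hj | ⟨j, rfl⟩
    · rw [hv1 j hj, hιb, hn1 j hj, hm1 j hj, div_one, ← he1 j hj, orthonormal_iff_ite.1 he_orth]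
      simp [eq_comm]
    · rw [hv2, map_smul, inner_smul_right, hιG]
      rcases hcases k with hk | ⟨k, rfl⟩
      · rw [he1 k hk, hAθV j _ (hιb k hk ▸ Submodule.mem_map_of_mem (hb k hk)), mul_zero,
          if_neg (by omega)]
      · rw [he2, hAθ]
        by_cases hjk : j = k
        · subst hjk
          have h1 := hmκ j
          have h2 := (hm0 (j + N)).ne'
          rw [if_pos rfl, if_pos rfl, hn2]
          field_simp
          ring
        · rw [if_neg hjk, if_neg (by omega), mul_zero]
  have hvproj : ∀ f j, ⟪H₀ᗮ.starProjection f, H₀ᗮ.starProjection (v j)⟫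
      = (1 - n j) * ⟪ι f, e j⟫ := by
    intro f j
    have hfV : ι f = ι (H₀.starProjection f) + ι (H₀ᗮ.starProjection f) := by
      rw [← map_add]
      congr 1
      simp [Submodule.starProjection_orthogonal]
    rcases hcases j with hj | ⟨k, rfl⟩
    · have h1 : H₀ᗮ.starProjection (v j) = 0 := by
        rw [hv1 j hj, Submodule.starProjection_orthogonal]
        simp [Submodule.starProjection_eq_self_iff.2 (hb j hj)]
      rw [h1, inner_zero_right, hn1 j hj, sub_self, zero_mul]
    · have h1 : ⟪ι (H₀.starProjection f), θ k⟫ = 0 :=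
        hθV k _ (Submodule.mem_map_of_mem (Submodule.starProjection_apply_mem _ _))
      rw [hv2, map_smul, inner_smul_right, Submodule.starProjection_eq_self_iff.2 (hGm k),
        hG k _ (Submodule.starProjection_apply_mem _ _), he2, hfV, inner_add_left, h1, zero_add]
  have hnd : ∀ f : H, p f = 0 → (∀ k, ⟪e k, ι f⟫ = 0) → f = 0 := by
    intro f hf hf0
    have hfm : f ∈ H₀ := (h.null f).2 hf
    refine hinj ?_
    rw [map_zero]
    refine hu0 _ (Submodule.mem_map_of_mem hfm) fun j hj => ?_
    rw [← he1 j hj]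
    exact hf0 j
  obtain ⟨D, hDm, hDn, hD1, hD2⟩ :=
    h.exists_design he_orth hm0 hm_anti hm_sum hn0 hn_anti hvin hvproj hnd
  have hγ : AsympEquiv D.γ fun k => ρ k * D.μ k := by
    have h1 := (asympEquiv_of_blocks (N := N) hr hd hρ hκ).mul_right (fun k => (hm0 k).le)
    obtain ⟨A, k₀, hA, h2⟩ := h1
    -- For j < N the eigenvalue ν_j = 1 makes γ_j infinite, represented by 0, so the comparison can
    -- start only at N.
    refine ⟨A, max k₀ N, hA, fun j hj => ?_⟩
    have h3 : D.γ j = κ (j - N) * m j := by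
      obtain ⟨k, rfl⟩ : ∃ k, j = k + N := ⟨j - N, by have := le_max_right k₀ N; omega⟩
      have h4 := hmκ k
      have h5 : (n (k + N))⁻¹ - 1 = (m (k + N) * κ k)⁻¹ := by
        rw [hn2]
        generalize m (k + N) * κ k = x at h4
        rw [show 1 - (1 + x)⁻¹ = x / (1 + x) by field_simp; ring, inv_div, add_div,
          div_self h4.ne', add_sub_cancel_right, one_div]
      rw [Design.γ, hDn, h5, Nat.add_sub_cancel, inv_inv, mul_comm]
    rw [h3, hDm]
    exact h2 j ((le_max_left _ _).trans hj)
  have hDμ : AsympEquiv D.μ fun k => ((k : ℝ) + 1) ^ (-(2 * s)) := hDm ▸ hm_asymp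
  obtain ⟨A, k₀, hA, h1⟩ := hDμ
  obtain ⟨A', k₀', hA', h2⟩ := hγ
  refine ⟨D, max A A', max k₀ k₀', ⟨⟨lt_max_of_lt_left hA, fun k hk => ?_⟩, hD1, fun f => ?_,
    ⟨lt_max_of_lt_left hA, fun k hk => ?_⟩⟩⟩
  · obtain ⟨h3, h4⟩ := h1 k ((le_max_left _ _).trans hk)
    have h5 : 0 ≤ D.μ k := hDm ▸ (hm0 k).le
    exact ⟨h3.trans (by gcongr; exact le_max_left _ _),
      h4.trans (by gcongr; exact le_max_left _ _)⟩
  · exact (hD2 f).trans (by gcongr)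
  · obtain ⟨h3, h4⟩ := h2 k ((le_max_right _ _).trans hk)
    have h5 : 0 ≤ D.μ k := hDm ▸ (hm0 k).le
    have h6 := hρ0 k
    have h7 : 0 ≤ D.γ k := by
      have : 0 ≤ A' * D.γ k := (mul_nonneg h6.le h5).trans h4
      exact nonneg_of_mul_nonneg_right this hA'
    exact ⟨h3.trans (by gcongr; exact le_max_right _ _),
      h4.trans (by gcongr; exact le_max_right _ _)⟩

end Existence

end FLR

/-! ### The theorem. -/

theorem theorem7 {m : ℕ} (𝒯 : Set (EuclideanSpace ℝ (Fin m))) (h𝒯 : IsCompact 𝒯)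
    (τ : Measure 𝒯) [IsFiniteMeasure τ]
    (H : Type*) [NormedAddCommGroup H] [InnerProductSpace ℝ H] [CompleteSpace H]
    [RKHS ℝ H 𝒯 ℝ]
    -- `H` is a subspace of the square integrable functions
    (ι : H →ₗ[ℝ] Lp ℝ 2 τ) (hι : ∀ f : H, ι f =ᵐ[τ] f) (hι_inj : Function.Injective ι)
    -- the penalty `J = p²`, with finite-dimensional null space `H₀`
    (p : Seminorm ℝ H) (H₀ : Submodule ℝ H) [FiniteDimensional ℝ H₀]
    (hH₀ : ∀ f, f ∈ H₀ ↔ p f = 0) (hp : ∀ f ∈ H₀ᗮ, p f = ‖f‖)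
    -- the reproducing kernel `K` of the orthogonal complement of `H₀`, and its eigenvalues
    (K : 𝒯 → 𝒯 → ℝ)
    (hK : FLR.IsReproducingKernel (H₀ᗮ : Set H) (fun f g => ⟪f, g⟫) K)
    (hK_cont : Continuous fun q : 𝒯 × 𝒯 => K q.1 q.2)
    (opK : Lp ℝ 2 τ →L[ℝ] Lp ℝ 2 τ) (hopK : FLR.IsIntegralOperator K opK)
    (ρ : ℕ → ℝ) (ψ : ℕ → Lp ℝ 2 τ) (hψ : FLR.IsEigenSystem opK ρ ψ)
    (r s M M₂ a α₀ : ℝ) (hr : 1 / 2 < r) (hs : 1 / 2 < s) (hM : 3 ≤ M) (hM₂ : 0 < M₂)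
    (ha0 : 0 ≤ a) (ha1 : a ≤ 1)
    (hρ : FLR.AsympEquiv ρ fun k => ((k : ℝ) + 1) ^ (-(2 * r))) :
    -- the lower bound
    (∃ d : ℝ, 0 < d ∧ ∀ noise : Measure ℝ, FLR.IsNoise M₂ noise →
      0 < liminf (fun n : ℕ => ⨅ b : FLR.Estimator τ n,
        ⨆ (D : FLR.Design ι p) (_ : D.InClass ρ s M) (β₀ : H),
          FLR.errProb D noise a α₀ β₀ b.1 (d * FLR.rate r s a n)) atTop) ∧
    -- rate optimality of the regularized estimator
    (∀ (A : ℝ) (k₀ : ℕ) (B : ℝ), 0 < B →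
      (∃ D : FLR.Design ι p, D.InClassWith ρ s M A k₀) →
      ∀ lam : ℕ → ℝ, (∀ n, 0 < lam n) →
        FLR.AsympEquiv lam (fun n => (n : ℝ) ^ (-(2 * (r + s) / (2 * (r + s) + 1)))) →
      ∀ βhat : ∀ n : ℕ, (Fin n → Lp ℝ 2 τ × ℝ) → H,
        (∀ n data, FLR.IsRegularized ι p (lam n) data (βhat n data)) →
        FLR.IsRateOptimal {D : FLR.Design ι p | D.InClassWith ρ s M A k₀} M₂ B a α₀
          (FLR.rate r s a) (fun n data => ι (βhat n data))) := by
  have h : FLR.IsPenalty ι p H₀ := ⟨hι, hH₀, hp⟩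
  have : Fact ((2 : ℝ≥0∞) ≠ ∞) := ⟨by norm_num⟩
  have hsc : SecondCountableTopology (Lp ℝ 2 τ) := inferInstance
  -- Any positive d serves in the first claim, since the bound for unrestricted slopes holds for
  -- every sequence of thresholds.
  refine ⟨⟨1, one_pos, fun noise hnoise => ?_⟩, fun A k₀ B hB hD lam hlam hlam' βhat hβ => ?_⟩
  · obtain ⟨D, hD⟩ := h.exists_inClass hι_inj hK hopK hψ (by linarith) hs hM hρ
    exact FLR.lower_bound_unbounded h hρ hD hnoise a α₀ _
  · obtain ⟨D, hD⟩ := hD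
    exact ⟨FLR.tendsto_limsup_worstProb h hr hs (by linarith) hM₂ hD.eigenvalues.1 hB ha0 ha1 hρ
      hlam hlam' hβ, FLR.lower_bound h hr hs hM₂ hB ha0 hρ hD⟩
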